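/- Let $4\le n\le\infty$, let $\Omega\subseteq\mathbb R^2$ be open, let $A_0,A_1,A_2,A_3:\Omega\to\mathbb R$ be of class $C^n$, and consider the ODE $$y''=A_0(x,y)+A_1(x,y)\,y'+A_2(x,y)\,(y')^2+A_3(x,y)\,(y')^3 .\qquad(1)$$ **Thomas symbols.** Write $(x^1,x^2)=(x,y)$. The Thomas symbols of (1) are the unique symmetric trace-free connection symbols whose unparametrised geodesics are given by (1): $$\Pi^1_{11}=\tfrac13A_1,\quad \Pi^1_{12}=\tfrac13A_2,\quad \Pi^1_{22}=A_3,\quad \Pi^2_{11}=-A_0,\quad \Pi^2_{12}=-\tfrac13A_1,\quad \Pi^2_{22}=-\tfrac13A_2 .$$ Equivalently, $\Pi^c_{ab}=\Gamma^c_{ab}-\frac13\Gamma^d_{da}\delta^c_b-\frac13\Gamma^d_{db}\delta^c_a$ for any torsion-free connection $\Gamma$ of the projective structure. Let $\nabla$ be the connection with these symbols, and let $P_{ab}=\partial_c\Pi^c_{ab}-\Pi^c_{ad}\Pi^d_{cb}$ be its (symmetric) Ricci $=$ Schouten tensor. **Invariants.** Let $\epsilon^{12}=\epsilon_{12}=1$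 be skew, and put $$L_b=\epsilon^{cd}\nabla_cP_{db},\qquad L^a=\epsilon^{ab}L_b,\qquad \nu_5=L^aL^b\nabla_aL_b .$$ On triples $(V^1,V^2,v)$ let $$D_a(V^b,v)=\big(\nabla_aV^b+\epsilon^{bc}P_{ca}v,\ \partial_av+\epsilon_{ab}V^b\big).$$ This is the dual of the prolongation connection $(K_b,\mu)\mapsto(\nabla_aK_b-\epsilon_{ab}\mu,\ \partial_a\mu-\epsilon^{bc}P_{ca}K_b)$ of the Killing equation $\nabla_{(a}K_{b)}=0$. With $V=(\frac13L^1,\frac13L^2,0)$ let $W_{abc}=\det\big(V,D_aV,D_{(b}D_{c)}V\big)$, where the second derivative is covariant with respect to $\nabla$ in its free index. Liouville's $w_1$ is $$w_1=-27\,W_{111}/L_1^3\ \text{ where } L_1\ne0,\qquad w_1=-27\,W_{222}/L_2^3\ \text{ where } L_1=0\ne L_2 .$$ **Coordinates.** Local coordinates $(X,Y)$ are a homeomorphism $\varphi=(X,Y)$ from an open subset of $\Omega$ onto an open subset of $\mathbb R^2$ that is of class $C^n$ together with its inverse. They bring (1) to the equation $$Y_{XX}=B_0+B_1Y_X+B_2Y_X^2+B_3Y_X^3,\qquad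 B_i=B_i(X,Y),$$ if, whenever $\varphi$ maps the graph of a twice differentiable function $y(x)$ on an open interval onto the graph of a twice differentiable function $Y(X)$ on an open interval, $y$ solves (1) if and only if $Y$ solves the second equation. **Theorem.** Let $p\in\Omega$ be a point at which the projective structure of (1) is not flat: $(L_1,L_2)(p)\neq(0,0)$. The following are equivalent. 1. There are local coordinates $(X,Y)$ near $p$ that bring (1) to the form $Y_{XX}=f(X,Y)$. 2. $\nu_5=w_1=0$ on a neighbourhood of $p$. 3. There are local coordinates $(X,Y)$ near $p$ that bring (1) to an equation cubic in $Y_X$ whose Thomas-symbol connection in the coordinates $(X,Y)$ admits $dX$ as a Killing $1$-form. Moreover, given any local coordinates $(X,Y)$ in $\Omega$ that bring (1) to an equation with coefficients $B_0,\dots,B_3$, this equation has the form $Y_{XX}=f(X,Y)$ (that is, $B_1=B_2=B_3=0$) if and only if $dX$ is a Killing $1$-form of its Thomas-symbol connection. -/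

import Mathlib

open scoped Topology

noncomputable section

namespace ProjectiveODE

/-! ### Tensor calculus in a coordinate chart of the plane

Indices `0, 1 : Fin 2` stand for the coordinates `x¹ = x`, `x² = y`. -/

/-- The partial derivative `∂ₐ f` of a function of the two coordinates. -/
def pd (a : Fin 2) (f : ℝ × ℝ → ℝ) : ℝ × ℝ → ℝ :=
  fun q => fderiv ℝ f q ((![(1, 0), (0, 1)] : Fin 2 → ℝ × ℝ) a)

/-- Connection symbols in a chart: `Γ c a b` is `Γᶜₐᵦ`. -/
abbrev Conn := Fin 2 → Fin 2 → Fin 2 → ℝ × ℝ → ℝ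

/-- The components `ε₁₂ = ε¹² = 1` of the coordinate volume form; `ε^{ab} ε_{cb} = δ^a_c`. -/
def eps (a b : Fin 2) : ℝ := (![![0, 1], ![-1, 0]] : Fin 2 → Fin 2 → ℝ) a b

/-- The coefficients `A₀, A₁, A₂, A₃` of the equation of unparametrised geodesics
`y'' = A₀ + A₁ y' + A₂ y'² + A₃ y'³` of a torsion-free connection. -/
def geodesicCoeff (Γ : Conn) : Fin 4 → ℝ × ℝ → ℝ :=
  ![fun q => -Γ 1 0 0 q,
    fun q => Γ 0 0 0 q - 2 * Γ 1 0 1 q,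
    fun q => 2 * Γ 0 0 1 q - Γ 1 1 1 q,
    fun q => Γ 0 1 1 q]

/-- The Thomas symbols `Πᶜₐᵦ = Γᶜₐᵦ - (1/3) Γᵈ_{da} δᶜ_b - (1/3) Γᵈ_{db} δᶜ_a` of a connection. -/
def thomasSymbols (Γ : Conn) : Conn := fun c a b q =>
  Γ c a b q - 1 / 3 * (∑ d, Γ d d a q) * (if c = b then 1 else 0)
    - 1 / 3 * (∑ d, Γ d d b q) * (if c = a then 1 else 0)

/-- The connection given by the Thomas symbols of the projective structure defined by
`y'' = A₀ + A₁ y' + A₂ y'² + A₃ y'³`, in the coordinates `(x, y)` of the equation. -/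
def thomas (A : Fin 4 → ℝ × ℝ → ℝ) : Conn := fun c a b q =>
  (![![![A 1 q / 3, A 2 q / 3],
       ![A 2 q / 3, A 3 q]],
     ![![-A 0 q, -A 1 q / 3],
       ![-A 1 q / 3, -A 2 q / 3]]] : Fin 2 → Fin 2 → Fin 2 → ℝ) c a b

/-- The Thomas symbols of any torsion-free connection whose geodesics solve the equation are
those given by `thomas`. -/
theorem thomasSymbols_eq_thomas (Γ : Conn) (hΓ : ∀ c a b, Γ c a b = Γ c b a) :
    thomasSymbols Γ = thomas (geodesicCoeff Γ) := by
  funext c a b q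
  have h0 := congrFun (hΓ 0 1 0) q
  have h1 := congrFun (hΓ 1 1 0) q
  fin_cases c <;> fin_cases a <;> fin_cases b <;>
    simp [thomasSymbols, thomas, geodesicCoeff, Fin.sum_univ_two, h0, h1] <;> ring

/-- The connection of Thomas symbols represents the projective structure of the equation. -/
theorem geodesicCoeff_thomas (A : Fin 4 → ℝ × ℝ → ℝ) : geodesicCoeff (thomas A) = A := by
  funext i q
  fin_cases i <;> simp [thomas, geodesicCoeff] <;> ring

/-- The covariant derivative `∇ₐ K_b` of a one-form. -/
def covForm (Γ : Conn) (K : Fin 2 → ℝ × ℝ → ℝ) (a b : Fin 2) : ℝ × ℝ → ℝ := fun q =>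
  pd a (K b) q - ∑ c, Γ c a b q * K c q

/-- `K` is a Killing one-form of the connection on `U`: `∇ₐ K_b + ∇_b Kₐ = 0`. -/
def IsKillingOn (Γ : Conn) (K : Fin 2 → ℝ × ℝ → ℝ) (U : Set (ℝ × ℝ)) : Prop :=
  (∀ a, DifferentiableOn ℝ (K a) U) ∧
    ∀ q ∈ U, ∀ a b, covForm Γ K a b q + covForm Γ K b a q = 0

/-- The one-form `dX`, where `X` is the first coordinate. -/
def dX : Fin 2 → ℝ × ℝ → ℝ := ![fun _ => 1, fun _ => 0]

/-- The Ricci tensor `R_{ab} = R_{ca}{}^c{}_b`, where `[∇ₐ, ∇_b] Xᶜ = R_{ab}{}^c{}_d Xᵈ`. -/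
def ricci (Γ : Conn) (a b : Fin 2) : ℝ × ℝ → ℝ := fun q =>
  ∑ c, (pd c (Γ c a b) q - pd a (Γ c c b) q
    + ∑ e, (Γ c c e q * Γ e a b q - Γ c a e q * Γ e c b q))

/-- The projective Schouten tensor `P_{ab} = (2/3) R_{ab} + (1/3) R_{ba}`. -/
def schouten (Γ : Conn) (a b : Fin 2) : ℝ × ℝ → ℝ := fun q =>
  2 / 3 * ricci Γ a b q + 1 / 3 * ricci Γ b a q

/-- The Cotton one-form `L_b = ε^{cd} ∇_c P_{db}`. -/
def cotton (Γ : Conn) (b : Fin 2) : ℝ × ℝ → ℝ := fun q =>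
  ∑ c, ∑ d, eps c d * (pd c (schouten Γ d b) q
    - ∑ e, (Γ e c d q * schouten Γ e b q + Γ e c b q * schouten Γ d e q))

/-- Raising an index: `Kᵃ = ε^{ab} K_b`. -/
def raise (K : Fin 2 → ℝ × ℝ → ℝ) (a : Fin 2) : ℝ × ℝ → ℝ := fun q => ∑ b, eps a b * K b q

/-! ### The prolongation connection of the Killing equation

For a connection with symmetric Ricci tensor and `∇ε = 0` (such as that of the Thomas symbols),
a one-form `K` is Killing if and only if, for some `μ`, the pair `(K, μ)` is parallel for
`Dₐ (K_b, μ) = (∇ₐ K_b - ε_{ab} μ, ∇ₐ μ - P^b{}_a K_b)`. -/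

/-- The connection dual to `D`: a section is a triple `(V¹, V², v)`, and
`Dₐ (V^b, v) = (∇ₐ V^b + P^b{}_a v, ∇ₐ v + ε_{ab} V^b)` with `P^b{}_a = ε^{bc} P_{ca}`. -/
def dualD (Γ : Conn) (a : Fin 2) (V : Fin 3 → ℝ × ℝ → ℝ) : Fin 3 → ℝ × ℝ → ℝ :=
  let top : Fin 2 → ℝ × ℝ → ℝ := fun b q =>
    pd a (V b.castSucc) q + (∑ c, Γ b a c q * V c.castSucc q)
      + (∑ c, eps b c * schouten Γ c a q) * V 2 q
  ![top 0, top 1, fun q => pd a (V 2) q + ∑ b : Fin 2, eps a b * V b.castSucc q]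

/-- The second covariant derivative `D_b D_c V`. -/
def dualD2 (Γ : Conn) (b c : Fin 2) (V : Fin 3 → ℝ × ℝ → ℝ) : Fin 3 → ℝ × ℝ → ℝ := fun i q =>
  dualD Γ b (dualD Γ c V) i q - ∑ e, Γ e b c q * dualD Γ e V i q

/-- The section `V = (F¹, F², 0)`, `Fᵃ = (1/3) ε^{ab} L_b`, that annihilates every parallel
section of `D`. -/
def obstruction (Γ : Conn) : Fin 3 → ℝ × ℝ → ℝ :=
  ![fun q => 1 / 3 * raise (cotton Γ) 0 q, fun q => 1 / 3 * raise (cotton Γ) 1 q, fun _ => 0]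

/-- The tensor `W_{abc} = det (V, Dₐ V, D_{(b} D_{c)} V)`. -/
def wTensor (Γ : Conn) (a b c : Fin 2) : ℝ × ℝ → ℝ := fun q =>
  Matrix.det (![fun i => obstruction Γ i q,
    fun i => dualD Γ a (obstruction Γ) i q,
    fun i => (dualD2 Γ b c (obstruction Γ) i q + dualD2 Γ c b (obstruction Γ) i q) / 2] :
      Matrix (Fin 3) (Fin 3) ℝ)

/-! ### Liouville's invariants of `y'' = A₀ + A₁ y' + A₂ y'² + A₃ y'³` -/

/-- Liouville's one-form `(L₁, L₂)` (up to sign the pair of Liouville's expressions in the `Aᵢ`),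
whose vanishing characterises flatness. -/
def liouvilleL (A : Fin 4 → ℝ × ℝ → ℝ) : Fin 2 → ℝ × ℝ → ℝ := cotton (thomas A)

/-- `ν₅ = Lᵃ L^b ∇ₐ L_b`. -/
def nu5 (A : Fin 4 → ℝ × ℝ → ℝ) : ℝ × ℝ → ℝ := fun q =>
  ∑ a, ∑ b, raise (liouvilleL A) a q * raise (liouvilleL A) b q
    * covForm (thomas A) (liouvilleL A) a b q

open Classical in
/-- Liouville's `w₁`, obtained from `W₁₁₁` where `L₁ ≠ 0` and from `W₂₂₂` where `L₂ ≠ 0`. When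
`ν₅ = 0` one has `-27 W_{abc} = w₁ Lₐ L_b L_c`, so both choices agree where both make sense. The
factor `-27` is Liouville's normalisation. -/
def w1 (A : Fin 4 → ℝ × ℝ → ℝ) : ℝ × ℝ → ℝ := fun q =>
  if liouvilleL A 0 q ≠ 0 then
    -27 * wTensor (thomas A) 0 0 0 q / liouvilleL A 0 q ^ 3
  else
    -27 * wTensor (thomas A) 1 1 1 q / liouvilleL A 1 q ^ 3

/-! ### Point transformations -/

/-- `y` is twice differentiable on the (open) set `I`. -/
def TwiceDiffOn (y : ℝ → ℝ) (I : Set ℝ) : Prop :=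
  ∀ x ∈ I, DifferentiableAt ℝ y x ∧ DifferentiableAt ℝ (deriv y) x

/-- `y` solves `y'' = A₀ + A₁ y' + A₂ y'² + A₃ y'³` on `I`. -/
def SolvesOn (A : Fin 4 → ℝ × ℝ → ℝ) (y : ℝ → ℝ) (I : Set ℝ) : Prop :=
  TwiceDiffOn y I ∧
    ∀ x ∈ I, deriv (deriv y) x = ∑ i : Fin 4, A i (x, y x) * deriv y x ^ (i : ℕ)

/-- The graph of `y` over `I`. -/
def graphOver (y : ℝ → ℝ) (I : Set ℝ) : Set (ℝ × ℝ) := (fun x => (x, y x)) '' I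

/-- The local coordinates `(X, Y) = φ(x, y)`, of class `Cⁿ` together with the inverse change,
bring the equation with coefficients `A` to that with coefficients `B`: whenever `φ` maps the graph
of a function `y(x)` to the graph of a function `η(X)`, `y` solves the first equation if and only
if `η` solves the second. -/
structure IsPointTransformation (n : ℕ∞) (φ : OpenPartialHomeomorph (ℝ × ℝ) (ℝ × ℝ))
    (A B : Fin 4 → ℝ × ℝ → ℝ) : Prop where
  contDiffOn : ContDiffOn ℝ n φ φ.source
  contDiffOn_symm : ContDiffOn ℝ n φ.symm φ.target
  solvesOn_iff : ∀ (I J : Set ℝ) (y η : ℝ → ℝ),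
    IsOpen I → I.OrdConnected → IsOpen J → J.OrdConnected →
    TwiceDiffOn y I → TwiceDiffOn η J →
    graphOver y I ⊆ φ.source → φ '' graphOver y I = graphOver η J →
    (SolvesOn A y I ↔ SolvesOn B η J)

end ProjectiveODE

end

noncomputable section

namespace ProjectiveODE

open Set MeasureTheory

/-! ### Partial derivatives -/

/-! Everything passes through Killing forms of the Thomas connection of (1) in the original
coordinates.

Coordinates and Killing forms. In the target coordinates `∇ₐ(dX)_b = -Π¹ₐ_b`, and the symbols `Π¹`
are `B₁/3`, `B₂/3`, `B₃`; so `dX` is Killing exactly when these coefficients vanish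
(`isKillingOn_dX_iff`). This gives the last claim and the equivalence of 1 and 3. The Thomas
connection is tied to the coordinate volume form. Hence, if `J` is the Jacobian determinant of `(X,
Y)`, the form in the old coordinates that corresponds to `dX` is not `dX` but `J^(-2/3) dX`;
`isKillingOn_smul_iff` proves this for every multiple `g dX` with `g³J²` constant. Conversely, a
form `K` with `K(p) ≠ 0` can be written `g dX` near `p`, with `X` constant along the curves tangent
to `ker K`, and `Y` can then be chosen to give `J` the required size (`exists_rectification`). So 1
says that some Killing form does not vanish at `p`.

Killing forms and invariants. Let `μ` be the skew part of `∇K`. The Killing equation becomes a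
closed linear system for `(K, μ)`, and commuting derivatives of `μ` gives `L₂K₁ - L₁K₂ = 0`.
Differentiating this relation shows `ν₅ = 0`; differentiating it twice with the dual connection
produces three vectors that annihilate `(K, μ)`, so that `W = 0`. Conversely, since `L ≠ 0` near
`p`, only multiples of `L` can be Killing. The condition `ν₅ = 0` says that the symmetric part of
`∇L` vanishes on `ker L`, hence that it is a symmetric product of `L` with a form `M`; then `27 Wₐₐₐ
= Lₐ³ dM` (`IsRecurrentOn.wTensor_eq`), so `w₁ = 0` makes `M` closed. With `M = dm`, the form
`e^(-m) L` is Killing.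

Solutions and coefficients. `IsPointTransformation` speaks of solutions, `TransformsTo` of
coefficients. The chain rule leads from the second to the first. The converse takes a solution
through each point with each slope transverse to the fibres of `X`, and compares two cubic
polynomials in the slope. -/

theorem pd_zero_eq (f : ℝ × ℝ → ℝ) (q : ℝ × ℝ) : pd 0 f q = fderiv ℝ f q (1, 0) := rfl

theorem pd_one_eq (f : ℝ × ℝ → ℝ) (q : ℝ × ℝ) : pd 1 f q = fderiv ℝ f q (0, 1) := rfl

theorem fderiv_eq_pd (f : ℝ × ℝ → ℝ) (q u : ℝ × ℝ) :
    fderiv ℝ f q u = pd 0 f q * u.1 + pd 1 f q * u.2 := by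
  have h : u = u.1 • ((1 : ℝ), (0 : ℝ)) + u.2 • ((0 : ℝ), (1 : ℝ)) := by
    ext <;> simp
  rw [h, map_add, map_smul, map_smul, pd_zero_eq, pd_one_eq]
  simp [mul_comm]

theorem pd_eq_of_hasFDerivAt {f : ℝ × ℝ → ℝ} {f' : ℝ × ℝ →L[ℝ] ℝ} {q : ℝ × ℝ}
    (h : HasFDerivAt f f' q) (a : Fin 2) :
    pd a f q = f' ((![(1, 0), (0, 1)] : Fin 2 → ℝ × ℝ) a) := by
  rw [pd, h.fderiv]

theorem pd_congr_of_eventuallyEq {f g : ℝ × ℝ → ℝ} {q : ℝ × ℝ} (h : f =ᶠ[𝓝 q] g) (a : Fin 2) :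
    pd a f q = pd a g q := by
  rw [pd, pd, h.fderiv_eq]

theorem pd_congr {f g : ℝ × ℝ → ℝ} {U : Set (ℝ × ℝ)} (hU : IsOpen U) (h : ∀ q ∈ U, f q = g q)
    {q : ℝ × ℝ} (hq : q ∈ U) (a : Fin 2) : pd a f q = pd a g q :=
  pd_congr_of_eventuallyEq (Filter.eventually_of_mem (hU.mem_nhds hq) h) a

theorem pd_const (a : Fin 2) (c : ℝ) (q : ℝ × ℝ) : pd a (fun _ => c) q = 0 := by
  simp [pd]

theorem pd_neg (a : Fin 2) (f : ℝ × ℝ → ℝ) (q : ℝ × ℝ) :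
    pd a (fun x => -f x) q = -pd a f q := by
  simp [pd, fderiv_fun_neg]

theorem pd_const_mul (a : Fin 2) (c : ℝ) {f : ℝ × ℝ → ℝ} {q : ℝ × ℝ}
    (hf : DifferentiableAt ℝ f q) : pd a (fun x => c * f x) q = c * pd a f q := by
  rw [pd, fderiv_const_mul hf]; simp [pd]

theorem pd_div_const (a : Fin 2) (c : ℝ) {f : ℝ × ℝ → ℝ} {q : ℝ × ℝ}
    (hf : DifferentiableAt ℝ f q) : pd a (fun x => f x / c) q = pd a f q / c := by
  simp only [div_eq_inv_mul]; exact pd_const_mul a _ hf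

theorem pd_add (a : Fin 2) {f g : ℝ × ℝ → ℝ} {q : ℝ × ℝ} (hf : DifferentiableAt ℝ f q)
    (hg : DifferentiableAt ℝ g q) : pd a (fun x => f x + g x) q = pd a f q + pd a g q := by
  rw [pd, fderiv_fun_add hf hg]; simp [pd]

theorem pd_sub (a : Fin 2) {f g : ℝ × ℝ → ℝ} {q : ℝ × ℝ} (hf : DifferentiableAt ℝ f q)
    (hg : DifferentiableAt ℝ g q) : pd a (fun x => f x - g x) q = pd a f q - pd a g q := by
  rw [pd, fderiv_fun_sub hf hg]; simp [pd]

theorem pd_mul (a : Fin 2) {f g : ℝ × ℝ → ℝ} {q : ℝ × ℝ} (hf : DifferentiableAt ℝ f q)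
    (hg : DifferentiableAt ℝ g q) :
    pd a (fun x => f x * g x) q = pd a f q * g q + f q * pd a g q := by
  rw [pd, fderiv_fun_mul hf hg]; simp [pd]; ring

theorem pd_pow (a : Fin 2) (k : ℕ) {f : ℝ × ℝ → ℝ} {q : ℝ × ℝ} (hf : DifferentiableAt ℝ f q) :
    pd a (fun x => f x ^ k) q = k * f q ^ (k - 1) * pd a f q := by
  rw [pd, fderiv_fun_pow k hf]; simp [pd]

theorem pd_fst (a : Fin 2) (q : ℝ × ℝ) : pd a Prod.fst q = (![1, 0] : Fin 2 → ℝ) a := by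
  rw [pd_eq_of_hasFDerivAt hasFDerivAt_fst]; fin_cases a <;> simp

theorem pd_snd (a : Fin 2) (q : ℝ × ℝ) : pd a Prod.snd q = (![0, 1] : Fin 2 → ℝ) a := by
  rw [pd_eq_of_hasFDerivAt hasFDerivAt_snd]; fin_cases a <;> simp

/-- The chain rule along a curve. -/
theorem hasDerivAt_comp_curve {f : ℝ × ℝ → ℝ} {u v : ℝ → ℝ} {u' v' t : ℝ}
    (hf : DifferentiableAt ℝ f (u t, v t)) (hu : HasDerivAt u u' t) (hv : HasDerivAt v v' t) :
    HasDerivAt (fun s => f (u s, v s)) (pd 0 f (u t, v t) * u' + pd 1 f (u t, v t) * v') t := by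
  have h := hf.hasFDerivAt.comp_hasDerivAt t (hu.prodMk hv)
  rwa [fderiv_eq_pd] at h

theorem _root_.ContDiffOn.pd_of_le {f : ℝ × ℝ → ℝ} {U : Set (ℝ × ℝ)} {m n : WithTop ℕ∞}
    (hf : ContDiffOn ℝ n f U) (hU : IsOpen U) (hmn : m + 1 ≤ n) (a : Fin 2) :
    ContDiffOn ℝ m (pd a f) U :=
  (hf.fderiv_of_isOpen hU hmn).clm_apply contDiffOn_const

theorem contDiffOn_succ_of_pd {f : ℝ × ℝ → ℝ} {U : Set (ℝ × ℝ)} {m : ℕ}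
    (hU : IsOpen U) (hf : DifferentiableOn ℝ f U) (h : ∀ a, ContDiffOn ℝ m (pd a f) U) :
    ContDiffOn ℝ ((m + 1 : ℕ) : WithTop ℕ∞) f U := by
  have : ((m + 1 : ℕ) : WithTop ℕ∞) = (m : WithTop ℕ∞) + 1 := by push_cast; rfl
  rw [this, contDiffOn_succ_iff_fderiv_of_isOpen hU]
  refine ⟨hf, by simp, ?_⟩
  rw [contDiffOn_clm_apply]
  intro u
  simp only [fderiv_eq_pd]
  exact ((h 0).mul contDiffOn_const).add ((h 1).mul contDiffOn_const)

/-- A function with continuous partial derivatives is differentiable. -/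
theorem hasStrictFDerivAt_of_partial {f f₁ f₂ : ℝ × ℝ → ℝ} {q : ℝ × ℝ}
    (h₁ : ∀ᶠ r in 𝓝 q, HasDerivAt (fun s => f (s, r.2)) (f₁ r) r.1)
    (h₂ : ∀ᶠ r in 𝓝 q, HasDerivAt (fun s => f (r.1, s)) (f₂ r) r.2)
    (c₁ : ContinuousAt f₁ q) (c₂ : ContinuousAt f₂ q) :
    HasStrictFDerivAt f
      ((ContinuousLinearMap.toSpanSingleton ℝ (f₁ q)).coprod
        (ContinuousLinearMap.toSpanSingleton ℝ (f₂ q))) q := by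
  have key := hasStrictFDerivAt_uncurry_coprod (𝕜 := ℝ) (u := q) (f := fun x y => f (x, y))
    (f₁ := fun x y => ContinuousLinearMap.toSpanSingleton ℝ (f₁ (x, y)))
    (f₂ := fun x y => ContinuousLinearMap.toSpanSingleton ℝ (f₂ (x, y)))
    (by filter_upwards [h₁] with r hr using hr.hasFDerivAt)
    (by filter_upwards [h₂] with r hr using hr.hasFDerivAt)
    ((ContinuousLinearMap.toSpanSingletonCLE (𝕜 := ℝ) (E := ℝ)).continuous.continuousAt.comp c₁)
    ((ContinuousLinearMap.toSpanSingletonCLE (𝕜 := ℝ) (E := ℝ)).continuous.continuousAt.comp c₂)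
  exact key

/-- Partial derivatives of class `Cᵐ` make a function of class `Cᵐ⁺¹`. -/
theorem contDiffOn_succ_of_partial {f f₁ f₂ : ℝ × ℝ → ℝ} {U : Set (ℝ × ℝ)} {m : ℕ}
    (hU : IsOpen U)
    (h₁ : ∀ r ∈ U, HasDerivAt (fun s => f (s, r.2)) (f₁ r) r.1)
    (h₂ : ∀ r ∈ U, HasDerivAt (fun s => f (r.1, s)) (f₂ r) r.2)
    (c₁ : ContDiffOn ℝ m f₁ U) (c₂ : ContDiffOn ℝ m f₂ U) :
    ContDiffOn ℝ ((m + 1 : ℕ) : WithTop ℕ∞) f U := by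
  have h : ∀ q ∈ U, HasStrictFDerivAt f
      ((ContinuousLinearMap.toSpanSingleton ℝ (f₁ q)).coprod
        (ContinuousLinearMap.toSpanSingleton ℝ (f₂ q))) q := fun q hq =>
    hasStrictFDerivAt_of_partial (Filter.eventually_of_mem (hU.mem_nhds hq) h₁)
      (Filter.eventually_of_mem (hU.mem_nhds hq) h₂)
      (c₁.continuousOn.continuousAt (hU.mem_nhds hq))
      (c₂.continuousOn.continuousAt (hU.mem_nhds hq))
  refine contDiffOn_succ_of_pd hU
    (fun q hq => (h q hq).hasFDerivAt.differentiableAt.differentiableWithinAt) fun a => ?_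
  fin_cases a
  · refine c₁.congr fun q hq => ?_
    rw [pd_eq_of_hasFDerivAt (h q hq).hasFDerivAt]; simp
  · refine c₂.congr fun q hq => ?_
    rw [pd_eq_of_hasFDerivAt (h q hq).hasFDerivAt]; simp

theorem pd_comm {f : ℝ × ℝ → ℝ} {U : Set (ℝ × ℝ)} (hU : IsOpen U) (hf : ContDiffOn ℝ 2 f U)
    {q : ℝ × ℝ} (hq : q ∈ U) : pd 0 (pd 1 f) q = pd 1 (pd 0 f) q := by
  have hfa : ContDiffAt ℝ 2 f q := hf.contDiffAt (hU.mem_nhds hq)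
  have hd : DifferentiableAt ℝ (fderiv ℝ f) q :=
    (hfa.fderiv_right (m := 1) (by norm_num)).differentiableAt (by norm_num)
  have hs := hfa.isSymmSndFDerivAt (by simp)
  have h : ∀ u v : ℝ × ℝ, fderiv ℝ (fun x => fderiv ℝ f x u) q v = fderiv ℝ (fderiv ℝ f) q v u := by
    intro u v
    rw [fderiv_clm_apply hd (by fun_prop)]; simp
  have h0 : pd 0 (pd 1 f) q = fderiv ℝ (fderiv ℝ f) q (1, 0) (0, 1) := h _ _
  have h1 : pd 1 (pd 0 f) q = fderiv ℝ (fderiv ℝ f) q (0, 1) (1, 0) := h _ _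
  rw [h0, h1]; exact hs _ _

section

/-! ### The Schouten tensor and Liouville's one-form in terms of the coefficients -/

variable {A : Fin 4 → ℝ × ℝ → ℝ} {U : Set (ℝ × ℝ)} {q : ℝ × ℝ}

theorem ricci_thomas (hA : ∀ i, DifferentiableAt ℝ (A i) q) (a b : Fin 2) :
    ricci (thomas A) a b q =
      (![![pd 0 (A 1) q / 3 - pd 1 (A 0) q - 2 * (A 1 q ^ 2 / 9 - A 0 q * A 2 q / 3),
           pd 0 (A 2) q / 3 - pd 1 (A 1) q / 3 - (A 1 q * A 2 q / 9 - A 0 q * A 3 q)],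
         ![pd 0 (A 2) q / 3 - pd 1 (A 1) q / 3 - (A 1 q * A 2 q / 9 - A 0 q * A 3 q),
           pd 0 (A 3) q - pd 1 (A 2) q / 3 - 2 * (A 2 q ^ 2 / 9 - A 1 q * A 3 q / 3)]] :
        Fin 2 → Fin 2 → ℝ) a b := by
  have h1 := hA 1
  have h2 := hA 2
  have t000 : thomas A 0 0 0 = fun q => A 1 q / 3 := rfl
  have t001 : thomas A 0 0 1 = fun q => A 2 q / 3 := rfl
  have t010 : thomas A 0 1 0 = fun q => A 2 q / 3 := rfl
  have t011 : thomas A 0 1 1 = A 3 := rfl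
  have t100 : thomas A 1 0 0 = fun q => -A 0 q := rfl
  have t101 : thomas A 1 0 1 = fun q => -(A 1 q / 3) := by funext q; simp [thomas, neg_div]
  have t110 : thomas A 1 1 0 = fun q => -(A 1 q / 3) := by funext q; simp [thomas, neg_div]
  have t111 : thomas A 1 1 1 = fun q => -(A 2 q / 3) := by funext q; simp [thomas, neg_div]
  fin_cases a <;> fin_cases b <;>
    simp (disch := assumption) [ricci, t000, t001, t010, t011, t100, t101, t110, t111,
      Fin.sum_univ_two, pd_neg, pd_div_const] <;>
    ring

/-- The Thomas symbols are trace-free, so their Ricci tensor is symmetric and the weights `2/3` and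
`1/3` recombine to the Ricci tensor itself. -/
theorem schouten_thomas (hA : ∀ i, DifferentiableAt ℝ (A i) q) (a b : Fin 2) :
    schouten (thomas A) a b q =
      (![![pd 0 (A 1) q / 3 - pd 1 (A 0) q - 2 * (A 1 q ^ 2 / 9 - A 0 q * A 2 q / 3),
           pd 0 (A 2) q / 3 - pd 1 (A 1) q / 3 - (A 1 q * A 2 q / 9 - A 0 q * A 3 q)],
         ![pd 0 (A 2) q / 3 - pd 1 (A 1) q / 3 - (A 1 q * A 2 q / 9 - A 0 q * A 3 q),
           pd 0 (A 3) q - pd 1 (A 2) q / 3 - 2 * (A 2 q ^ 2 / 9 - A 1 q * A 3 q / 3)]] :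
        Fin 2 → Fin 2 → ℝ) a b := by
  rw [schouten, ricci_thomas hA, ricci_thomas hA]
  fin_cases a <;> fin_cases b <;> simp <;> ring

theorem schouten_thomas_comm (hA : ∀ i, DifferentiableAt ℝ (A i) q) :
    schouten (thomas A) 1 0 q = schouten (thomas A) 0 1 q := by
  rw [schouten_thomas hA, schouten_thomas hA]; simp

theorem contDiffOn_schouten {m n : WithTop ℕ∞} (hU : IsOpen U)
    (hA : ∀ i, ContDiffOn ℝ n (A i) U) (hmn : m + 1 ≤ n) (a b : Fin 2) :
    ContDiffOn ℝ m (schouten (thomas A) a b) U := by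
  have hd : ∀ i, ∀ q ∈ U, DifferentiableAt ℝ (A i) q := fun i q hq =>
    ((hA i).contDiffAt (hU.mem_nhds hq)).differentiableAt
      (fun h => by simp [h] at hmn)
  refine ContDiffOn.congr ?_ fun q hq => schouten_thomas (fun i => hd i q hq) a b
  have h0 : ∀ i, ContDiffOn ℝ m (A i) U := fun i => (hA i).of_le (le_self_add.trans hmn)
  have h1 : ∀ i a, ContDiffOn ℝ m (pd a (A i)) U := fun i a => (hA i).pd_of_le hU hmn a
  have e0 := h0 0
  have e1 := h0 1
  have e2 := h0 2
  have e3 := h0 3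
  have f10 := h1 1 0
  have f01 := h1 0 1
  have f20 := h1 2 0
  have f11 := h1 1 1
  have f30 := h1 3 0
  have f21 := h1 2 1
  fin_cases a <;> fin_cases b <;> simp <;> fun_prop

theorem cotton_thomas_zero (hU : IsOpen U) (hA : ∀ i, DifferentiableOn ℝ (A i) U) (hq : q ∈ U) :
    cotton (thomas A) 0 q =
      pd 0 (schouten (thomas A) 0 1) q - pd 1 (schouten (thomas A) 0 0) q
        - (2 * A 1 q / 3) * schouten (thomas A) 0 1 q + A 0 q * schouten (thomas A) 1 1 q
        + A 2 q / 3 * schouten (thomas A) 0 0 q := by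
  have hs : ∀ r ∈ U, schouten (thomas A) 1 0 r = schouten (thomas A) 0 1 r := fun r hr =>
    schouten_thomas_comm fun i => (hA i).differentiableAt (hU.mem_nhds hr)
  have e := pd_congr hU hs hq 0
  simp [cotton, thomas, Fin.sum_univ_two, eps, e, hs q hq]
  ring

theorem cotton_thomas_one (hU : IsOpen U) (hA : ∀ i, DifferentiableOn ℝ (A i) U) (hq : q ∈ U) :
    cotton (thomas A) 1 q =
      pd 0 (schouten (thomas A) 1 1) q - pd 1 (schouten (thomas A) 0 1) q
        - A 2 q * (2 / 3) * schouten (thomas A) 0 1 q + A 1 q / 3 * schouten (thomas A) 1 1 q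
        + A 3 q * schouten (thomas A) 0 0 q := by
  have hs : ∀ r ∈ U, schouten (thomas A) 1 0 r = schouten (thomas A) 0 1 r := fun r hr =>
    schouten_thomas_comm fun i => (hA i).differentiableAt (hU.mem_nhds hr)
  simp [cotton, thomas, Fin.sum_univ_two, eps, hs q hq]
  ring

theorem contDiffOn_cotton {m : ℕ} {n : WithTop ℕ∞} (hU : IsOpen U)
    (hA : ∀ i, ContDiffOn ℝ n (A i) U) (hmn : (m : WithTop ℕ∞) + 1 + 1 ≤ n) (b : Fin 2) :
    ContDiffOn ℝ m (cotton (thomas A) b) U := by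
  have hP := contDiffOn_schouten hU hA hmn
  have h0 : ∀ i, ContDiffOn ℝ m (A i) U := fun i => (hA i).of_le
    ((le_self_add.trans le_self_add).trans hmn)
  have hd : ∀ i, DifferentiableOn ℝ (A i) U := fun i => (hA i).differentiableOn
      (fun h => by simp [h] at hmn)
  have hP0 : ∀ a b, ContDiffOn ℝ m (schouten (thomas A) a b) U := fun a b =>
    (hP a b).of_le le_self_add
  have hP1 : ∀ c a b, ContDiffOn ℝ m (pd c (schouten (thomas A) a b)) U := fun c a b =>
    (hP a b).pd_of_le hU le_rfl c
  have e0 := h0 0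
  have e1 := h0 1
  have e2 := h0 2
  have e3 := h0 3
  have p0 := hP0 0 0
  have p1 := hP0 0 1
  have p2 := hP0 1 1
  have f0 := hP1 1 0 0
  have f1 := hP1 0 0 1
  have f2 := hP1 1 0 1
  have f3 := hP1 0 1 1
  fin_cases b
  · exact ContDiffOn.congr (by fun_prop) fun q hq => cotton_thomas_zero hU hd hq
  · exact ContDiffOn.congr (by fun_prop) fun q hq => cotton_thomas_one hU hd hq

/-! ### The prolongation of the Killing equation -/

/-- The Killing equation of the Thomas symbols, written out. -/
theorem isKillingOn_thomas_iff (K : Fin 2 → ℝ × ℝ → ℝ) :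
    IsKillingOn (thomas A) K U ↔ (∀ a, DifferentiableOn ℝ (K a) U) ∧ ∀ q ∈ U,
      pd 0 (K 0) q = A 1 q / 3 * K 0 q - A 0 q * K 1 q ∧
      pd 0 (K 1) q + pd 1 (K 0) q = 2 * (A 2 q / 3 * K 0 q - A 1 q / 3 * K 1 q) ∧
      pd 1 (K 1) q = A 3 q * K 0 q - A 2 q / 3 * K 1 q := by
  unfold IsKillingOn
  refine and_congr_right fun _ => forall₂_congr fun q _ => ?_
  simp only [covForm, thomas, Fin.sum_univ_two, Fin.forall_fin_two]
  simp
  constructor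
  · rintro ⟨⟨h1, h2⟩, h3, h4⟩
    refine ⟨?_, ?_, ?_⟩ <;> linarith
  · rintro ⟨h1, h2, h3⟩
    refine ⟨⟨?_, ?_⟩, ?_, ?_⟩ <;> linarith

/-- The skew part of `∇ₐ K_b`. -/
def skewPart (K : Fin 2 → ℝ × ℝ → ℝ) : ℝ × ℝ → ℝ := fun q => (pd 0 (K 1) q - pd 1 (K 0) q) / 2

theorem IsKillingOn.pd_eq {K : Fin 2 → ℝ × ℝ → ℝ} (h : IsKillingOn (thomas A) K U) (hq : q ∈ U) :
    pd 0 (K 0) q = A 1 q / 3 * K 0 q - A 0 q * K 1 q ∧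
    pd 0 (K 1) q = A 2 q / 3 * K 0 q - A 1 q / 3 * K 1 q + skewPart K q ∧
    pd 1 (K 0) q = A 2 q / 3 * K 0 q - A 1 q / 3 * K 1 q - skewPart K q ∧
    pd 1 (K 1) q = A 3 q * K 0 q - A 2 q / 3 * K 1 q := by
  obtain ⟨h1, h2, h3⟩ := ((isKillingOn_thomas_iff K).1 h).2 q hq
  refine ⟨h1, ?_, ?_, h3⟩ <;> simp only [skewPart] <;> linarith

theorem contDiffOn_skewPart {K : Fin 2 → ℝ × ℝ → ℝ} {m n : WithTop ℕ∞} (hU : IsOpen U)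
    (hK : ∀ a, ContDiffOn ℝ n (K a) U) (hmn : m + 1 ≤ n) : ContDiffOn ℝ m (skewPart K) U :=
  (((hK 1).pd_of_le hU hmn 0).sub ((hK 0).pd_of_le hU hmn 1)).div_const 2

/-- Commuting the partial derivatives of `K 0` and of `K 1`, with all first derivatives replaced
through `pd_eq`, can be solved for the derivatives of the skew part. This closes the Killing
equation to a linear system in `(K, μ)`. -/
theorem IsKillingOn.pd_skewPart {K : Fin 2 → ℝ × ℝ → ℝ} (h : IsKillingOn (thomas A) K U)
    (hU : IsOpen U) (hK : ∀ a, ContDiffOn ℝ 2 (K a) U) (hA : ∀ i, DifferentiableOn ℝ (A i) U)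
    (hq : q ∈ U) :
    pd 0 (skewPart K) q =
        schouten (thomas A) 0 1 q * K 0 q - schouten (thomas A) 0 0 q * K 1 q ∧
      pd 1 (skewPart K) q =
        schouten (thomas A) 1 1 q * K 0 q - schouten (thomas A) 0 1 q * K 1 q := by
  have hAd : ∀ i, DifferentiableAt ℝ (A i) q := fun i => (hA i).differentiableAt (hU.mem_nhds hq)
  have a0 := hAd 0
  have a1 := hAd 1
  have a2 := hAd 2
  have a3 := hAd 3
  have hKd : ∀ a, DifferentiableAt ℝ (K a) q := fun a =>
    ((hK a).differentiableOn (by norm_num)).differentiableAt (hU.mem_nhds hq)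
  have k0 := hKd 0
  have k1 := hKd 1
  have hm : DifferentiableAt ℝ (skewPart K) q :=
    ((contDiffOn_skewPart (m := 1) hU hK (by norm_num)).differentiableOn
      (by norm_num)).differentiableAt (hU.mem_nhds hq)
  have c0 := pd_comm hU (hK 0) hq
  have c1 := pd_comm hU (hK 1) hq
  rw [pd_congr hU (fun r hr => (h.pd_eq hr).1) hq,
    pd_congr hU (fun r hr => (h.pd_eq hr).2.2.1) hq] at c0
  rw [pd_congr hU (fun r hr => (h.pd_eq hr).2.1) hq,
    pd_congr hU (fun r hr => (h.pd_eq hr).2.2.2) hq] at c1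
  simp (disch := fun_prop) only [pd_add, pd_sub, pd_mul, pd_div_const] at c0 c1
  obtain ⟨d1, d2, d3, d4⟩ := h.pd_eq hq
  rw [d1, d2, d3, d4] at c0 c1
  simp only [schouten_thomas hAd]
  constructor
  · simp; linear_combination -c0
  · simp; linear_combination -c1

/-- The integrability condition of the prolonged Killing equation. -/
theorem IsKillingOn.cotton_mul {K : Fin 2 → ℝ × ℝ → ℝ} (h : IsKillingOn (thomas A) K U)
    (hU : IsOpen U) (hK : ∀ a, ContDiffOn ℝ 3 (K a) U) (hA : ∀ i, ContDiffOn ℝ 2 (A i) U)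
    (hq : q ∈ U) :
    cotton (thomas A) 1 q * K 0 q - cotton (thomas A) 0 q * K 1 q = 0 := by
  have hAd : ∀ i, DifferentiableOn ℝ (A i) U := fun i => (hA i).differentiableOn (by norm_num)
  have hK2 : ∀ a, ContDiffOn ℝ 2 (K a) U := fun a => (hK a).of_le (by norm_num)
  have hKd : ∀ a, DifferentiableAt ℝ (K a) q := fun a =>
    ((hK a).differentiableOn (by norm_num)).differentiableAt (hU.mem_nhds hq)
  have k0 := hKd 0
  have k1 := hKd 1
  have hP : ∀ a b, DifferentiableAt ℝ (schouten (thomas A) a b) q := fun a b =>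
    ((contDiffOn_schouten (m := 1) hU hA (by norm_num) a b).differentiableOn
      (by norm_num)).differentiableAt (hU.mem_nhds hq)
  have p0 := hP 0 0
  have p1 := hP 0 1
  have p2 := hP 1 1
  -- The system is closed, so the one remaining condition is the equality of the mixed derivatives
  -- of `μ`. The terms in `μ` cancel, and what is left pairs the Cotton form with `K`.
  have c := pd_comm hU (contDiffOn_skewPart (m := 2) hU hK (by norm_num)) hq
  rw [pd_congr hU (fun r hr => (h.pd_skewPart hU hK2 hAd hr).1) hq,
    pd_congr hU (fun r hr => (h.pd_skewPart hU hK2 hAd hr).2) hq] at c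
  simp (disch := fun_prop) only [pd_sub, pd_mul] at c
  obtain ⟨d1, d2, d3, d4⟩ := h.pd_eq hq
  rw [d1, d2, d3, d4] at c
  rw [cotton_thomas_zero hU hAd hq, cotton_thomas_one hU hAd hq]
  linear_combination c

/-- The connections on triples and on the prolongation of the Killing equation are dual. -/
theorem IsKillingOn.sum_dualD_mul {K : Fin 2 → ℝ × ℝ → ℝ} (h : IsKillingOn (thomas A) K U)
    (hU : IsOpen U) (hK : ∀ a, ContDiffOn ℝ 2 (K a) U) (hA : ∀ i, DifferentiableOn ℝ (A i) U)
    {V : Fin 3 → ℝ × ℝ → ℝ} (hV : ∀ i, DifferentiableOn ℝ (V i) U)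
    (hVK : ∀ q ∈ U, V 0 q * K 0 q + V 1 q * K 1 q + V 2 q * skewPart K q = 0)
    (hq : q ∈ U) (a : Fin 2) :
    dualD (thomas A) a V 0 q * K 0 q + dualD (thomas A) a V 1 q * K 1 q
      + dualD (thomas A) a V 2 q * skewPart K q = 0 := by
  have hKd : ∀ a, DifferentiableAt ℝ (K a) q := fun a =>
    ((hK a).differentiableOn (by norm_num)).differentiableAt (hU.mem_nhds hq)
  have k0 := hKd 0
  have k1 := hKd 1
  have hm : DifferentiableAt ℝ (skewPart K) q :=
    ((contDiffOn_skewPart (m := 1) hU hK (by norm_num)).differentiableOn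
      (by norm_num)).differentiableAt (hU.mem_nhds hq)
  have hVd : ∀ i, DifferentiableAt ℝ (V i) q := fun i => (hV i).differentiableAt (hU.mem_nhds hq)
  have v0 := hVd 0
  have v1 := hVd 1
  have v2 := hVd 2
  have c := pd_congr hU hVK hq a
  simp (disch := fun_prop) only [pd_add, pd_mul, pd_const] at c
  obtain ⟨d1, d2, d3, d4⟩ := h.pd_eq hq
  obtain ⟨e1, e2⟩ := h.pd_skewPart hU hK hA hq
  have hs := schouten_thomas_comm fun i => (hA i).differentiableAt (hU.mem_nhds hq)
  fin_cases a <;>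
    simp [dualD, thomas, eps, Fin.sum_univ_two, hs, d1, d2, d3, d4, e1, e2] at c ⊢ <;>
    linear_combination c

theorem contDiffOn_thomas {m : WithTop ℕ∞} (h : ∀ i, ContDiffOn ℝ m (A i) U) (c a b : Fin 2) :
    ContDiffOn ℝ m (thomas A c a b) U := by
  fin_cases c <;> fin_cases a <;> fin_cases b
  exacts [(h 1).div_const 3, (h 2).div_const 3, (h 2).div_const 3, h 3, (h 0).neg,
    (h 1).neg.div_const 3, (h 1).neg.div_const 3, (h 2).neg.div_const 3]

theorem contDiffOn_dualD {m n : ℕ} (hU : IsOpen U) (hA : ∀ i, ContDiffOn ℝ n (A i) U)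
    (hmn : m + 1 ≤ n) {V : Fin 3 → ℝ × ℝ → ℝ}
    (hV : ∀ i, ContDiffOn ℝ ((m + 1 : ℕ) : WithTop ℕ∞) (V i) U) (a : Fin 2) (i : Fin 3) :
    ContDiffOn ℝ m (dualD (thomas A) a V i) U := by
  have hmn' : (m : WithTop ℕ∞) + 1 ≤ n := by exact_mod_cast hmn
  have h0 : ∀ i, ContDiffOn ℝ m (A i) U := fun i => (hA i).of_le (le_self_add.trans hmn')
  have hP := contDiffOn_schouten hU hA hmn'
  have hV0 : ∀ i, ContDiffOn ℝ m (V i) U := fun i => (hV i).of_le (by exact_mod_cast m.le_succ)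
  have hV1 : ∀ i a, ContDiffOn ℝ m (pd a (V i)) U := fun i a =>
    (hV i).pd_of_le hU (by push_cast; exact le_rfl) a
  have hT := contDiffOn_thomas h0
  have key : ∀ b : Fin 2, ContDiffOn ℝ m (fun q => pd a (V b.castSucc) q
      + (∑ c, thomas A b a c q * V c.castSucc q)
      + (∑ c, eps b c * schouten (thomas A) c a q) * V 2 q) U := by
    intro b
    refine ((hV1 _ _).add (ContDiffOn.sum fun c _ => (hT _ _ _).mul (hV0 _))).add
      ((ContDiffOn.sum fun c _ => contDiffOn_const.mul (hP _ _)).mul (hV0 _))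
  fin_cases i
  · exact key 0
  · exact key 1
  · exact (hV1 2 a).add (ContDiffOn.sum fun b _ => contDiffOn_const.mul (hV0 _))

theorem contDiffOn_obstruction {m n : ℕ} (hU : IsOpen U) (hA : ∀ i, ContDiffOn ℝ n (A i) U)
    (hmn : m + 2 ≤ n) (i : Fin 3) : ContDiffOn ℝ m (obstruction (thomas A) i) U := by
  have hL := contDiffOn_cotton (m := m) hU hA (by exact_mod_cast hmn)
  have hr : ∀ a, ContDiffOn ℝ m (raise (cotton (thomas A)) a) U := fun a =>
    ContDiffOn.sum fun b _ => contDiffOn_const.mul (hL b)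
  fin_cases i
  · exact contDiffOn_const.mul (hr 0)
  · exact contDiffOn_const.mul (hr 1)
  · exact contDiffOn_const

/-- A Killing form that does not vanish forces `W` to vanish. -/
theorem IsKillingOn.wTensor_eq_zero {K : Fin 2 → ℝ × ℝ → ℝ} (h : IsKillingOn (thomas A) K U)
    (hU : IsOpen U) (hK : ∀ a, ContDiffOn ℝ 3 (K a) U) (hA : ∀ i, ContDiffOn ℝ 4 (A i) U)
    (hq : q ∈ U) (hKq : ∃ a, K a q ≠ 0) (a b c : Fin 2) : wTensor (thomas A) a b c q = 0 := by
  have hAd : ∀ i, DifferentiableOn ℝ (A i) U := fun i => (hA i).differentiableOn (by norm_num)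
  have hK2 : ∀ a, ContDiffOn ℝ 2 (K a) U := fun a => (hK a).of_le (by norm_num)
  have hF2 : ∀ i, ContDiffOn ℝ (2 : ℕ) (obstruction (thomas A) i) U :=
    contDiffOn_obstruction (n := 4) hU hA le_rfl
  have hF1 : ∀ a i, ContDiffOn ℝ (1 : ℕ) (dualD (thomas A) a (obstruction (thomas A)) i) U :=
    contDiffOn_dualD (n := 4) hU hA (by norm_num) hF2
  have h0 : ∀ q ∈ U, obstruction (thomas A) 0 q * K 0 q + obstruction (thomas A) 1 q * K 1 q
      + obstruction (thomas A) 2 q * skewPart K q = 0 := by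
    intro q hq
    have := h.cotton_mul hU hK (fun i => (hA i).of_le (by norm_num)) hq
    simp [obstruction, raise, eps, Fin.sum_univ_two]
    linear_combination this / 3
  have h1 : ∀ a, ∀ q ∈ U, _ := fun a q hq => h.sum_dualD_mul hU hK2 hAd
    (fun i => (hF2 i).differentiableOn (by norm_num)) h0 hq a
  have h2 : ∀ a b, ∀ q ∈ U, _ := fun a b q hq => h.sum_dualD_mul hU hK2 hAd
    (fun i => (hF1 b i).differentiableOn (by norm_num)) (h1 b) hq a
  -- The triple `(K, μ)` is a nonzero vector in the kernel of the matrix: `h0` is annihilation by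
  -- `V`, and each use of duality transfers it to one more derivative of `V`.
  refine Matrix.exists_mulVec_eq_zero_iff.1 ⟨![K 0 q, K 1 q, skewPart K q], ?_, ?_⟩
  · intro hz
    obtain ⟨e, he⟩ := hKq
    fin_cases e
    · exact he (congrFun hz 0)
    · exact he (congrFun hz 1)
  · ext i
    fin_cases i
    · simpa [Matrix.mulVec, dotProduct, Fin.sum_univ_three] using h0 q hq
    · simpa [Matrix.mulVec, dotProduct, Fin.sum_univ_three] using h1 a q hq
    · simp [Matrix.mulVec, dotProduct, Fin.sum_univ_three, dualD2]
      linear_combination (h2 b c q hq + h2 c b q hq - (thomas A 0 b c q + thomas A 0 c b q)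
        * h1 0 q hq - (thomas A 1 b c q + thomas A 1 c b q) * h1 1 q hq) / 2

/-! ### The invariants in the presence of a Killing form -/

theorem nu5_eq (A : Fin 4 → ℝ × ℝ → ℝ) (q : ℝ × ℝ) :
    nu5 A q = liouvilleL A 1 q ^ 2 * covForm (thomas A) (liouvilleL A) 0 0 q
      - liouvilleL A 0 q * liouvilleL A 1 q * (covForm (thomas A) (liouvilleL A) 0 1 q
        + covForm (thomas A) (liouvilleL A) 1 0 q)
      + liouvilleL A 0 q ^ 2 * covForm (thomas A) (liouvilleL A) 1 1 q := by
  simp [nu5, raise, eps, Fin.sum_univ_two]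
  ring

/-- Differentiate `L ∧ K = 0` covariantly. As `∇ₐK_b` is a multiple of `ε_{ab}`, contracting the
derivative index with `Lᵃ` turns the term `L ∧ ∇ₐK` into a multiple of `L ∧ L = 0`. What remains is
`(Lᵃ∇ₐL) ∧ K = 0`, where `K` is parallel to `L`. -/
theorem IsKillingOn.nu5_eq_zero {K : Fin 2 → ℝ × ℝ → ℝ} (h : IsKillingOn (thomas A) K U)
    (hU : IsOpen U) (hK : ∀ a, ContDiffOn ℝ 3 (K a) U) (hA : ∀ i, ContDiffOn ℝ 4 (A i) U)
    (hq : q ∈ U) (hKq : ∃ a, K a q ≠ 0) : nu5 A q = 0 := by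
  have hz : ∀ r ∈ U, cotton (thomas A) 1 r * K 0 r - cotton (thomas A) 0 r * K 1 r = 0 :=
    fun r hr => h.cotton_mul hU hK (fun i => (hA i).of_le (by norm_num)) hr
  have hKd : ∀ a, DifferentiableAt ℝ (K a) q := fun a =>
    ((hK a).differentiableOn (by norm_num)).differentiableAt (hU.mem_nhds hq)
  have k0 := hKd 0
  have k1 := hKd 1
  have hLd : ∀ b, DifferentiableAt ℝ (cotton (thomas A) b) q := fun b =>
    ((contDiffOn_cotton (m := 2) hU hA (by norm_num) b).differentiableOn
      (by norm_num)).differentiableAt (hU.mem_nhds hq)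
  have l0 := hLd 0
  have l1 := hLd 1
  have c0 := pd_congr hU hz hq 0
  have c1 := pd_congr hU hz hq 1
  simp (disch := fun_prop) only [pd_sub, pd_mul, pd_const] at c0 c1
  obtain ⟨d1, d2, d3, d4⟩ := h.pd_eq hq
  rw [d1, d2] at c0
  rw [d3, d4] at c1
  have hzq := hz q hq
  rw [nu5_eq]
  simp only [liouvilleL]
  have s0 : covForm (thomas A) (cotton (thomas A)) 0 1 q * K 0 q
      - covForm (thomas A) (cotton (thomas A)) 0 0 q * K 1 q
      - cotton (thomas A) 0 q * skewPart K q = 0 := by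
    simp [covForm, thomas, Fin.sum_univ_two]
    linear_combination c0
  have s1 : covForm (thomas A) (cotton (thomas A)) 1 1 q * K 0 q
      - covForm (thomas A) (cotton (thomas A)) 1 0 q * K 1 q
      - cotton (thomas A) 1 q * skewPart K q = 0 := by
    simp [covForm, thomas, Fin.sum_univ_two]
    linear_combination c1
  generalize covForm (thomas A) (cotton (thomas A)) 0 0 q = S00 at s0 s1 ⊢
  generalize covForm (thomas A) (cotton (thomas A)) 0 1 q = S01 at s0 s1 ⊢
  generalize covForm (thomas A) (cotton (thomas A)) 1 0 q = S10 at s0 s1 ⊢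
  generalize covForm (thomas A) (cotton (thomas A)) 1 1 q = S11 at s0 s1 ⊢
  generalize cotton (thomas A) 0 q = L0 at s0 s1 hzq ⊢
  generalize cotton (thomas A) 1 q = L1 at s0 s1 hzq ⊢
  obtain ⟨a, ha⟩ := hKq
  -- `L` is allowed to vanish at `q`, so the identity is proved after multiplication by a nonzero
  -- component of `K`. The combination `L1 * s0 - L0 * s1` is the contraction with `Lᵃ` that removes
  -- `skewPart K`.
  refine (mul_eq_zero.1 ?_).resolve_left ha
  fin_cases a
  · change K 0 q * _ = 0
    linear_combination -L0 * (L1 * s0 - L0 * s1) + (L1 * S00 - L0 * S10) * hzq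
  · change K 1 q * _ = 0
    linear_combination -L1 * (L1 * s0 - L0 * s1) + (L1 * S01 - L0 * S11) * hzq

theorem IsKillingOn.w1_eq_zero {K : Fin 2 → ℝ × ℝ → ℝ} (h : IsKillingOn (thomas A) K U)
    (hU : IsOpen U) (hK : ∀ a, ContDiffOn ℝ 3 (K a) U) (hA : ∀ i, ContDiffOn ℝ 4 (A i) U)
    (hq : q ∈ U) (hKq : ∃ a, K a q ≠ 0) : w1 A q = 0 := by
  simp [w1, h.wTensor_eq_zero hU hK hA hq hKq]

end

section

/-! ### Liouville's `w₁` as the curvature of a one-form -/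

variable {A : Fin 4 → ℝ × ℝ → ℝ} {U : Set (ℝ × ℝ)} {q : ℝ × ℝ}

/-- The symmetrised covariant derivative of `L` is the symmetric product of `L` and `M`. -/
def IsRecurrentOn (Γ : Conn) (L M : Fin 2 → ℝ × ℝ → ℝ) (U : Set (ℝ × ℝ)) : Prop :=
  ∀ q ∈ U, ∀ a b, covForm Γ L a b q + covForm Γ L b a q = L a q * M b q + L b q * M a q

theorem IsRecurrentOn.pd_eq {L M : Fin 2 → ℝ × ℝ → ℝ} (h : IsRecurrentOn (thomas A) L M U)
    (hq : q ∈ U) :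
    pd 0 (L 0) q = A 1 q / 3 * L 0 q - A 0 q * L 1 q + L 0 q * M 0 q ∧
    pd 0 (L 1) q = A 2 q / 3 * L 0 q - A 1 q / 3 * L 1 q
      + (L 0 q * M 1 q + L 1 q * M 0 q) / 2 + skewPart L q ∧
    pd 1 (L 0) q = A 2 q / 3 * L 0 q - A 1 q / 3 * L 1 q
      + (L 0 q * M 1 q + L 1 q * M 0 q) / 2 - skewPart L q ∧
    pd 1 (L 1) q = A 3 q * L 0 q - A 2 q / 3 * L 1 q + L 1 q * M 1 q := by
  have h00 := h q hq 0 0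
  have h01 := h q hq 0 1
  have h11 := h q hq 1 1
  simp [covForm, thomas, Fin.sum_univ_two] at h00 h01 h11
  simp only [skewPart]
  refine ⟨?_, ?_, ?_, ?_⟩ <;> linarith

/-- The same commutation argument as for a Killing form, now with the source term `L ⊙ M` in the
symmetric part of `∇L`; the additional terms are the derivatives of that source and its contractions
with the symbols. -/
theorem IsRecurrentOn.pd_skewPart {L M : Fin 2 → ℝ × ℝ → ℝ} (h : IsRecurrentOn (thomas A) L M U)
    (hU : IsOpen U) (hL : ∀ a, ContDiffOn ℝ 2 (L a) U) (hM : ∀ a, DifferentiableOn ℝ (M a) U)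
    (hA : ∀ i, DifferentiableOn ℝ (A i) U) (hq : q ∈ U) :
    pd 0 (skewPart L) q =
        schouten (thomas A) 0 1 q * L 0 q - schouten (thomas A) 0 0 q * L 1 q
        + (pd 0 (L 0) q * M 1 q + L 0 q * pd 0 (M 1) q + pd 0 (L 1) q * M 0 q
          + L 1 q * pd 0 (M 0) q) / 2
        - (pd 1 (L 0) q * M 0 q + L 0 q * pd 1 (M 0) q)
        + A 2 q / 3 * (L 0 q * M 0 q) - A 1 q / 3 * (L 0 q * M 1 q + L 1 q * M 0 q)
        + A 0 q * (L 1 q * M 1 q) ∧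
      pd 1 (skewPart L) q =
        schouten (thomas A) 1 1 q * L 0 q - schouten (thomas A) 0 1 q * L 1 q
        - (pd 1 (L 0) q * M 1 q + L 0 q * pd 1 (M 1) q + pd 1 (L 1) q * M 0 q
          + L 1 q * pd 1 (M 0) q) / 2
        + (pd 0 (L 1) q * M 1 q + L 1 q * pd 0 (M 1) q)
        + A 3 q * (L 0 q * M 0 q) - A 2 q / 3 * (L 0 q * M 1 q + L 1 q * M 0 q)
        + A 1 q / 3 * (L 1 q * M 1 q) := by
  have hAd : ∀ i, DifferentiableAt ℝ (A i) q := fun i => (hA i).differentiableAt (hU.mem_nhds hq)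
  have a0 := hAd 0
  have a1 := hAd 1
  have a2 := hAd 2
  have a3 := hAd 3
  have hLd : ∀ a, DifferentiableAt ℝ (L a) q := fun a =>
    ((hL a).differentiableOn (by norm_num)).differentiableAt (hU.mem_nhds hq)
  have l0 := hLd 0
  have l1 := hLd 1
  have m0 := (hM 0).differentiableAt (hU.mem_nhds hq)
  have m1 := (hM 1).differentiableAt (hU.mem_nhds hq)
  have hm : DifferentiableAt ℝ (skewPart L) q :=
    ((contDiffOn_skewPart (m := 1) hU hL (by norm_num)).differentiableOn
      (by norm_num)).differentiableAt (hU.mem_nhds hq)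
  have c0 := pd_comm hU (hL 0) hq
  have c1 := pd_comm hU (hL 1) hq
  rw [pd_congr hU (fun r hr => (h.pd_eq hr).1) hq,
    pd_congr hU (fun r hr => (h.pd_eq hr).2.2.1) hq] at c0
  rw [pd_congr hU (fun r hr => (h.pd_eq hr).2.1) hq,
    pd_congr hU (fun r hr => (h.pd_eq hr).2.2.2) hq] at c1
  simp (disch := fun_prop) only [pd_add, pd_sub, pd_mul, pd_div_const] at c0 c1
  obtain ⟨d1, d2, d3, d4⟩ := h.pd_eq hq
  rw [d1, d2, d3, d4] at c0 c1
  rw [d1, d2, d3, d4]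
  simp only [schouten_thomas hAd]
  constructor
  · simp; linear_combination -c0
  · simp; linear_combination -c1

theorem dualD_thomas (V : Fin 3 → ℝ × ℝ → ℝ) (a : Fin 2) (i : Fin 3) :
    dualD (thomas A) a V i q =
      (![![pd 0 (V 0) q + A 1 q / 3 * V 0 q + A 2 q / 3 * V 1 q
            + schouten (thomas A) 1 0 q * V 2 q,
          pd 0 (V 1) q - A 0 q * V 0 q - A 1 q / 3 * V 1 q - schouten (thomas A) 0 0 q * V 2 q,
          pd 0 (V 2) q + V 1 q],
        ![pd 1 (V 0) q + A 2 q / 3 * V 0 q + A 3 q * V 1 q + schouten (thomas A) 1 1 q * V 2 q,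
          pd 1 (V 1) q - A 1 q / 3 * V 0 q - A 2 q / 3 * V 1 q
            - schouten (thomas A) 0 1 q * V 2 q,
          pd 1 (V 2) q - V 0 q]] : Fin 2 → Fin 3 → ℝ) a i := by
  fin_cases a <;> fin_cases i <;> simp [dualD, thomas, eps, Fin.sum_univ_two] <;> ring

/-- The first covariant derivatives of the triple `(L¹, L², 0) / 3`. -/
theorem IsRecurrentOn.dualD_obstruction {M : Fin 2 → ℝ × ℝ → ℝ}
    (h : IsRecurrentOn (thomas A) (cotton (thomas A)) M U) (hU : IsOpen U)
    (hL : ∀ a, ContDiffOn ℝ 1 (cotton (thomas A) a) U) (hq : q ∈ U) (a : Fin 2) (i : Fin 3) :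
    dualD (thomas A) a (obstruction (thomas A)) i q =
      (![![((cotton (thomas A) 0 q * M 1 q + cotton (thomas A) 1 q * M 0 q) / 2
            + skewPart (cotton (thomas A)) q) / 3,
          -(cotton (thomas A) 0 q * M 0 q) / 3, -cotton (thomas A) 0 q / 3],
        ![cotton (thomas A) 1 q * M 1 q / 3,
          (skewPart (cotton (thomas A)) q
            - (cotton (thomas A) 0 q * M 1 q + cotton (thomas A) 1 q * M 0 q) / 2) / 3,
          -cotton (thomas A) 1 q / 3]] : Fin 2 → Fin 3 → ℝ) a i := by
  have hLd : ∀ a, DifferentiableAt ℝ (cotton (thomas A) a) q := fun a =>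
    ((hL a).differentiableOn (by norm_num)).differentiableAt (hU.mem_nhds hq)
  have l0 := hLd 0
  have l1 := hLd 1
  have f0 : obstruction (thomas A) 0 = fun q => 1 / 3 * cotton (thomas A) 1 q := by
    funext q; simp [obstruction, raise, eps, Fin.sum_univ_two]
  have f1 : obstruction (thomas A) 1 = fun q => 1 / 3 * -cotton (thomas A) 0 q := by
    funext q; simp [obstruction, raise, eps, Fin.sum_univ_two]
  have f2 : obstruction (thomas A) 2 = fun _ => 0 := rfl
  obtain ⟨d1, d2, d3, d4⟩ := h.pd_eq hq
  fin_cases a <;> fin_cases i <;>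
    simp (disch := fun_prop) [dualD, thomas, eps, Fin.sum_univ_two, f0, f1, f2, pd_const_mul,
      pd_neg, pd_const, d1, d2, d3, d4] <;> ring

theorem wTensor_diag (Γ : Conn) (a : Fin 2) (q : ℝ × ℝ) :
    wTensor Γ a a a q =
      obstruction Γ 0 q * (dualD Γ a (obstruction Γ) 1 q * dualD2 Γ a a (obstruction Γ) 2 q
        - dualD Γ a (obstruction Γ) 2 q * dualD2 Γ a a (obstruction Γ) 1 q)
      - obstruction Γ 1 q * (dualD Γ a (obstruction Γ) 0 q * dualD2 Γ a a (obstruction Γ) 2 q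
        - dualD Γ a (obstruction Γ) 2 q * dualD2 Γ a a (obstruction Γ) 0 q)
      + obstruction Γ 2 q * (dualD Γ a (obstruction Γ) 0 q * dualD2 Γ a a (obstruction Γ) 1 q
        - dualD Γ a (obstruction Γ) 1 q * dualD2 Γ a a (obstruction Γ) 0 q) := by
  have h : ∀ v0 v1 v2 : Fin 3 → ℝ, Matrix.det (![v0, v1, v2] : Matrix (Fin 3) (Fin 3) ℝ) =
      v0 0 * (v1 1 * v2 2 - v1 2 * v2 1) - v0 1 * (v1 0 * v2 2 - v1 2 * v2 0)
        + v0 2 * (v1 0 * v2 1 - v1 1 * v2 0) := fun v0 v1 v2 => by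
    refine (Matrix.det_fin_three _).trans ?_
    change v0 0 * v1 1 * v2 2 - v0 0 * v1 2 * v2 1 - v0 1 * v1 0 * v2 2 + v0 1 * v1 2 * v2 0
      + v0 2 * v1 0 * v2 1 - v0 2 * v1 1 * v2 0 = _
    ring
  refine (h _ _ _).trans ?_
  simp only [add_self_div_two]

/-- The recurrence expresses every derivative of `L` that enters `W` through `L`, `M`, the skew part
of `∇L` and the first derivatives of `M`. In the determinant all of this cancels except the exterior
derivative of `M`, the part of `M` that is unchanged when `L` is rescaled by a function. -/
theorem IsRecurrentOn.wTensor_eq {M : Fin 2 → ℝ × ℝ → ℝ}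
    (h : IsRecurrentOn (thomas A) (cotton (thomas A)) M U) (hU : IsOpen U)
    (hA : ∀ i, ContDiffOn ℝ 4 (A i) U) (hM : ∀ a, DifferentiableOn ℝ (M a) U) (hq : q ∈ U)
    (a : Fin 2) : wTensor (thomas A) a a a q =
      cotton (thomas A) a q ^ 3 * (pd 0 (M 1) q - pd 1 (M 0) q) / 27 := by
  have hAd : ∀ i, DifferentiableOn ℝ (A i) U := fun i => (hA i).differentiableOn (by norm_num)
  have hL : ∀ a, ContDiffOn ℝ 2 (cotton (thomas A) a) U :=
    contDiffOn_cotton (m := 2) hU hA (by norm_num)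
  have hD := fun r (hr : r ∈ U) => h.dualD_obstruction (q := r) hU (fun a => (hL a).of_le (by norm_num)) hr
  obtain ⟨d1, d2, d3, d4⟩ := h.pd_eq hq
  obtain ⟨e1, e2⟩ := h.pd_skewPart hU hL hM hAd hq
  rw [d1, d2, d3] at e1
  rw [d2, d3, d4] at e2
  have hs := schouten_thomas_comm fun i => (hAd i).differentiableAt (hU.mem_nhds hq)
  have hLd : ∀ a, DifferentiableAt ℝ (cotton (thomas A) a) q := fun a =>
    ((hL a).differentiableOn (by norm_num)).differentiableAt (hU.mem_nhds hq)
  have l0 := hLd 0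
  have l1 := hLd 1
  have m0 := (hM 0).differentiableAt (hU.mem_nhds hq)
  have m1 := (hM 1).differentiableAt (hU.mem_nhds hq)
  have hm : DifferentiableAt ℝ (skewPart (cotton (thomas A))) q :=
    ((contDiffOn_skewPart (m := 1) hU hL (by norm_num)).differentiableOn
      (by norm_num)).differentiableAt (hU.mem_nhds hq)
  have g := fun c a i => pd_congr hU (fun r hr => hD r hr a i) hq c
  rw [wTensor_diag]
  have f0 : obstruction (thomas A) 0 q = 1 / 3 * cotton (thomas A) 1 q := by
    simp [obstruction, raise, eps, Fin.sum_univ_two]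
  have f1 : obstruction (thomas A) 1 q = 1 / 3 * -cotton (thomas A) 0 q := by
    simp [obstruction, raise, eps, Fin.sum_univ_two]
  have f2 : obstruction (thomas A) 2 q = 0 := rfl
  fin_cases a
  · have g0 := g 0 0 0
    have g1 := g 0 0 1
    have g2 := g 0 0 2
    simp (disch := fun_prop) [neg_div, pd_neg, pd_add, pd_mul, pd_div_const] at g0 g1 g2
    rw [d1, d2, e1] at g0
    rw [d1] at g1 g2
    have b := fun i => dualD_thomas (A := A) (q := q) (dualD (thomas A) 0 (obstruction (thomas A)))
      0 i
    have b0 := b 0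
    have b1 := b 1
    have b2 := b 2
    simp [g0, g1, g2, hs, hD q hq] at b0 b1 b2
    simp [dualD2, b0, b1, b2, f0, f1, f2, hD q hq, thomas, Fin.sum_univ_two]
    ring
  · have g0 := g 1 1 0
    have g1 := g 1 1 1
    have g2 := g 1 1 2
    simp (disch := fun_prop) [neg_div, pd_neg, pd_add, pd_sub, pd_mul, pd_div_const] at g0 g1 g2
    rw [d4] at g0 g2
    rw [d3, d4, e2] at g1
    have b := fun i => dualD_thomas (A := A) (q := q) (dualD (thomas A) 1 (obstruction (thomas A)))
      1 i
    have b0 := b 0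
    have b1 := b 1
    have b2 := b 2
    simp [g0, g1, g2, hs, hD q hq] at b0 b1 b2
    simp [dualD2, b0, b1, b2, f0, f1, f2, hD q hq, thomas, Fin.sum_univ_two]
    ring


/-! ### A Killing form from the vanishing of the invariants -/

theorem contDiffOn_covForm {L : Fin 2 → ℝ × ℝ → ℝ} {m n : WithTop ℕ∞} (hU : IsOpen U)
    (hA : ∀ i, ContDiffOn ℝ m (A i) U) (hL : ∀ a, ContDiffOn ℝ n (L a) U) (hmn : m + 1 ≤ n)
    (a b : Fin 2) : ContDiffOn ℝ m (covForm (thomas A) L a b) U :=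
  ((hL b).pd_of_le hU hmn a).sub (ContDiffOn.sum fun c _ =>
    (contDiffOn_thomas hA c a b).mul ((hL c).of_le (le_self_add.trans hmn)))

/-- A quadratic form on the plane that vanishes on `ker L` is divisible by `L`, and the hypothesis
`hν` is this vanishing for the symmetric part of `∇L`. Where `L a ≠ 0`, two of the three component
equations give `M` by division, and the third is `hν`. -/
theorem exists_isRecurrentOn {L : Fin 2 → ℝ × ℝ → ℝ} (hU : IsOpen U)
    (hA : ∀ i, ContDiffOn ℝ 1 (A i) U) (hL : ∀ a, ContDiffOn ℝ 2 (L a) U)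
    (hν : ∀ q ∈ U, L 1 q ^ 2 * covForm (thomas A) L 0 0 q
      - L 0 q * L 1 q * (covForm (thomas A) L 0 1 q + covForm (thomas A) L 1 0 q)
      + L 0 q ^ 2 * covForm (thomas A) L 1 1 q = 0)
    (a : Fin 2) (ha : ∀ q ∈ U, L a q ≠ 0) :
    ∃ M : Fin 2 → ℝ × ℝ → ℝ, (∀ a, ContDiffOn ℝ 1 (M a) U) ∧ IsRecurrentOn (thomas A) L M U := by
  have hC : ∀ a b, ContDiffOn ℝ 1 (covForm (thomas A) L a b) U :=
    contDiffOn_covForm hU hA hL (by norm_num)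
  have hL1 : ∀ a, ContDiffOn ℝ 1 (L a) U := fun a => (hL a).of_le (by norm_num)
  fin_cases a
  · have ha0 : ∀ q ∈ U, L 0 q ≠ 0 := ha
    have hM0 : ContDiffOn ℝ 1 (fun q => covForm (thomas A) L 0 0 q / L 0 q) U :=
      (hC 0 0).div (hL1 0) ha0
    have hM1 : ContDiffOn ℝ 1 (fun q => (covForm (thomas A) L 0 1 q + covForm (thomas A) L 1 0 q
        - L 1 q * (covForm (thomas A) L 0 0 q / L 0 q)) / L 0 q) U :=
      (((hC 0 1).add (hC 1 0)).sub ((hL1 1).mul hM0)).div (hL1 0) ha0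
    refine ⟨![_, _], Fin.forall_fin_two.2 ⟨hM0, hM1⟩, fun q hq => ?_⟩
    have h0 := ha0 q hq
    have hν := hν q hq
    simp only [Fin.forall_fin_two, Matrix.cons_val_zero, Matrix.cons_val_one]
    refine ⟨⟨?_, ?_⟩, ?_, ?_⟩ <;> field_simp <;>
      first | linear_combination hν | ring
  · have ha1 : ∀ q ∈ U, L 1 q ≠ 0 := ha
    have hM1 : ContDiffOn ℝ 1 (fun q => covForm (thomas A) L 1 1 q / L 1 q) U :=
      (hC 1 1).div (hL1 1) ha1
    have hM0 : ContDiffOn ℝ 1 (fun q => (covForm (thomas A) L 0 1 q + covForm (thomas A) L 1 0 q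
        - L 0 q * (covForm (thomas A) L 1 1 q / L 1 q)) / L 1 q) U :=
      (((hC 0 1).add (hC 1 0)).sub ((hL1 0).mul hM1)).div (hL1 1) ha1
    refine ⟨![_, _], Fin.forall_fin_two.2 ⟨hM0, hM1⟩, fun q hq => ?_⟩
    have h0 := ha1 q hq
    have hν := hν q hq
    simp only [Fin.forall_fin_two, Matrix.cons_val_zero, Matrix.cons_val_one]
    refine ⟨⟨?_, ?_⟩, ?_, ?_⟩ <;> field_simp <;>
      first | linear_combination hν | ring

/-- The Poincaré lemma for one-forms in the plane. -/
theorem exists_potential {M : Fin 2 → ℝ × ℝ → ℝ} (hU : IsOpen U) (hc : Convex ℝ U)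
    (hM : ∀ a, ContDiffOn ℝ 1 (M a) U) (h : ∀ q ∈ U, pd 0 (M 1) q = pd 1 (M 0) q) :
    ∃ m : ℝ × ℝ → ℝ, ContDiffOn ℝ 2 m U ∧ ∀ q ∈ U, ∀ a, pd a m q = M a q := by
  have hMd : ∀ q ∈ U, ∀ a, DifferentiableAt ℝ (M a) q := fun q hq a =>
    ((hM a).differentiableOn (by norm_num)).differentiableAt (hU.mem_nhds hq)
  let P : ℝ × ℝ → ℝ × ℝ →L[ℝ] ℝ := fun q =>
    M 0 q • ContinuousLinearMap.fst ℝ ℝ ℝ + M 1 q • ContinuousLinearMap.snd ℝ ℝ ℝ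
  have hP : ∀ q ∈ U, HasFDerivAt P
      ((fderiv ℝ (M 0) q).smulRight (ContinuousLinearMap.fst ℝ ℝ ℝ)
        + (fderiv ℝ (M 1) q).smulRight (ContinuousLinearMap.snd ℝ ℝ ℝ)) q := fun q hq =>
    ((hMd q hq 0).hasFDerivAt.smul_const (ContinuousLinearMap.fst ℝ ℝ ℝ)).fun_add
      ((hMd q hq 1).hasFDerivAt.smul_const (ContinuousLinearMap.snd ℝ ℝ ℝ))
  obtain ⟨m, hm⟩ := hc.exists_forall_hasFDerivWithinAt_of_hasFDerivWithinAt_symmetric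
    (fun q hq => (hP q hq).hasFDerivWithinAt) (fun q hq x _ y _ => by
      simp [fderiv_eq_pd]
      rw [h q hq]; ring)
  have hm' : ∀ q ∈ U, HasFDerivAt m (P q) q := fun q hq => (hm q hq).hasFDerivAt (hU.mem_nhds hq)
  have hpd : ∀ q ∈ U, ∀ a, pd a m q = M a q := by
    intro q hq a
    rw [pd_eq_of_hasFDerivAt (hm' q hq)]
    fin_cases a <;> simp [P]
  refine ⟨m, ?_, hpd⟩
  exact contDiffOn_succ_of_pd (m := 1) hU
    (fun q hq => (hm' q hq).differentiableAt.differentiableWithinAt)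
    fun a => (hM a).congr fun q hq => hpd q hq a

theorem pd_exp_neg (a : Fin 2) {f : ℝ × ℝ → ℝ} (hf : DifferentiableAt ℝ f q) :
    pd a (fun x => Real.exp (-f x)) q = -(Real.exp (-f q) * pd a f q) := by
  rw [pd_eq_of_hasFDerivAt hf.hasFDerivAt.fun_neg.exp]
  simp [pd]

/-- The derivative of `e^(-m)` contributes `-e^(-m) dm ⊙ L`, which cancels the recurrence term
because `dm = M`. -/
theorem IsRecurrentOn.isKillingOn {L M : Fin 2 → ℝ × ℝ → ℝ} {m : ℝ × ℝ → ℝ} {Γ : Conn}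
    (h : IsRecurrentOn Γ L M U) (hU : IsOpen U) (hL : ∀ a, DifferentiableOn ℝ (L a) U)
    (hm : DifferentiableOn ℝ m U) (hmM : ∀ q ∈ U, ∀ a, pd a m q = M a q) :
    IsKillingOn Γ (fun a q => Real.exp (-m q) * L a q) U := by
  refine ⟨fun a => hm.neg.exp.mul (hL a), fun q hq a b => ?_⟩
  have hmd := hm.differentiableAt (hU.mem_nhds hq)
  have hLd := fun a => (hL a).differentiableAt (hU.mem_nhds hq)
  have hq' := h q hq a b
  simp only [covForm, Fin.sum_univ_two] at hq' ⊢
  rw [pd_mul a hmd.fun_neg.exp (hLd b), pd_mul b hmd.fun_neg.exp (hLd a), pd_exp_neg a hmd,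
    pd_exp_neg b hmd, hmM q hq a, hmM q hq b]
  linear_combination Real.exp (-m q) * hq'

/-- If Liouville's invariants vanish, the projective structure has a Killing form. -/
theorem exists_isKillingOn {p : ℝ × ℝ} {Ω : Set (ℝ × ℝ)} (hΩ : IsOpen Ω)
    (hA : ∀ i, ContDiffOn ℝ 4 (A i) Ω) (hp : p ∈ Ω) (hL : ∃ a, liouvilleL A a p ≠ 0)
    (h : ∀ᶠ q in 𝓝 p, nu5 A q = 0 ∧ w1 A q = 0) :
    ∃ (U : Set (ℝ × ℝ)) (K : Fin 2 → ℝ × ℝ → ℝ), IsOpen U ∧ p ∈ U ∧ U ⊆ Ω ∧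
      (∀ a, ContDiffOn ℝ 2 (K a) U) ∧ IsKillingOn (thomas A) K U ∧ ∃ a, K a p ≠ 0 := by
  obtain ⟨a, ha⟩ := hL
  have hLΩ : ∀ a, ContDiffOn ℝ 2 (cotton (thomas A) a) Ω :=
    contDiffOn_cotton (m := 2) hΩ hA (by norm_num)
  have hne : ∀ᶠ q in 𝓝 p, cotton (thomas A) a q ≠ 0 :=
    ((hLΩ a).continuousOn.continuousAt (hΩ.mem_nhds hp)).eventually_ne ha
  -- A ball is convex, as the Poincaré lemma below requires. One component `a` of `L` is nonzero on
  -- all of it, which gives a single formula for `M`.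
  obtain ⟨r, hr, hball⟩ := Metric.eventually_nhds_iff_ball.1
    ((h.and hne).and (hΩ.eventually_mem hp))
  have hU : IsOpen (Metric.ball p r) := Metric.isOpen_ball
  have hUΩ : Metric.ball p r ⊆ Ω := fun q hq => (hball q hq).2
  have hAU : ∀ i, ContDiffOn ℝ 4 (A i) (Metric.ball p r) := fun i => (hA i).mono hUΩ
  have hLU : ∀ a, ContDiffOn ℝ 2 (cotton (thomas A) a) (Metric.ball p r) := fun a =>
    (hLΩ a).mono hUΩ
  obtain ⟨M, hM, hrec⟩ := exists_isRecurrentOn hU (fun i => (hAU i).of_le (by norm_num)) hLU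
    (fun q hq => (nu5_eq A q).symm.trans (hball q hq).1.1.1) a (fun q hq => (hball q hq).1.2)
  have hMd : ∀ a, DifferentiableOn ℝ (M a) (Metric.ball p r) := fun a =>
    (hM a).differentiableOn (by norm_num)
  have hclosed : ∀ q ∈ Metric.ball p r, pd 0 (M 1) q = pd 1 (M 0) q := by
    intro q hq
    have hw := (hball q hq).1.1.2
    rw [w1] at hw
    split_ifs at hw with h0
    · rw [hrec.wTensor_eq hU hAU hMd hq] at hw
      simp only [liouvilleL] at hw h0
      field_simp at hw
      linarith
    · push Not at h0
      -- At a zero of the first component the second one is nonzero, since the component `a` has no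
      -- zero in the ball; hence the other branch of `w1` determines `dM` here.
      have h1 : cotton (thomas A) 1 q ≠ 0 := by
        intro h1
        have := (hball q hq).1.2
        fin_cases a
        · exact this h0
        · exact this h1
      rw [hrec.wTensor_eq hU hAU hMd hq] at hw
      simp only [liouvilleL] at hw
      field_simp at hw
      linarith
  obtain ⟨m, hm, hmM⟩ := exists_potential hU (convex_ball p r) hM hclosed
  refine ⟨_, _, hU, Metric.mem_ball_self hr, hUΩ, fun a => hm.neg.exp.mul (hLU a),
    hrec.isKillingOn hU (fun a => (hLU a).differentiableOn (by norm_num))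
      (hm.differentiableOn (by norm_num)) hmM, a, mul_ne_zero (Real.exp_ne_zero _) ha⟩

/-! ### Regularity of Killing forms -/

/-- A bootstrap in the closed system. The derivatives of `K` involve only `A`, `K` and `μ`; those of
`μ` involve only `P` and `K`, and `P` has one derivative less than `A`. So `μ` reaches class `Cⁿ`
and `K` reaches `Cⁿ⁺¹`, one order better than `A`. -/
theorem IsKillingOn.contDiffOn {K : Fin 2 → ℝ × ℝ → ℝ} {n : ℕ∞} (h : IsKillingOn (thomas A) K U)
    (hU : IsOpen U) (hn : 2 ≤ n) (hA : ∀ i, ContDiffOn ℝ n (A i) U)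
    (hK : ∀ a, ContDiffOn ℝ 2 (K a) U) (a : Fin 2) :
    ContDiffOn ℝ ((n + 1 : ℕ∞) : WithTop ℕ∞) (K a) U := by
  have hAd : ∀ i, DifferentiableOn ℝ (A i) U := fun i => (hA i).differentiableOn (by
    have : n ≠ 0 := fun h0 => by simp [h0] at hn
    exact_mod_cast this)
  have hAj : ∀ j : ℕ, (j : ℕ∞) ≤ n → ∀ i, ContDiffOn ℝ j (A i) U := fun j hj i =>
    (hA i).of_le (by exact_mod_cast hj)
  have hm1 : ContDiffOn ℝ 1 (skewPart K) U := contDiffOn_skewPart hU hK (by norm_num)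
  have hpd : ∀ j : ℕ, (∀ i, ContDiffOn ℝ j (A i) U) → (∀ a, ContDiffOn ℝ j (K a) U) →
      ContDiffOn ℝ j (skewPart K) U → ∀ a, ContDiffOn ℝ ((j + 1 : ℕ) : WithTop ℕ∞) (K a) U := by
    intro j hAj hKj hmj a
    refine contDiffOn_succ_of_pd hU (h.1 a) fun b => ?_
    have a0 := hAj 0
    have a1 := hAj 1
    have a2 := hAj 2
    have a3 := hAj 3
    have k0 := hKj 0
    have k1 := hKj 1
    fin_cases a <;> fin_cases b
    · exact ContDiffOn.congr (by fun_prop) fun q hq => (h.pd_eq hq).1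
    · exact ContDiffOn.congr (by fun_prop) fun q hq => (h.pd_eq hq).2.2.1
    · exact ContDiffOn.congr (by fun_prop) fun q hq => (h.pd_eq hq).2.1
    · exact ContDiffOn.congr (by fun_prop) fun q hq => (h.pd_eq hq).2.2.2
  have hind : ∀ j : ℕ, (j : ℕ∞) ≤ n →
      (∀ a, ContDiffOn ℝ j (K a) U) ∧ ContDiffOn ℝ j (skewPart K) U := by
    intro j
    induction j with
    | zero => exact fun _ => ⟨fun a => (hK a).of_le (by norm_num), hm1.of_le (by norm_num)⟩
    | succ j ih =>
      intro hj
      have hj' : (j : ℕ∞) ≤ n := le_trans (by exact_mod_cast j.le_succ) hj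
      obtain ⟨hKj, hmj⟩ := ih hj'
      refine ⟨hpd j (hAj j hj') hKj hmj, contDiffOn_succ_of_pd hU
        (hm1.differentiableOn (by norm_num)) fun b => ?_⟩
      have hP : ∀ a b, ContDiffOn ℝ j (schouten (thomas A) a b) U :=
        contDiffOn_schouten hU (hAj (j + 1) hj) (by push_cast; exact le_rfl)
      have k0 := hKj 0
      have k1 := hKj 1
      have p0 := hP 0 0
      have p1 := hP 0 1
      have p2 := hP 1 1
      fin_cases b
      · exact ContDiffOn.congr (by fun_prop) fun q hq => (h.pd_skewPart hU hK hAd hq).1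
      · exact ContDiffOn.congr (by fun_prop) fun q hq => (h.pd_skewPart hU hK hAd hq).2
  rw [contDiffOn_iff_forall_nat_le]
  intro j hj
  rcases j with _ | j
  · exact (hK a).of_le (by norm_num)
  · have hj' : (j : ℕ∞) ≤ n := by
      push_cast at hj
      exact (ENat.add_le_add_iff_right ENat.one_ne_top).1 hj
    exact hpd j (hAj j hj') (hind j hj').1 (hind j hj').2 a

end

section

/-! ### Coordinate changes: the pointwise algebra

`x₀ x₁ y₀ y₁` stand for the first and `xᵢⱼ`, `yᵢⱼ` for the second derivatives of the new
coordinates. -/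

/-- The hypotheses read `3J ∇ₐ∇_bX = JₐX_b + J_bXₐ`, which is the Killing equation of `J^(-2/3) dX`
divided by its scale. They say that the left-hand sides of the four conclusions, as a binary cubic,
are a multiple of the cube of `dX`. -/
theorem cubic_of_killing {x0 x1 y0 y1 x00 x01 x11 y00 y01 y11 a0 a1 a2 a3 J J0 J1 : ℝ}
    (hJ : J = x0 * y1 - x1 * y0) (hJ0 : J ≠ 0)
    (hJ_0 : J0 = x00 * y1 + x0 * y01 - (x01 * y0 + x1 * y00))
    (hJ_1 : J1 = x01 * y1 + x0 * y11 - (x11 * y0 + x1 * y01))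
    (k00 : 3 * J * (x00 - (a1 / 3 * x0 - a0 * x1)) = 2 * J0 * x0)
    (k01 : 3 * J * (x01 - (a2 / 3 * x0 - a1 / 3 * x1)) = J0 * x1 + J1 * x0)
    (k11 : 3 * J * (x11 - (a3 * x0 - a2 / 3 * x1)) = 2 * J1 * x1) :
    ∃ F : ℝ,
      J * a0 + (x0 * y00 - y0 * x00) = F * x0 ^ 3 ∧
      J * a1 + (2 * x0 * y01 + x1 * y00 - (2 * y0 * x01 + y1 * x00)) = F * (3 * x0 ^ 2 * x1) ∧
      J * a2 + (x0 * y11 + 2 * x1 * y01 - (y0 * x11 + 2 * y1 * x01)) = F * (3 * x0 * x1 ^ 2) ∧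
      J * a3 + (x1 * y11 - y1 * x11) = F * x1 ^ 3 := by
  -- The vector `(y1, -y0)` is `J ∂_X`, so `F` is the Hessian `∇∇Y` evaluated twice on `∂_X`.
  obtain ⟨F, hF⟩ : ∃ F : ℝ, J ^ 2 * F = (y00 - (a1 / 3 * y0 - a0 * y1)) * y1 ^ 2
      - 2 * (y01 - (a2 / 3 * y0 - a1 / 3 * y1)) * y0 * y1
      + (y11 - (a3 * y0 - a2 / 3 * y1)) * y0 ^ 2 :=
    ⟨_, mul_div_cancel₀ _ (pow_ne_zero 2 hJ0)⟩
  have hne : 3 * J ^ 3 ≠ 0 := mul_ne_zero three_ne_zero (pow_ne_zero 3 hJ0)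
  subst hJ_0 hJ_1 hJ
  refine ⟨F, ?_, ?_, ?_, ?_⟩ <;> apply mul_left_cancel₀ hne
  · linear_combination -(x0 * y1 - x1 * y0) ^ 2 * (y0 * k00)
      - 2 * (x0 ^ 2 * y0) * (y1 ^ 2 * k00 - 2 * y0 * y1 * k01 + y0 ^ 2 * k11)
      - (x0 * y0 ^ 2) * (-(y1 * x1) * k00 + (y1 * x0 + y0 * x1) * k01 - y0 * x0 * k11)
      - 3 * (x0 * y1 - x1 * y0) * (x0 ^ 3) * hF
  · linear_combination -(x0 * y1 - x1 * y0) ^ 2 * ((y1 * k00 + 2 * y0 * k01))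
      - 2 * ((2 * x0 * x1 * y0 + x0 ^ 2 * y1)) * (y1 ^ 2 * k00 - 2 * y0 * y1 * k01 + y0 ^ 2 * k11)
      - ((x1 * y0 ^ 2 + 2 * x0 * y0 * y1)) * (-(y1 * x1) * k00 + (y1 * x0 + y0 * x1) * k01 - y0 * x0 * k11)
      - 3 * (x0 * y1 - x1 * y0) * ((3 * x0 ^ 2 * x1)) * hF
  · linear_combination -(x0 * y1 - x1 * y0) ^ 2 * ((y0 * k11 + 2 * y1 * k01))
      - 2 * ((x1 ^ 2 * y0 + 2 * x0 * x1 * y1)) * (y1 ^ 2 * k00 - 2 * y0 * y1 * k01 + y0 ^ 2 * k11)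
      - ((x0 * y1 ^ 2 + 2 * x1 * y0 * y1)) * (-(y1 * x1) * k00 + (y1 * x0 + y0 * x1) * k01 - y0 * x0 * k11)
      - 3 * (x0 * y1 - x1 * y0) * ((3 * x0 * x1 ^ 2)) * hF
  · linear_combination -(x0 * y1 - x1 * y0) ^ 2 * (y1 * k11)
      - 2 * (x1 ^ 2 * y1) * (y1 ^ 2 * k00 - 2 * y0 * y1 * k01 + y0 ^ 2 * k11)
      - (x1 * y1 ^ 2) * (-(y1 * x1) * k00 + (y1 * x0 + y0 * x1) * k01 - y0 * x0 * k11)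
      - 3 * (x0 * y1 - x1 * y0) * (x1 ^ 3) * hF

/-- `F (dX)³` vanishes as soon as one of its polarised arguments lies in `ker dX`. Three such
evaluations eliminate `F` and recover the three components of the equation for `∇∇X`. -/
theorem killing_of_cubic {x0 x1 y0 y1 x00 x01 x11 y00 y01 y11 a0 a1 a2 a3 J J0 J1 F : ℝ}
    (hJ : J = x0 * y1 - x1 * y0) (hJ0 : J ≠ 0)
    (hJ_0 : J0 = x00 * y1 + x0 * y01 - (x01 * y0 + x1 * y00))
    (hJ_1 : J1 = x01 * y1 + x0 * y11 - (x11 * y0 + x1 * y01))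
    (r0 : J * a0 + (x0 * y00 - y0 * x00) = F * x0 ^ 3)
    (r1 : J * a1 + (2 * x0 * y01 + x1 * y00 - (2 * y0 * x01 + y1 * x00)) =
      F * (3 * x0 ^ 2 * x1))
    (r2 : J * a2 + (x0 * y11 + 2 * x1 * y01 - (y0 * x11 + 2 * y1 * x01)) =
      F * (3 * x0 * x1 ^ 2))
    (r3 : J * a3 + (x1 * y11 - y1 * x11) = F * x1 ^ 3) :
    3 * J * (x00 - (a1 / 3 * x0 - a0 * x1)) = 2 * J0 * x0 ∧
    3 * J * (x01 - (a2 / 3 * x0 - a1 / 3 * x1)) = J0 * x1 + J1 * x0 ∧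
    3 * J * (x11 - (a3 * x0 - a2 / 3 * x1)) = 2 * J1 * x1 := by
  have hne : J ^ 2 ≠ 0 := pow_ne_zero 2 hJ0
  subst hJ_0 hJ_1 hJ
  refine ⟨?_, ?_, ?_⟩ <;> apply mul_left_cancel₀ hne
  -- The three bracketed multipliers polarise the cubic on `u = (y1, -y0)` and `w = (-x1, x0)`, at
  -- `(u, u, w)`, `(u, w, w)` and `(w, w, w)`; `w` spans `ker dX`.
  · linear_combination -3 * x0 ^ 2 * (-(y1 ^ 2 * x1) * r0 + (2 * y0 * y1 * x1 + y1 ^ 2 * x0) / 3 * r1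
        - (y0 ^ 2 * x1 + 2 * y0 * y1 * x0) / 3 * r2 + y0 ^ 2 * x0 * r3)
      - 3 * 2 * x0 * y0 * (y1 * x1 ^ 2 * r0 - (y0 * x1 ^ 2 + 2 * y1 * x0 * x1) / 3 * r1
        + (2 * y0 * x0 * x1 + y1 * x0 ^ 2) / 3 * r2 - y0 * x0 ^ 2 * r3)
      - 3 * y0 ^ 2 * (-x1 ^ 3 * r0 + x1 ^ 2 * x0 * r1 - x1 * x0 ^ 2 * r2 + x0 ^ 3 * r3)
  · linear_combination -3 * x0 * x1 * (-(y1 ^ 2 * x1) * r0 + (2 * y0 * y1 * x1 + y1 ^ 2 * x0) / 3 * r1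
        - (y0 ^ 2 * x1 + 2 * y0 * y1 * x0) / 3 * r2 + y0 ^ 2 * x0 * r3)
      - 3 * (x0 * y1 + x1 * y0) * (y1 * x1 ^ 2 * r0 - (y0 * x1 ^ 2 + 2 * y1 * x0 * x1) / 3 * r1
        + (2 * y0 * x0 * x1 + y1 * x0 ^ 2) / 3 * r2 - y0 * x0 ^ 2 * r3)
      - 3 * y0 * y1 * (-x1 ^ 3 * r0 + x1 ^ 2 * x0 * r1 - x1 * x0 ^ 2 * r2 + x0 ^ 3 * r3)
  · linear_combination -3 * x1 ^ 2 * (-(y1 ^ 2 * x1) * r0 + (2 * y0 * y1 * x1 + y1 ^ 2 * x0) / 3 * r1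
        - (y0 ^ 2 * x1 + 2 * y0 * y1 * x0) / 3 * r2 + y0 ^ 2 * x0 * r3)
      - 3 * 2 * x1 * y1 * (y1 * x1 ^ 2 * r0 - (y0 * x1 ^ 2 + 2 * y1 * x0 * x1) / 3 * r1
        + (2 * y0 * x0 * x1 + y1 * x0 ^ 2) / 3 * r2 - y0 * x0 ^ 2 * r3)
      - 3 * y1 ^ 2 * (-x1 ^ 3 * r0 + x1 ^ 2 * x0 * r1 - x1 * x0 ^ 2 * r2 + x0 ^ 3 * r3)

/-! ### Killing forms and coordinates -/

/-- The Jacobian determinant of `(X, Y)`. -/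
def jac (X Y : ℝ × ℝ → ℝ) : ℝ × ℝ → ℝ := fun q => pd 0 X q * pd 1 Y q - pd 1 X q * pd 0 Y q

/-- The coordinates `(X, Y)` transform the equation with coefficients `A` at `q` to one whose
right-hand side has the value `F`, whatever the slope. -/
def TransformsTo (A : Fin 4 → ℝ × ℝ → ℝ) (X Y : ℝ × ℝ → ℝ) (F : ℝ) (q : ℝ × ℝ) : Prop :=
  jac X Y q * A 0 q + (pd 0 X q * pd 0 (pd 0 Y) q - pd 0 Y q * pd 0 (pd 0 X) q) =
      F * pd 0 X q ^ 3 ∧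
  jac X Y q * A 1 q + (2 * pd 0 X q * pd 0 (pd 1 Y) q + pd 1 X q * pd 0 (pd 0 Y) q
      - (2 * pd 0 Y q * pd 0 (pd 1 X) q + pd 1 Y q * pd 0 (pd 0 X) q)) =
      F * (3 * pd 0 X q ^ 2 * pd 1 X q) ∧
  jac X Y q * A 2 q + (pd 0 X q * pd 1 (pd 1 Y) q + 2 * pd 1 X q * pd 0 (pd 1 Y) q
      - (pd 0 Y q * pd 1 (pd 1 X) q + 2 * pd 1 Y q * pd 0 (pd 1 X) q)) =
      F * (3 * pd 0 X q * pd 1 X q ^ 2) ∧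
  jac X Y q * A 3 q + (pd 1 X q * pd 1 (pd 1 Y) q - pd 1 Y q * pd 1 (pd 1 X) q) =
      F * pd 1 X q ^ 3

variable {A : Fin 4 → ℝ × ℝ → ℝ} {U : Set (ℝ × ℝ)} {X Y g : ℝ × ℝ → ℝ} {q : ℝ × ℝ}

theorem differentiableAt_pd (hU : IsOpen U) (hX : ContDiffOn ℝ 2 X U) (hq : q ∈ U) (a : Fin 2) :
    DifferentiableAt ℝ (pd a X) q :=
  ((hX.pd_of_le (m := 1) hU (by norm_num) a).differentiableOn
    (by norm_num)).differentiableAt (hU.mem_nhds hq)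

theorem contDiffOn_jac {m n : WithTop ℕ∞} (hU : IsOpen U) (hX : ContDiffOn ℝ n X U)
    (hY : ContDiffOn ℝ n Y U) (hmn : m + 1 ≤ n) : ContDiffOn ℝ m (jac X Y) U :=
  ((hX.pd_of_le hU hmn 0).mul (hY.pd_of_le hU hmn 1)).sub
    ((hX.pd_of_le hU hmn 1).mul (hY.pd_of_le hU hmn 0))

theorem pd_jac (hU : IsOpen U) (hX : ContDiffOn ℝ 2 X U) (hY : ContDiffOn ℝ 2 Y U) (hq : q ∈ U)
    (a : Fin 2) :
    pd a (jac X Y) q = pd a (pd 0 X) q * pd 1 Y q + pd 0 X q * pd a (pd 1 Y) q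
      - (pd a (pd 1 X) q * pd 0 Y q + pd 1 X q * pd a (pd 0 Y) q) := by
  have x0 := differentiableAt_pd hU hX hq 0
  have x1 := differentiableAt_pd hU hX hq 1
  have y0 := differentiableAt_pd hU hY hq 0
  have y1 := differentiableAt_pd hU hY hq 1
  unfold jac
  rw [pd_sub a (x0.fun_mul y1) (x1.fun_mul y0), pd_mul a x0 y1, pd_mul a x1 y0]

/-- This is the logarithmic derivative `3 dg/g + 2 dJ/J = 0`, cleared of denominators. -/
theorem pd_of_cube_mul_sq {J : ℝ × ℝ → ℝ} {c : ℝ} (hU : IsOpen U) (hq : q ∈ U)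
    (hg : DifferentiableAt ℝ g q) (hJ : DifferentiableAt ℝ J q) (hc : c ≠ 0)
    (h : ∀ r ∈ U, g r ^ 3 * J r ^ 2 = c) (a : Fin 2) :
    3 * J q * pd a g q = -2 * g q * pd a J q := by
  have h1 := pd_congr hU h hq a
  rw [pd_mul a (hg.fun_pow 3) (hJ.fun_pow 2), pd_pow a 3 hg, pd_pow a 2 hJ, pd_const] at h1
  have h0 := h q hq
  have hg0 : g q ≠ 0 := by rintro h; simp [h] at h0; exact hc h0.symm
  have hJ0 : J q ≠ 0 := by rintro h; simp [h] at h0; exact hc h0.symm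
  apply mul_left_cancel₀ (mul_ne_zero (pow_ne_zero 2 hg0) hJ0)
  push_cast at h1
  linear_combination h1

/-- The Killing equation for the multiple of `dX` of the right weight. -/
theorem isKillingOn_smul_iff {c : ℝ} (hU : IsOpen U) (hX : ContDiffOn ℝ 2 X U)
    (hY : ContDiffOn ℝ 2 Y U) (hg : DifferentiableOn ℝ g U) (hc : c ≠ 0)
    (h : ∀ r ∈ U, g r ^ 3 * jac X Y r ^ 2 = c) :
    IsKillingOn (thomas A) (fun a q => g q * pd a X q) U ↔ ∀ q ∈ U, ∃ F, TransformsTo A X Y F q := by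
  rw [isKillingOn_thomas_iff, and_iff_right fun a => hg.fun_mul
    ((hX.pd_of_le (m := 1) hU (by norm_num) a).differentiableOn (by norm_num))]
  refine forall₂_congr fun q hq => ?_
  have hgd := hg.differentiableAt (hU.mem_nhds hq)
  have hJd : DifferentiableAt ℝ (jac X Y) q :=
    ((contDiffOn_jac (m := 1) hU hX hY (by norm_num)).differentiableOn
      (by norm_num)).differentiableAt (hU.mem_nhds hq)
  have x0 := differentiableAt_pd hU hX hq 0
  have x1 := differentiableAt_pd hU hX hq 1
  have g0 := pd_of_cube_mul_sq hU hq hgd hJd hc h 0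
  have g1 := pd_of_cube_mul_sq hU hq hgd hJd hc h 1
  have h0 := h q hq
  have hgq : g q ≠ 0 := by rintro h; simp [h] at h0; exact hc h0.symm
  have hJq : jac X Y q ≠ 0 := by rintro h; simp [h] at h0; exact hc h0.symm
  have hJ3 : 3 * jac X Y q ≠ 0 := mul_ne_zero three_ne_zero hJq
  have j0 := pd_jac hU hX hY hq 0
  have j1 := pd_jac hU hX hY hq 1
  rw [← pd_comm hU hX hq, ← pd_comm hU hY hq] at j1
  rw [pd_mul 0 hgd x0, pd_mul 0 hgd x1, pd_mul 1 hgd x0, pd_mul 1 hgd x1, ← pd_comm hU hX hq]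
  constructor
  · rintro ⟨k00, k01, k11⟩
    refine cubic_of_killing (J := jac X Y q) rfl hJq j0 j1 ?_ ?_ ?_ <;>
      apply mul_left_cancel₀ hgq
    · linear_combination 3 * jac X Y q * k00 - pd 0 X q * g0
    · linear_combination (3 * jac X Y q * k01 - pd 1 X q * g0 - pd 0 X q * g1) / 2
    · linear_combination 3 * jac X Y q * k11 - pd 1 X q * g1
  · rintro ⟨F, r0, r1, r2, r3⟩
    obtain ⟨k00, k01, k11⟩ := killing_of_cubic (J := jac X Y q) rfl hJq j0 j1 r0 r1 r2 r3
    refine ⟨?_, ?_, ?_⟩ <;> apply mul_left_cancel₀ hJ3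
    · linear_combination g q * k00 + pd 0 X q * g0
    · linear_combination 2 * g q * k01 + pd 1 X q * g0 + pd 0 X q * g1
    · linear_combination g q * k11 + pd 1 X q * g1

/-! ### Graphs under a change of coordinates -/

theorem hasDerivAt_graph {I : Set ℝ} {y : ℝ → ℝ} {Z : ℝ × ℝ → ℝ} (hU : IsOpen U)
    (hZ : ContDiffOn ℝ 2 Z U) (hy : TwiceDiffOn y I) (hyU : ∀ x ∈ I, (x, y x) ∈ U) {x : ℝ}
    (hx : x ∈ I) :
    HasDerivAt (fun s => Z (s, y s)) (pd 0 Z (x, y x) + pd 1 Z (x, y x) * deriv y x) x := by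
  have := hasDerivAt_comp_curve (u := fun s => s) (v := y)
    ((hZ.differentiableOn (by norm_num)).differentiableAt (hU.mem_nhds (hyU x hx)))
    (hasDerivAt_id' x) (hy x hx).1.hasDerivAt
  rwa [mul_one] at this

theorem hasDerivAt_deriv_graph {I : Set ℝ} {y : ℝ → ℝ} {Z : ℝ × ℝ → ℝ} (hU : IsOpen U)
    (hZ : ContDiffOn ℝ 2 Z U) (hy : TwiceDiffOn y I) (hyU : ∀ x ∈ I, (x, y x) ∈ U) {x : ℝ}
    (hx : x ∈ I) :
    HasDerivAt (fun s => pd 0 Z (s, y s) + pd 1 Z (s, y s) * deriv y s)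
      (pd 0 (pd 0 Z) (x, y x) + 2 * pd 0 (pd 1 Z) (x, y x) * deriv y x
          + pd 1 (pd 1 Z) (x, y x) * deriv y x ^ 2 + pd 1 Z (x, y x) * deriv (deriv y) x) x := by
  have hq := hyU x hx
  have e0 := hasDerivAt_comp_curve (u := fun s => s) (v := y) (differentiableAt_pd hU hZ hq 0)
    (hasDerivAt_id' x) (hy x hx).1.hasDerivAt
  have e1 := hasDerivAt_comp_curve (u := fun s => s) (v := y) (differentiableAt_pd hU hZ hq 1)
    (hasDerivAt_id' x) (hy x hx).1.hasDerivAt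
  refine (e0.add (e1.mul (hy x hx).2.hasDerivAt)).congr_deriv ?_
  rw [← pd_comm hU hZ hq]
  ring

theorem second_deriv_of_graph {I J : Set ℝ} {y η : ℝ → ℝ} (hU : IsOpen U)
    (hX : ContDiffOn ℝ 2 X U) (hY : ContDiffOn ℝ 2 Y U) (hI : IsOpen I) (hy : TwiceDiffOn y I)
    (hη : TwiceDiffOn η J) (hyU : ∀ x ∈ I, (x, y x) ∈ U) (hJ : ∀ x ∈ I, X (x, y x) ∈ J)
    (h : ∀ x ∈ I, η (X (x, y x)) = Y (x, y x)) {x : ℝ} (hx : x ∈ I) :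
    pd 0 Y (x, y x) + pd 1 Y (x, y x) * deriv y x =
        deriv η (X (x, y x)) * (pd 0 X (x, y x) + pd 1 X (x, y x) * deriv y x) ∧
      pd 0 (pd 0 Y) (x, y x) + 2 * pd 0 (pd 1 Y) (x, y x) * deriv y x
          + pd 1 (pd 1 Y) (x, y x) * deriv y x ^ 2 + pd 1 Y (x, y x) * deriv (deriv y) x =
        deriv (deriv η) (X (x, y x)) * (pd 0 X (x, y x) + pd 1 X (x, y x) * deriv y x) ^ 2
          + deriv η (X (x, y x)) * (pd 0 (pd 0 X) (x, y x)
            + 2 * pd 0 (pd 1 X) (x, y x) * deriv y x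
            + pd 1 (pd 1 X) (x, y x) * deriv y x ^ 2 + pd 1 X (x, y x) * deriv (deriv y) x) := by
  have he1 : ∀ x ∈ I, HasDerivAt (fun s => η (X (s, y s)))
      (deriv η (X (x, y x)) * (pd 0 X (x, y x) + pd 1 X (x, y x) * deriv y x)) x := fun x hx =>
    HasDerivAt.comp x (hη _ (hJ x hx)).1.hasDerivAt (hasDerivAt_graph hU hX hy hyU hx)
  have key1 : ∀ x ∈ I, pd 0 Y (x, y x) + pd 1 Y (x, y x) * deriv y x =
      deriv η (X (x, y x)) * (pd 0 X (x, y x) + pd 1 X (x, y x) * deriv y x) := fun x hx =>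
    ((hasDerivAt_graph hU hY hy hyU hx).congr_of_eventuallyEq
      (Filter.eventually_of_mem (hI.mem_nhds hx) h)).unique (he1 x hx)
  refine ⟨key1 x hx, ?_⟩
  have he2 := (HasDerivAt.comp x (hη _ (hJ x hx)).2.hasDerivAt (hasDerivAt_graph hU hX hy hyU hx)).mul (hasDerivAt_deriv_graph hU hX hy hyU hx)
  have := ((hasDerivAt_deriv_graph hU hY hy hyU hx).congr_of_eventuallyEq (Filter.eventually_of_mem (hI.mem_nhds hx)
    fun s hs => (key1 s hs).symm)).unique he2
  rw [this]
  simp only [Function.comp]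
  ring

/-- The transformation law of the second derivative. -/
theorem jac_mul_second_deriv {I J : Set ℝ} {y η : ℝ → ℝ} (hU : IsOpen U)
    (hX : ContDiffOn ℝ 2 X U) (hY : ContDiffOn ℝ 2 Y U) (hI : IsOpen I) (hy : TwiceDiffOn y I)
    (hη : TwiceDiffOn η J) (hyU : ∀ x ∈ I, (x, y x) ∈ U) (hJ : ∀ x ∈ I, X (x, y x) ∈ J)
    (h : ∀ x ∈ I, η (X (x, y x)) = Y (x, y x)) {x : ℝ} (hx : x ∈ I) :
    jac X Y (x, y x) * deriv (deriv y) x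
      + ((pd 0 X (x, y x) * pd 0 (pd 0 Y) (x, y x) - pd 0 Y (x, y x) * pd 0 (pd 0 X) (x, y x))
      + (2 * pd 0 X (x, y x) * pd 0 (pd 1 Y) (x, y x) + pd 1 X (x, y x) * pd 0 (pd 0 Y) (x, y x)
        - (2 * pd 0 Y (x, y x) * pd 0 (pd 1 X) (x, y x)
          + pd 1 Y (x, y x) * pd 0 (pd 0 X) (x, y x))) * deriv y x
      + (pd 0 X (x, y x) * pd 1 (pd 1 Y) (x, y x) + 2 * pd 1 X (x, y x) * pd 0 (pd 1 Y) (x, y x)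
        - (pd 0 Y (x, y x) * pd 1 (pd 1 X) (x, y x)
          + 2 * pd 1 Y (x, y x) * pd 0 (pd 1 X) (x, y x))) * deriv y x ^ 2
      + (pd 1 X (x, y x) * pd 1 (pd 1 Y) (x, y x) - pd 1 Y (x, y x) * pd 1 (pd 1 X) (x, y x))
        * deriv y x ^ 3) =
    (pd 0 X (x, y x) + pd 1 X (x, y x) * deriv y x) ^ 3 * deriv (deriv η) (X (x, y x)) := by
  obtain ⟨h1, h2⟩ := second_deriv_of_graph hU hX hY hI hy hη hyU hJ h hx
  simp only [jac]
  -- With dots for derivatives along the graph, `Ẋ` times the second-order relation minus `Ẍ` times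
  -- the first-order one eliminates the slope of `η`: `ẊŸ - ẌẎ = η'' Ẋ³`.
  linear_combination (pd 0 X (x, y x) + pd 1 X (x, y x) * deriv y x) * h2
    - (pd 0 (pd 0 X) (x, y x) + 2 * pd 0 (pd 1 X) (x, y x) * deriv y x
      + pd 1 (pd 1 X) (x, y x) * deriv y x ^ 2 + pd 1 X (x, y x) * deriv (deriv y) x) * h1

end

section

variable {A : Fin 4 → ℝ × ℝ → ℝ} {U : Set (ℝ × ℝ)} {q : ℝ × ℝ}

/-! ### Point transformations -/

theorem contDiffOn_fst_comp {n : WithTop ℕ∞} {φ : ℝ × ℝ → ℝ × ℝ} (h : ContDiffOn ℝ n φ U) :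
    ContDiffOn ℝ n (fun q => (φ q).1) U := contDiff_fst.comp_contDiffOn h

theorem contDiffOn_snd_comp {n : WithTop ℕ∞} {φ : ℝ × ℝ → ℝ × ℝ} (h : ContDiffOn ℝ n φ U) :
    ContDiffOn ℝ n (fun q => (φ q).2) U := contDiff_snd.comp_contDiffOn h

theorem fderiv_eq_pd_prod {φ : ℝ × ℝ → ℝ × ℝ} (h : DifferentiableAt ℝ φ q) (u : ℝ × ℝ) :
    fderiv ℝ φ q u =
      (pd 0 (fun q => (φ q).1) q * u.1 + pd 1 (fun q => (φ q).1) q * u.2,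
       pd 0 (fun q => (φ q).2) q * u.1 + pd 1 (fun q => (φ q).2) q * u.2) := by
  rw [← fderiv_eq_pd, ← fderiv_eq_pd, fderiv.fst h, fderiv.snd h]
  rfl

theorem jac_ne_zero (φ : OpenPartialHomeomorph (ℝ × ℝ) (ℝ × ℝ))
    (h1 : DifferentiableOn ℝ φ φ.source) (h2 : DifferentiableOn ℝ φ.symm φ.target)
    (hq : q ∈ φ.source) : jac (fun q => (φ q).1) (fun q => (φ q).2) q ≠ 0 := by
  have d1 := h1.differentiableAt (φ.open_source.mem_nhds hq)
  have d2 := h2.differentiableAt (φ.open_target.mem_nhds (φ.map_source hq))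
  have hc : (fderiv ℝ φ.symm (φ q)).comp (fderiv ℝ φ q) = ContinuousLinearMap.id ℝ (ℝ × ℝ) := by
    have h : HasFDerivAt (φ.symm ∘ φ) _ q := d2.hasFDerivAt.comp q d1.hasFDerivAt
    refine h.unique ((hasFDerivAt_id q).congr_of_eventuallyEq ?_)
    exact Filter.eventually_of_mem (φ.open_source.mem_nhds hq) fun r hr => φ.left_inv hr
  have hinj : ∀ u, fderiv ℝ φ q u = 0 → u = 0 := fun u hu => by
    have := DFunLike.congr_fun hc u
    simpa [hu] using this.symm
  simp only [fderiv_eq_pd_prod d1] at hinj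
  intro hj
  unfold jac at hj
  generalize pd 0 (fun q => (φ q).1) q = x0 at hinj hj
  generalize pd 1 (fun q => (φ q).1) q = x1 at hinj hj
  generalize pd 0 (fun q => (φ q).2) q = y0 at hinj hj
  generalize pd 1 (fun q => (φ q).2) q = y1 at hinj hj
  -- If the Jacobian vanished, both rows turned by a right angle would lie in the kernel of the
  -- differential. Injectivity makes both rows zero, and then `(1, 0)` contradicts it.
  have e1 := hinj (x1, -x0) (Prod.ext (by simp; ring) (by simp; linarith))
  have e2 := hinj (y1, -y0) (Prod.ext (by simp; linarith) (by simp; ring))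
  simp only [Prod.mk_eq_zero, neg_eq_zero] at e1 e2
  have e3 := hinj (1, 0) (by simp [e1, e2])
  simp at e3

/-- Along a graph, `J` times the defect of the first equation equals the cube of the derivative of
`X` times the defect of the second. Both factors are nonzero, so the two equations hold at the same
points. -/
theorem TransformsTo.isPointTransformation {n : ℕ∞} (hn : 2 ≤ n)
    {φ : OpenPartialHomeomorph (ℝ × ℝ) (ℝ × ℝ)} {f : ℝ × ℝ → ℝ}
    (h1 : ContDiffOn ℝ n φ φ.source) (h2 : ContDiffOn ℝ n φ.symm φ.target)
    (h : ∀ q ∈ φ.source, TransformsTo A (fun q => (φ q).1) (fun q => (φ q).2) (f (φ q)) q) :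
    IsPointTransformation n φ A ![f, fun _ => 0, fun _ => 0, fun _ => 0] := by
  have hn' : (2 : WithTop ℕ∞) ≤ n := WithTop.coe_le_coe.2 hn
  have h1' : ContDiffOn ℝ 2 φ φ.source := h1.of_le hn'
  have h2' : ContDiffOn ℝ 2 φ.symm φ.target := h2.of_le hn'
  refine ⟨h1, h2, fun I J y η hI _ _ _ hy hη hgr himg => ?_⟩
  have hyU : ∀ x ∈ I, (x, y x) ∈ φ.source := fun x hx => hgr ⟨x, hx, rfl⟩
  have hφ : ∀ x ∈ I, (φ (x, y x)).1 ∈ J ∧ η (φ (x, y x)).1 = (φ (x, y x)).2 := by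
    intro x hx
    have hm : φ (x, y x) ∈ graphOver η J := himg ▸ ⟨_, ⟨x, hx, rfl⟩, rfl⟩
    obtain ⟨s, hs, he⟩ := hm
    rw [← he]
    exact ⟨hs, rfl⟩
  have key : ∀ x ∈ I, (deriv (deriv y) x = ∑ i : Fin 4, A i (x, y x) * deriv y x ^ (i : ℕ)) ↔
      deriv (deriv η) (φ (x, y x)).1 = f (φ (x, y x)) := by
    intro x hx
    have e := jac_mul_second_deriv φ.open_source (contDiffOn_fst_comp h1')
      (contDiffOn_snd_comp h1') hI hy hη hyU (fun x hx => (hφ x hx).1) (fun x hx => (hφ x hx).2) hx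
    have e1 := (second_deriv_of_graph φ.open_source (contDiffOn_fst_comp h1')
      (contDiffOn_snd_comp h1') hI hy hη hyU (fun x hx => (hφ x hx).1)
      (fun x hx => (hφ x hx).2) hx).1
    have hJ := jac_ne_zero φ (h1'.differentiableOn (by norm_num))
      (h2'.differentiableOn (by norm_num)) (hyU x hx)
    obtain ⟨t0, t1, t2, t3⟩ := h _ (hyU x hx)
    -- The image is a graph over the `X`-axis, so if `X` were stationary along the curve then `Y`
    -- would be too, against the invertibility of the differential.
    have hw : pd 0 (fun q => (φ q).1) (x, y x) + pd 1 (fun q => (φ q).1) (x, y x) * deriv y x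
        ≠ 0 := by
      intro hw
      rw [hw, mul_zero] at e1
      apply hJ
      simp only [jac]
      linear_combination pd 1 (fun q => (φ q).2) (x, y x) * hw
        - pd 1 (fun q => (φ q).1) (x, y x) * e1
    have e2 : jac (fun q => (φ q).1) (fun q => (φ q).2) (x, y x) *
        (deriv (deriv y) x - ∑ i : Fin 4, A i (x, y x) * deriv y x ^ (i : ℕ)) =
        (pd 0 (fun q => (φ q).1) (x, y x) + pd 1 (fun q => (φ q).1) (x, y x) * deriv y x) ^ 3
          * (deriv (deriv η) (φ (x, y x)).1 - f (φ (x, y x))) := by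
      simp only [Fin.sum_univ_four]
      simp
      linear_combination e - t0 - deriv y x * t1 - deriv y x ^ 2 * t2 - deriv y x ^ 3 * t3
    rw [← sub_eq_zero, ← sub_eq_zero (b := f _)]
    constructor
    · intro h0
      rw [h0, mul_zero] at e2
      exact (mul_eq_zero.1 e2.symm).resolve_left (pow_ne_zero 3 hw)
    · intro h0
      rw [h0, mul_zero] at e2
      exact (mul_eq_zero.1 e2).resolve_left hJ
  have hB : ∀ s, ∑ i : Fin 4, (![f, fun _ => 0, fun _ => 0, fun _ => 0] :
      Fin 4 → ℝ × ℝ → ℝ) i (s, η s) * deriv η s ^ (i : ℕ) = f (s, η s) := by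
    intro s; simp [Fin.sum_univ_four]
  constructor
  · rintro ⟨_, hs⟩
    refine ⟨hη, fun s hs' => ?_⟩
    rw [hB]
    have hm : (s, η s) ∈ φ '' graphOver y I := himg ▸ ⟨s, hs', rfl⟩
    obtain ⟨_, ⟨x, hx, rfl⟩, he⟩ := hm
    have := (key x hx).1 (hs x hx)
    rwa [he] at this
  · rintro ⟨_, hs⟩
    refine ⟨hy, fun x hx => (key x hx).2 ?_⟩
    rw [hs _ (hφ x hx).1, hB, (hφ x hx).2]

/-- Through every point there is a solution of the equation with a given slope. -/
theorem exists_solvesOn {Ω : Set (ℝ × ℝ)} (hΩ : IsOpen Ω) (hA : ∀ i, ContDiffOn ℝ 1 (A i) Ω)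
    (hq : q ∈ Ω) (t : ℝ) : ∃ ε > 0, ∃ y : ℝ → ℝ, y q.1 = q.2 ∧ deriv y q.1 = t ∧
      SolvesOn A y (Ioo (q.1 - ε) (q.1 + ε)) := by
  -- The equation is made autonomous and of first order in `(x, y, y')`. The first unknown has
  -- derivative `1` and starts at `q.1`, so it is the parameter itself.
  let F : ℝ × ℝ × ℝ → ℝ × ℝ × ℝ := fun w =>
    (1, w.2.2, ∑ i : Fin 4, A i (w.1, w.2.1) * w.2.2 ^ (i : ℕ))
  have hF : ContDiffAt ℝ 1 F (q.1, q.2, t) := by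
    refine contDiffAt_const.prodMk ((by fun_prop : ContDiffAt ℝ 1
      (fun w : ℝ × ℝ × ℝ => w.2.2) _).prodMk (ContDiffAt.sum fun i _ => ?_))
    refine ContDiffAt.mul ?_ (by fun_prop)
    exact ContDiffAt.comp (g := A i) (f := fun w : ℝ × ℝ × ℝ => (w.1, w.2.1)) (q.1, q.2, t)
      ((hA i).contDiffAt (hΩ.mem_nhds hq)) (by fun_prop)
  obtain ⟨α, hα0, ε, hε, hα⟩ :=
    hF.exists_forall_mem_closedBall_exists_eq_forall_mem_Ioo_hasDerivAt₀ q.1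
  have hmem : q.1 ∈ Ioo (q.1 - ε) (q.1 + ε) := ⟨by linarith, by linarith⟩
  have h1 : ∀ s ∈ Ioo (q.1 - ε) (q.1 + ε), HasDerivAt (fun s => (α s).1) 1 s := fun s hs =>
    (hα s hs).fst
  have h2 : ∀ s ∈ Ioo (q.1 - ε) (q.1 + ε), HasDerivAt (fun s => (α s).2.1) (α s).2.2 s :=
    fun s hs => (hα s hs).snd.fst
  have h3 : ∀ s ∈ Ioo (q.1 - ε) (q.1 + ε), HasDerivAt (fun s => (α s).2.2)
      (∑ i : Fin 4, A i ((α s).1, (α s).2.1) * (α s).2.2 ^ (i : ℕ)) s :=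
    fun s hs => (hα s hs).snd.snd
  have hx : ∀ s ∈ Ioo (q.1 - ε) (q.1 + ε), (α s).1 = s := by
    intro s hs
    have hd : ∀ s ∈ Ioo (q.1 - ε) (q.1 + ε), HasDerivAt (fun s => (α s).1 - s) 0 s :=
      fun s hs => by simpa using (h1 s hs).fun_sub (hasDerivAt_id' s)
    have := isOpen_Ioo.is_const_of_deriv_eq_zero isPreconnected_Ioo
      (fun s hs => (hd s hs).differentiableAt.differentiableWithinAt)
      (fun s hs => (hd s hs).deriv) hs hmem
    simp only [hα0, sub_self] at this
    linarith
  have hy1 : ∀ s ∈ Ioo (q.1 - ε) (q.1 + ε), deriv (fun s => (α s).2.1) s = (α s).2.2 :=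
    fun s hs => (h2 s hs).deriv
  have hy2 : ∀ s ∈ Ioo (q.1 - ε) (q.1 + ε), HasDerivAt (deriv fun s => (α s).2.1)
      (∑ i : Fin 4, A i ((α s).1, (α s).2.1) * (α s).2.2 ^ (i : ℕ)) s := fun s hs =>
    (h3 s hs).congr_of_eventuallyEq (Filter.eventually_of_mem (isOpen_Ioo.mem_nhds hs) hy1)
  refine ⟨ε, hε, fun s => (α s).2.1, by simp [hα0], by rw [hy1 _ hmem, hα0],
    fun s hs => ⟨(h2 s hs).differentiableAt, (hy2 s hs).differentiableAt⟩, fun s hs => ?_⟩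
  rw [(hy2 s hs).deriv, hy1 s hs, hx s hs]

/-- A polynomial of degree three that vanishes off the zero of a nonzero linear form is zero. -/
theorem cubic_coeff_eq_zero {x0 x1 c0 c1 c2 c3 : ℝ} (hx : x0 ≠ 0 ∨ x1 ≠ 0)
    (h : ∀ t : ℝ, x0 + x1 * t ≠ 0 → c0 + c1 * t + c2 * t ^ 2 + c3 * t ^ 3 = 0) :
    c0 = 0 ∧ c1 = 0 ∧ c2 = 0 ∧ c3 = 0 := by
  -- Multiplying by the linear form removes the exceptional slope. A quartic that vanishes at the
  -- five points `0, ±1, ±2` has all coefficients zero.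
  have h' : ∀ t : ℝ, (x0 + x1 * t) * (c0 + c1 * t + c2 * t ^ 2 + c3 * t ^ 3) = 0 := fun t => by
    by_cases ht : x0 + x1 * t = 0
    · rw [ht, zero_mul]
    · rw [h t ht, mul_zero]
  have e0 := h' 0
  have e1 := h' 1
  have e2 := h' (-1)
  have e3 := h' 2
  have e4 := h' (-2)
  have f0 : x0 * c0 = 0 := by linarith
  have f4 : x1 * c3 = 0 := by linarith
  have f1 : x0 * c1 + x1 * c0 = 0 := by linarith
  have f2 : x0 * c2 + x1 * c1 = 0 := by linarith
  have f3 : x0 * c3 + x1 * c2 = 0 := by linarith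
  rcases eq_or_ne x1 0 with rfl | hx1
  · simp_all
  · have g3 := (mul_eq_zero.1 f4).resolve_left hx1
    simp only [g3, mul_zero, zero_add] at f3
    have g2 := (mul_eq_zero.1 f3).resolve_left hx1
    simp only [g2, mul_zero, zero_add] at f2
    have g1 := (mul_eq_zero.1 f2).resolve_left hx1
    simp only [g1, mul_zero, zero_add] at f1
    exact ⟨(mul_eq_zero.1 f1).resolve_left hx1, g1, g2, g3⟩

/-- The image of a graph that is transverse to the fibres of `X` is locally a graph. -/
theorem exists_graph_image {φ : OpenPartialHomeomorph (ℝ × ℝ) (ℝ × ℝ)}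
    (h1 : ContDiffOn ℝ 2 φ φ.source) {y : ℝ → ℝ} {x₀ ε : ℝ} (hε : 0 < ε)
    (hy : TwiceDiffOn y (Ioo (x₀ - ε) (x₀ + ε))) (hq : (x₀, y x₀) ∈ φ.source)
    (hw : pd 0 (fun q => (φ q).1) (x₀, y x₀)
      + pd 1 (fun q => (φ q).1) (x₀, y x₀) * deriv y x₀ ≠ 0) :
    ∃ (I J : Set ℝ) (η : ℝ → ℝ), IsOpen I ∧ I.OrdConnected ∧ IsOpen J ∧ J.OrdConnected ∧ x₀ ∈ I ∧
      I ⊆ Ioo (x₀ - ε) (x₀ + ε) ∧ TwiceDiffOn η J ∧ graphOver y I ⊆ φ.source ∧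
      φ '' graphOver y I = graphOver η J := by
  have hX := contDiffOn_fst_comp h1
  have hY := contDiffOn_snd_comp h1
  set X : ℝ × ℝ → ℝ := fun q => (φ q).1
  set Y : ℝ × ℝ → ℝ := fun q => (φ q).2
  have hx₀ : x₀ ∈ Ioo (x₀ - ε) (x₀ + ε) := ⟨by linarith, by linarith⟩
  have hyc : ContinuousOn (fun x => (x, y x)) (Ioo (x₀ - ε) (x₀ + ε)) :=
    continuousOn_id.prodMk fun x hx => (hy x hx).1.continuousAt.continuousWithinAt
  let I₁ := Ioo (x₀ - ε) (x₀ + ε) ∩ (fun x => (x, y x)) ⁻¹' φ.source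
  have hI₁ : IsOpen I₁ := hyc.isOpen_inter_preimage isOpen_Ioo φ.open_source
  have hy₁ : TwiceDiffOn y I₁ := fun x hx => hy x hx.1
  have hyU : ∀ x ∈ I₁, (x, y x) ∈ φ.source := fun x hx => hx.2
  let a : ℝ → ℝ := fun x => X (x, y x)
  let a' : ℝ → ℝ := fun x => pd 0 X (x, y x) + pd 1 X (x, y x) * deriv y x
  have ha : ∀ x ∈ I₁, HasDerivAt a (a' x) x := fun x hx =>
    hasDerivAt_graph φ.open_source hX hy₁ hyU hx
  have ha'd : ∀ x ∈ I₁, DifferentiableAt ℝ a' x := fun x hx =>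
    (hasDerivAt_deriv_graph φ.open_source hX hy₁ hyU hx).differentiableAt
  have hx₁ : x₀ ∈ I₁ := ⟨hx₀, hq⟩
  -- The inverse function theorem needs a strict derivative; it is available because `a'`, though
  -- only differentiable, is continuous. The differentiability of `a'` is what later gives `η` its
  -- second derivative.
  have hstrict : HasStrictDerivAt a (a' x₀) x₀ :=
    hasStrictDerivAt_of_hasDerivAt_of_continuousAt
      (Filter.eventually_of_mem (hI₁.mem_nhds hx₁) ha) (ha'd x₀ hx₁).continuousAt
  let e := (hstrict.hasStrictFDerivAt_equiv hw).toOpenPartialHomeomorph a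
  have hex : x₀ ∈ e.source :=
    (hstrict.hasStrictFDerivAt_equiv hw).mem_toOpenPartialHomeomorph_source
  have hea : ∀ x, e x = a x := fun x => rfl
  have hev : ∀ᶠ x in 𝓝 x₀, (x ∈ I₁ ∧ x ∈ e.source) ∧ a' x ≠ 0 :=
    ((hI₁.eventually_mem hx₁).and (e.open_source.eventually_mem hex)).and
      ((ha'd x₀ hx₁).continuousAt.eventually_ne hw)
  obtain ⟨δ, hδ, hball⟩ := Metric.eventually_nhds_iff_ball.1 hev
  have hIe : Metric.ball x₀ δ ⊆ e.source := fun x hx => (hball x hx).1.2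
  have hI1 : Metric.ball x₀ δ ⊆ I₁ := fun x hx => (hball x hx).1.1
  have hsymm : ∀ s ∈ e '' Metric.ball x₀ δ, e.symm s ∈ Metric.ball x₀ δ ∧ s ∈ e.target := by
    rintro _ ⟨x, hx, rfl⟩
    rw [e.left_inv (hIe hx)]
    exact ⟨hx, e.map_source (hIe hx)⟩
  have hJo : IsOpen (e '' Metric.ball x₀ δ) :=
    e.isOpen_image_of_subset_source Metric.isOpen_ball hIe
  have hsd : ∀ s ∈ e '' Metric.ball x₀ δ, HasDerivAt e.symm (a' (e.symm s))⁻¹ s := fun s hs =>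
    e.hasDerivAt_symm (hsymm s hs).2 (hball _ (hsymm s hs).1).2 (ha _ (hI1 (hsymm s hs).1))
  let b' : ℝ → ℝ := fun x => pd 0 Y (x, y x) + pd 1 Y (x, y x) * deriv y x
  have hη : ∀ s ∈ e '' Metric.ball x₀ δ, HasDerivAt (fun s => Y (e.symm s, y (e.symm s)))
      (b' (e.symm s) * (a' (e.symm s))⁻¹) s := fun s hs =>
    HasDerivAt.comp (h₂ := fun x => Y (x, y x)) s
      (hasDerivAt_graph φ.open_source hY hy₁ hyU (hI1 (hsymm s hs).1)) (hsd s hs)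
  refine ⟨Metric.ball x₀ δ, e '' Metric.ball x₀ δ, fun s => Y (e.symm s, y (e.symm s)),
    Metric.isOpen_ball, (convex_ball x₀ δ).ordConnected, hJo, ?_, Metric.mem_ball_self hδ,
    fun x hx => (hI1 hx).1, fun s hs => ⟨(hη s hs).differentiableAt, ?_⟩, ?_, ?_⟩
  · exact ((convex_ball x₀ δ).isPreconnected.image e (e.continuousOn.mono hIe)).ordConnected
  · have hd : DifferentiableAt ℝ (fun s => b' (e.symm s) * (a' (e.symm s))⁻¹) s := by
      have hs1 := (hsymm s hs).1
      have hes := (hsd s hs).differentiableAt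
      have hb : DifferentiableAt ℝ (fun s => b' (e.symm s)) s := DifferentiableAt.comp (g := b') s
        (hasDerivAt_deriv_graph φ.open_source hY hy₁ hyU (hI1 hs1)).differentiableAt hes
      have ha : DifferentiableAt ℝ (fun s => a' (e.symm s)) s := DifferentiableAt.comp (g := a') s
        (ha'd _ (hI1 hs1)) hes
      exact hb.mul (ha.inv (hball _ hs1).2)
    exact hd.congr_of_eventuallyEq (Filter.eventually_of_mem (hJo.mem_nhds hs)
      fun r hr => (hη r hr).deriv)
  · rintro _ ⟨x, hx, rfl⟩
    exact (hI1 hx).2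
  · ext r
    constructor
    · rintro ⟨_, ⟨x, hx, rfl⟩, rfl⟩
      refine ⟨a x, ⟨x, hx, rfl⟩, ?_⟩
      have : e.symm (a x) = x := e.left_inv (hIe hx)
      simp only [this]
      rfl
    · rintro ⟨_, ⟨x, hx, rfl⟩, rfl⟩
      refine ⟨_, ⟨x, hx, rfl⟩, ?_⟩
      have : e.symm (e x) = x := e.left_inv (hIe hx)
      simp only [this]
      rfl

/-- Through `q` with a slope transverse to the fibres of `X` there is a solution whose image is
locally a graph and therefore solves the second equation. The transformation law at `q` becomes an
equality of two cubics in the slope, and all transverse slopes are enough to equate coefficients. -/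
theorem IsPointTransformation.transformsTo {n : ℕ∞} (hn : 2 ≤ n) {Ω : Set (ℝ × ℝ)}
    (hΩ : IsOpen Ω) (hA : ∀ i, ContDiffOn ℝ 1 (A i) Ω)
    {φ : OpenPartialHomeomorph (ℝ × ℝ) (ℝ × ℝ)} (hφΩ : φ.source ⊆ Ω) {f : ℝ × ℝ → ℝ}
    (h : IsPointTransformation n φ A ![f, fun _ => 0, fun _ => 0, fun _ => 0])
    (hq : q ∈ φ.source) :
    TransformsTo A (fun q => (φ q).1) (fun q => (φ q).2) (f (φ q)) q := by
  have hn' : (2 : WithTop ℕ∞) ≤ n := WithTop.coe_le_coe.2 hn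
  have h1 : ContDiffOn ℝ 2 φ φ.source := h.contDiffOn.of_le hn'
  have h2 : ContDiffOn ℝ 2 φ.symm φ.target := h.contDiffOn_symm.of_le hn'
  have hX := contDiffOn_fst_comp h1
  have hY := contDiffOn_snd_comp h1
  have hJ := jac_ne_zero φ (h1.differentiableOn (by norm_num))
      (h2.differentiableOn (by norm_num)) hq
  have hx : pd 0 (fun q => (φ q).1) q ≠ 0 ∨ pd 1 (fun q => (φ q).1) q ≠ 0 := by
    by_contra! hx
    exact hJ (by simp [jac, hx])
  have red : ∀ {l0 l1 l2 l3 r0 r1 r2 r3 : ℝ},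
      (l0 - r0 = 0 ∧ l1 - r1 = 0 ∧ l2 - r2 = 0 ∧ l3 - r3 = 0) →
        l0 = r0 ∧ l1 = r1 ∧ l2 = r2 ∧ l3 = r3 := by
    simp only [sub_eq_zero, imp_self, implies_true]
  refine red (cubic_coeff_eq_zero hx fun t ht => ?_)
  obtain ⟨ε, hε, y, hy0, hyt, hsol⟩ := exists_solvesOn hΩ hA (hφΩ hq) t
  have hqe : (q.1, y q.1) = q := Prod.ext rfl hy0
  obtain ⟨I, J, η, hI, hIc, hJ, hJc, hxI, hIε, hη, hgr, himg⟩ := exists_graph_image h1 hε hsol.1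
    (by rwa [hqe]) (by rwa [hqe, hyt])
  have hyI : TwiceDiffOn y I := fun x hx => hsol.1 x (hIε hx)
  have hsη := (h.solvesOn_iff I J y η hI hIc hJ hJc hyI hη hgr himg).1
    ⟨hyI, fun x hx => hsol.2 x (hIε hx)⟩
  have hφ : ∀ x ∈ I, (φ (x, y x)).1 ∈ J ∧ η (φ (x, y x)).1 = (φ (x, y x)).2 := by
    intro x hx
    have hm : φ (x, y x) ∈ graphOver η J := himg ▸ ⟨_, ⟨x, hx, rfl⟩, rfl⟩
    obtain ⟨s, hs, he⟩ := hm
    rw [← he]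
    exact ⟨hs, rfl⟩
  have e := jac_mul_second_deriv φ.open_source hX hY hI hyI hη
    (fun x hx => hgr ⟨x, hx, rfl⟩) (fun x hx => (hφ x hx).1) (fun x hx => (hφ x hx).2) hxI
  have e2 := hsη.2 _ (hφ _ hxI).1
  rw [(hφ _ hxI).2] at e2
  rw [e2, hsol.2 _ (hIε hxI), hqe, hyt] at e
  simp [Fin.sum_univ_four] at e
  linear_combination e

end

section

/-! ### Primitives depending on a parameter -/

/-- The retraction of the line onto `[c, d]`. -/
def clamp (c d x : ℝ) : ℝ := max c (min d x)

theorem continuous_clamp (c d : ℝ) : Continuous (clamp c d) :=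
  continuous_const.max (continuous_const.min continuous_id)

theorem clamp_mem {c d : ℝ} (h : c ≤ d) (x : ℝ) : clamp c d x ∈ Icc c d :=
  ⟨le_max_left _ _, max_le h (min_le_left _ _)⟩

theorem clamp_of_mem {c d x : ℝ} (h : x ∈ Icc c d) : clamp c d x = x := by
  simp [clamp, h.1, h.2]

theorem uIcc_subset_Ioo' {t₁ t₂ t₀ t : ℝ} (h0 : t₀ ∈ Ioo t₁ t₂) (h : t ∈ Ioo t₁ t₂) :
    uIcc t₀ t ⊆ Ioo t₁ t₂ := ordConnected_Ioo.uIcc_subset h0 h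

variable {b₁ b₂ t₁ t₂ t₀ : ℝ} {h : ℝ × ℝ → ℝ}

theorem exists_continuous_eqOn {c d c' d' : ℝ} (hc : c ≤ d) (hc' : c' ≤ d')
    (hh : ContinuousOn h (Icc c d ×ˢ Icc c' d')) :
    ∃ H : ℝ × ℝ → ℝ, Continuous H ∧ EqOn H h (Icc c d ×ˢ Icc c' d') := by
  refine ⟨fun q => h (clamp c d q.1, clamp c' d' q.2), ?_, fun q hq => ?_⟩
  · exact hh.comp_continuous (((continuous_clamp c d).comp continuous_fst).prodMk
      ((continuous_clamp c' d').comp continuous_snd)) fun q => ⟨clamp_mem hc _, clamp_mem hc' _⟩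
  · simp only [clamp_of_mem hq.1, clamp_of_mem hq.2]

/-- Near a given point only a compact rectangle matters. On it the integrand agrees with a globally
continuous function, obtained by clamping both variables, to which the continuity of parametric
integrals applies. -/
theorem continuousOn_primitive (ht₀ : t₀ ∈ Ioo t₁ t₂)
    (hh : ContinuousOn h (Ioo b₁ b₂ ×ˢ Ioo t₁ t₂)) :
    ContinuousOn (fun q : ℝ × ℝ => ∫ s in t₀..q.2, h (q.1, s)) (Ioo b₁ b₂ ×ˢ Ioo t₁ t₂) := by
  rintro ⟨b, t⟩ ⟨hb, ht⟩
  obtain ⟨c, hc1, hcb⟩ := exists_between hb.1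
  obtain ⟨d, hbd, hd2⟩ := exists_between hb.2
  obtain ⟨c', hc1', hct⟩ := exists_between (lt_min ht₀.1 ht.1)
  obtain ⟨d', htd', hd2'⟩ := exists_between (max_lt ht₀.2 ht.2)
  rw [lt_min_iff] at hct
  rw [max_lt_iff] at htd'
  simp only at hbd hcb
  obtain ⟨H, hH, hHh⟩ := exists_continuous_eqOn (h := h) (hcb.trans hbd).le
    (hct.1.trans htd'.1).le (hh.mono (prod_mono (Icc_subset_Ioo hc1 hd2)
      (Icc_subset_Ioo hc1' hd2')))
  have hcont : Continuous fun q : ℝ × ℝ => ∫ s in t₀..q.2, H (q.1, s) :=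
    intervalIntegral.continuous_parametric_intervalIntegral_of_continuous
      (f := fun (q : ℝ × ℝ) s => H (q.1, s)) (by fun_prop) continuous_snd
  refine (hcont.continuousAt.congr ?_).continuousWithinAt
  have hmem : Ioo c d ×ˢ Ioo c' d' ∈ 𝓝 (b, t) :=
    (isOpen_Ioo.prod isOpen_Ioo).mem_nhds ⟨⟨hcb, hbd⟩, ⟨hct.2, htd'.2⟩⟩
  filter_upwards [hmem] with q hq
  refine intervalIntegral.integral_congr fun s hs => hHh ⟨Ioo_subset_Icc_self hq.1, ?_⟩
  exact Ioo_subset_Icc_self (uIcc_subset_Ioo' ⟨hct.1, htd'.1⟩ hq.2 hs)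

theorem hasDerivAt_primitive_param {h' : ℝ × ℝ → ℝ} (ht₀ : t₀ ∈ Ioo t₁ t₂)
    (hh : ContinuousOn h (Ioo b₁ b₂ ×ˢ Ioo t₁ t₂)) (hh' : ContinuousOn h' (Ioo b₁ b₂ ×ˢ Ioo t₁ t₂))
    (hd : ∀ b ∈ Ioo b₁ b₂, ∀ s ∈ Ioo t₁ t₂, HasDerivAt (fun b => h (b, s)) (h' (b, s)) b)
    {b t : ℝ} (hb : b ∈ Ioo b₁ b₂) (ht : t ∈ Ioo t₁ t₂) :
    HasDerivAt (fun b => ∫ s in t₀..t, h (b, s)) (∫ s in t₀..t, h' (b, s)) b := by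
  obtain ⟨c, hc1, hcb⟩ := exists_between hb.1
  obtain ⟨d, hbd, hd2⟩ := exists_between hb.2
  have hsub : Icc c d ×ˢ uIcc t₀ t ⊆ Ioo b₁ b₂ ×ˢ Ioo t₁ t₂ :=
    prod_mono (Icc_subset_Ioo hc1 hd2) (uIcc_subset_Ioo' ht₀ ht)
  obtain ⟨C, hC⟩ := (isCompact_Icc.prod isCompact_uIcc).exists_bound_of_continuousOn
    (hh'.mono hsub)
  have hint : ∀ {g : ℝ × ℝ → ℝ}, ContinuousOn g (Ioo b₁ b₂ ×ˢ Ioo t₁ t₂) → ∀ x ∈ Icc c d,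
      IntervalIntegrable (fun s => g (x, s)) volume t₀ t := by
    intro g hg x hx
    refine ContinuousOn.intervalIntegrable ?_
    exact hg.comp (by fun_prop) fun s hs => hsub ⟨hx, hs⟩
  refine (intervalIntegral.hasDerivAt_integral_of_dominated_loc_of_deriv_le
    (F := fun b s => h (b, s)) (F' := fun b s => h' (b, s)) (bound := fun _ => C)
    (Icc_mem_nhds hcb hbd) ?_ ?_ ?_ ?_ intervalIntegrable_const ?_).2
  · filter_upwards [Icc_mem_nhds hcb hbd] with x hx
    exact (hint hh x hx).aestronglyMeasurable_restrict_uIoc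
  · exact hint hh b ⟨hcb.le, hbd.le⟩
  · exact (hint hh' b ⟨hcb.le, hbd.le⟩).aestronglyMeasurable_restrict_uIoc
  · exact Filter.Eventually.of_forall fun s hs x hx => hC (x, s) ⟨hx, uIoc_subset_uIcc hs⟩
  · exact Filter.Eventually.of_forall fun s hs x hx => hd x (Icc_subset_Ioo hc1 hd2 hx) s
      (uIcc_subset_Ioo' ht₀ ht (uIoc_subset_uIcc hs))

theorem hasDerivAt_primitive (ht₀ : t₀ ∈ Ioo t₁ t₂)
    (hh : ContinuousOn h (Ioo b₁ b₂ ×ˢ Ioo t₁ t₂)) {b t : ℝ} (hb : b ∈ Ioo b₁ b₂)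
    (ht : t ∈ Ioo t₁ t₂) :
    HasDerivAt (fun t => ∫ s in t₀..t, h (b, s)) (h (b, t)) t := by
  have hc : ContinuousOn (fun s => h (b, s)) (Ioo t₁ t₂) :=
    hh.comp (by fun_prop) fun s hs => ⟨hb, hs⟩
  exact intervalIntegral.integral_hasDerivAt_right
    (hc.mono (uIcc_subset_Ioo' ht₀ ht)).intervalIntegrable
    (hc.stronglyMeasurableAtFilter isOpen_Ioo t ht) (hc.continuousAt (isOpen_Ioo.mem_nhds ht))

/-- Induction on the order: the parameter derivative is the primitive of `pd 0 h`, of the same type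
with one derivative less, and the derivative in the upper limit is `h`. -/
theorem contDiffOn_primitive (ht₀ : t₀ ∈ Ioo t₁ t₂) (j : ℕ) {h : ℝ × ℝ → ℝ}
    (hh : ContDiffOn ℝ j h (Ioo b₁ b₂ ×ˢ Ioo t₁ t₂)) :
    ContDiffOn ℝ j (fun q : ℝ × ℝ => ∫ s in t₀..q.2, h (q.1, s)) (Ioo b₁ b₂ ×ˢ Ioo t₁ t₂) := by
  have hU : IsOpen (Ioo b₁ b₂ ×ˢ Ioo t₁ t₂) := isOpen_Ioo.prod isOpen_Ioo
  induction j generalizing h with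
  | zero => exact contDiffOn_zero.2 (continuousOn_primitive ht₀ hh.continuousOn)
  | succ j ih =>
    have hp : ContDiffOn ℝ j (pd 0 h) (Ioo b₁ b₂ ×ˢ Ioo t₁ t₂) :=
      hh.pd_of_le hU (by push_cast; exact le_rfl) 0
    refine contDiffOn_succ_of_partial hU (f₁ := fun q => ∫ s in t₀..q.2, pd 0 h (q.1, s))
      (f₂ := h) ?_ ?_ (ih hp) (hh.of_le (by exact_mod_cast j.le_succ))
    · rintro ⟨b, t⟩ ⟨hb, ht⟩
      refine hasDerivAt_primitive_param ht₀ hh.continuousOn hp.continuousOn ?_ hb ht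
      intro b hb s hs
      have := hasDerivAt_comp_curve (f := h) (u := fun b => b) (v := fun _ => s)
        ((hh.differentiableOn (by simp)).differentiableAt (hU.mem_nhds ⟨hb, hs⟩))
        (hasDerivAt_id' b) (hasDerivAt_const b s)
      simpa using this
    · rintro ⟨b, t⟩ ⟨hb, ht⟩
      exact hasDerivAt_primitive ht₀ hh.continuousOn hb ht

/-! ### The flow of a scalar equation -/

/-- A continuous local flow of `y' = v(t, y)`. -/
theorem exists_continuous_flow {v : ℝ × ℝ → ℝ} (hv : ContDiff ℝ 1 v) (hc : HasCompactSupport v)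
    (t₀ y₀ : ℝ) : ∃ α : ℝ × ℝ → ℝ, Continuous α ∧
      (∀ b ∈ Ioo (y₀ - 1) (y₀ + 1), α (b, t₀) = b) ∧
      ∀ b ∈ Ioo (y₀ - 1) (y₀ + 1), ∀ t ∈ Ioo (t₀ - 1) (t₀ + 1),
        HasDerivAt (fun t => α (b, t)) (v (t, α (b, t))) t := by
  obtain ⟨K, hK⟩ := hv.lipschitzWith_of_hasCompactSupport hc (by norm_num)
  obtain ⟨C, hC⟩ := hc.exists_bound_of_continuous hv.continuous
  -- With `|v| ≤ C`, a solution starting within `1` of `y₀` moves by at most `C` in unit time; this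
  -- is why the radius is `C + 1`.
  have hpl : IsPicardLindelof (fun t y => v (t, y))
      (⟨t₀, by constructor <;> linarith⟩ : Icc (t₀ - 1) (t₀ + 1)) y₀ (C.toNNReal + 1) 1
      C.toNNReal K := by
    refine ⟨fun t _ => ?_, fun y _ => ?_, fun t _ y _ => (hC _).trans (Real.le_coe_toNNReal C), ?_⟩
    · refine (LipschitzWith.of_dist_le_mul fun y z => ?_).lipschitzOnWith
      refine (hK.dist_le_mul (t, y) (t, z)).trans_eq ?_
      simp [Prod.dist_eq]
    · exact (hv.continuous.comp (by fun_prop)).continuousOn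
    · simp
  obtain ⟨α, hα, hαc⟩ := hpl.exists_forall_mem_closedBall_eq_hasDerivWithinAt_continuousOn
  rw [Real.closedBall_eq_Icc] at hα hαc
  obtain ⟨β, hβ, hβα⟩ := exists_continuous_eqOn (by simp; linarith) (by linarith) hαc
  have hI : ∀ b ∈ Ioo (y₀ - 1) (y₀ + 1), b ∈ Icc (y₀ - ((1 : NNReal) : ℝ)) (y₀ + (1 : NNReal)) :=
    fun b hb => by simpa using Ioo_subset_Icc_self hb
  refine ⟨β, hβ, fun b hb => ?_, fun b hb t ht => ?_⟩
  · rw [hβα ⟨hI b hb, by constructor <;> linarith⟩]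
    exact (hα b (hI b hb)).1
  · have h1 := ((hα b (hI b hb)).2 t (Ioo_subset_Icc_self ht)).hasDerivAt
      (Icc_mem_nhds ht.1 ht.2)
    rw [hβα ⟨hI b hb, Ioo_subset_Icc_self ht⟩]
    refine h1.congr_of_eventuallyEq ?_
    filter_upwards [isOpen_Ioo.mem_nhds ht] with s hs
    exact hβα ⟨hI b hb, Ioo_subset_Icc_self hs⟩

/-- The derivative of the flow in the initial value. -/
theorem hasDerivAt_flow {v α : ℝ × ℝ → ℝ} (hv : ContDiff ℝ 1 v) (hα : Continuous α)
    (ht₀ : t₀ ∈ Ioo t₁ t₂) (h0 : ∀ b ∈ Ioo b₁ b₂, α (b, t₀) = b)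
    (hd : ∀ b ∈ Ioo b₁ b₂, ∀ t ∈ Ioo t₁ t₂, HasDerivAt (fun t => α (b, t)) (v (t, α (b, t))) t)
    {b t : ℝ} (hb : b ∈ Ioo b₁ b₂) (ht : t ∈ Ioo t₁ t₂) :
    HasDerivAt (fun b => α (b, t)) (Real.exp (∫ s in t₀..t, pd 1 v (s, α (b, s)))) b := by
  have hw : Continuous (pd 1 v) := (hv.continuous_fderiv (by norm_num)).clm_apply continuous_const
  -- `Q` is the mean of `∂v/∂y` on the segment between two solutions. Their difference then
  -- satisfies an exactly linear equation with coefficient `Q`, jointly continuous in the initial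
  -- value and the time.
  let Q : ℝ × ℝ → ℝ := fun p =>
    ∫ θ in (0 : ℝ)..1, pd 1 v (p.2, α (b, p.2) + θ * (α p - α (b, p.2)))
  have hQ : Continuous Q :=
    intervalIntegral.continuous_parametric_intervalIntegral_of_continuous'
      (f := fun (p : ℝ × ℝ) θ => pd 1 v (p.2, α (b, p.2) + θ * (α p - α (b, p.2))))
      (hw.comp (by fun_prop)) 0 1
  have hQv : ∀ p : ℝ × ℝ, v (p.2, α p) - v (p.2, α (b, p.2)) = Q p * (α p - α (b, p.2)) := by
    intro p
    have h1 : ∀ θ ∈ uIcc (0 : ℝ) 1,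
        HasDerivAt (fun θ : ℝ => v (p.2, α (b, p.2) + θ * (α p - α (b, p.2))))
        (pd 1 v (p.2, α (b, p.2) + θ * (α p - α (b, p.2))) * (α p - α (b, p.2))) θ := by
      intro θ _
      have := hasDerivAt_comp_curve (f := v) (u := fun _ => p.2)
        (v := fun θ => α (b, p.2) + θ * (α p - α (b, p.2)))
        ((hv.differentiable (by norm_num)) _) (hasDerivAt_const θ _)
        (((hasDerivAt_id' θ).mul_const (α p - α (b, p.2))).const_add (α (b, p.2)))
      simpa using this
    have h2 := intervalIntegral.integral_eq_sub_of_hasDerivAt h1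
      (Continuous.intervalIntegrable ((hw.comp (by fun_prop)).mul continuous_const) _ _)
    rw [intervalIntegral.integral_mul_const] at h2
    simp only [one_mul, zero_mul, add_zero, add_sub_cancel] at h2
    exact h2.symm
  let P : ℝ × ℝ → ℝ := fun p => ∫ s in t₀..p.2, Q (p.1, s)
  have hP : Continuous P := intervalIntegral.continuous_parametric_intervalIntegral_of_continuous
      (f := fun (q : ℝ × ℝ) s => Q (q.1, s)) (by fun_prop) continuous_snd
  have hPd : ∀ b' s, HasDerivAt (fun s => P (b', s)) (Q (b', s)) s := fun b' s =>
    intervalIntegral.integral_hasDerivAt_right ((by fun_prop : Continuous fun s =>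
      Q (b', s)).intervalIntegrable _ _) ((by fun_prop : Continuous fun s =>
      Q (b', s)).stronglyMeasurableAtFilter _ _) (by fun_prop)
  -- The linear equation integrates to an exact formula for the difference, so the difference
  -- quotient is `exp (P (b', t))` and its limit follows by continuity.
  have hδ : ∀ b' ∈ Ioo b₁ b₂, α (b', t) - α (b, t) = (b' - b) * Real.exp (P (b', t)) := by
    intro b' hb'
    have hD : ∀ s ∈ Ioo t₁ t₂, HasDerivAt
        (fun s => (α (b', s) - α (b, s)) * Real.exp (-P (b', s))) 0 s := by
      intro s hs
      refine (((hd b' hb' s hs).fun_sub (hd b hb s hs)).fun_mul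
        (hPd b' s).fun_neg.exp).congr_deriv ?_
      rw [hQv (b', s)]
      ring
    have h1 := isOpen_Ioo.is_const_of_deriv_eq_zero isPreconnected_Ioo
      (fun s hs => (hD s hs).differentiableAt.differentiableWithinAt)
      (fun s hs => (hD s hs).deriv) ht ht₀
    have hP0 : P (b', t₀) = 0 := intervalIntegral.integral_same
    simp only [h0 b' hb', h0 b hb, hP0, neg_zero, Real.exp_zero, mul_one] at h1
    rw [← h1, mul_assoc, ← Real.exp_add]
    simp
  have hPb : P (b, t) = ∫ s in t₀..t, pd 1 v (s, α (b, s)) := by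
    simp [P, Q]
  rw [← hPb, hasDerivAt_iff_tendsto_slope]
  have hlim : Filter.Tendsto (fun b' => Real.exp (P (b', t))) (𝓝[≠] b) (𝓝 (Real.exp (P (b, t)))) :=
    (by fun_prop : Continuous fun b' => Real.exp (P (b', t))).continuousAt.tendsto.mono_left
      nhdsWithin_le_nhds
  refine hlim.congr' ?_
  filter_upwards [self_mem_nhdsWithin, nhdsWithin_le_nhds (isOpen_Ioo.mem_nhds hb)] with b' hne hb'
  have hne' : b' - b ≠ 0 := sub_ne_zero.2 hne
  rw [slope_def_field, hδ b' hb']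
  field_simp

/-- A local flow of `y' = v(t, y)`, of the same class as `v`. -/
theorem exists_contDiffOn_flow {v : ℝ × ℝ → ℝ} {k : ℕ∞} (hk : 1 ≤ k) (hv : ContDiff ℝ k v)
    (hc : HasCompactSupport v) (t₀ y₀ : ℝ) : ∃ α : ℝ × ℝ → ℝ,
      ContDiffOn ℝ k α (Ioo (y₀ - 1) (y₀ + 1) ×ˢ Ioo (t₀ - 1) (t₀ + 1)) ∧
      α (y₀, t₀) = y₀ ∧ ∀ q ∈ Ioo (y₀ - 1) (y₀ + 1) ×ˢ Ioo (t₀ - 1) (t₀ + 1),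
        0 < pd 0 α q ∧ pd 1 α q = v (q.2, α q) := by
  have hv1 : ContDiff ℝ 1 v := hv.of_le (by exact_mod_cast hk)
  obtain ⟨α, hα, h0, hd⟩ := exists_continuous_flow hv1 hc t₀ y₀
  set U := Ioo (y₀ - 1) (y₀ + 1) ×ˢ Ioo (t₀ - 1) (t₀ + 1)
  have hU : IsOpen U := isOpen_Ioo.prod isOpen_Ioo
  have ht₀ : t₀ ∈ Ioo (t₀ - 1) (t₀ + 1) := ⟨by linarith, by linarith⟩
  have hy₀ : y₀ ∈ Ioo (y₀ - 1) (y₀ + 1) := ⟨by linarith, by linarith⟩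
  let E : ℝ × ℝ → ℝ := fun q => Real.exp (∫ s in t₀..q.2, pd 1 v (s, α (q.1, s)))
  have h1 : ∀ q ∈ U, HasDerivAt (fun s => α (s, q.2)) (E q) q.1 := fun q hq =>
    hasDerivAt_flow hv1 hα ht₀ h0 hd hq.1 hq.2
  have h2 : ∀ q ∈ U, HasDerivAt (fun s => α (q.1, s)) (v (q.2, α q)) q.2 := fun q hq =>
    hd q.1 hq.1 q.2 hq.2
  have hw : ∀ j : ℕ, ((j + 1 : ℕ) : ℕ∞) ≤ k → ContDiff ℝ j (pd 1 v) := fun j hj =>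
    (hv.fderiv_right (m := j) (by exact_mod_cast hj)).clm_apply contDiff_const
  have hind : ∀ j : ℕ, (j : ℕ∞) ≤ k → ContDiffOn ℝ j α U := by
    intro j
    induction j with
    | zero => exact fun _ => contDiffOn_zero.2 hα.continuousOn
    | succ j ih =>
      intro hj
      have hj' : (j : ℕ∞) ≤ k := le_trans (by exact_mod_cast j.le_succ) hj
      have hαj := ih hj'
      have hin : ContDiffOn ℝ j (fun q : ℝ × ℝ => (q.2, α q)) U :=
        contDiff_snd.contDiffOn.prodMk hαj
      -- Both partial derivatives of the flow are expressed through the flow itself, so each turn of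
      -- the induction gains one order until `v` has no further derivative to give.
      refine contDiffOn_succ_of_partial hU h1 h2 ?_ ?_
      · exact (contDiffOn_primitive ht₀ j (h := fun q => pd 1 v (q.2, α q))
          ((hw j hj).comp_contDiffOn hin)).exp
      · exact (hv.of_le (by exact_mod_cast hj')).comp_contDiffOn hin
  have hαk : ContDiffOn ℝ k α U := contDiffOn_iff_forall_nat_le.2 hind
  refine ⟨α, hαk, h0 y₀ hy₀, fun q hq => ?_⟩
  have hdα : DifferentiableAt ℝ α q := (hαk.differentiableOn (by
    have : k ≠ 0 := fun h => by simp [h] at hk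
    exact_mod_cast this)).differentiableAt (hU.mem_nhds hq)
  have e0 := hasDerivAt_comp_curve (f := α) (u := fun s => s) (v := fun _ => q.2) hdα
    (hasDerivAt_id' q.1) (hasDerivAt_const q.1 q.2)
  have e1 := hasDerivAt_comp_curve (f := α) (u := fun _ => q.1) (v := fun s => s) hdα
    (hasDerivAt_const q.2 q.1) (hasDerivAt_id' q.2)
  simp only [mul_one, mul_zero, add_zero, zero_add] at e0 e1
  have f0 := e0.unique (h1 q hq)
  have f1 := e1.unique (h2 q hq)
  exact ⟨f0 ▸ Real.exp_pos _, f1⟩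

end

/-! ### Rectification of a one-form -/

/-- The inverse function theorem in the plane. -/
theorem exists_openPartialHomeomorph {n : ℕ∞} (hn : 1 ≤ n) {F : ℝ × ℝ → ℝ × ℝ} {U : Set (ℝ × ℝ)}
    {p : ℝ × ℝ} (hU : IsOpen U) (hp : p ∈ U) (hF : ContDiffOn ℝ n F U)
    (hJ : ∀ q ∈ U, jac (fun q => (F q).1) (fun q => (F q).2) q ≠ 0) :
    ∃ φ : OpenPartialHomeomorph (ℝ × ℝ) (ℝ × ℝ), p ∈ φ.source ∧ φ.source ⊆ U ∧ (φ : _ → _) = F ∧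
      ContDiffOn ℝ n φ φ.source ∧ ContDiffOn ℝ n φ.symm φ.target := by
  have hn0 : (n : WithTop ℕ∞) ≠ 0 := by
    have : n ≠ 0 := fun h => by simp [h] at hn
    exact_mod_cast this
  have hC : ∀ q ∈ U, ContDiffAt ℝ n F q := fun q hq => hF.contDiffAt (hU.mem_nhds hq)
  have hE : ∀ q ∈ U, ∃ e : (ℝ × ℝ) ≃L[ℝ] (ℝ × ℝ),
      HasFDerivAt F (e : (ℝ × ℝ) →L[ℝ] (ℝ × ℝ)) q := by
    intro q hq
    have hd := (hC q hq).differentiableAt hn0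
    have hinj : Function.Injective (fderiv ℝ F q : (ℝ × ℝ) →ₗ[ℝ] (ℝ × ℝ)) := by
      rw [← LinearMap.ker_eq_bot, LinearMap.ker_eq_bot']
      intro u hu
      have hu' : fderiv ℝ F q u = 0 := hu
      have h := hJ q hq
      rw [fderiv_eq_pd_prod hd, Prod.mk_eq_zero] at hu'
      unfold jac at h
      refine Prod.ext ((mul_eq_zero.1 ?_).resolve_left h) ((mul_eq_zero.1 ?_).resolve_left h)
      · linear_combination pd 1 (fun q => (F q).2) q * hu'.1 - pd 1 (fun q => (F q).1) q * hu'.2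
      · linear_combination pd 0 (fun q => (F q).1) q * hu'.2 - pd 0 (fun q => (F q).2) q * hu'.1
    refine ⟨(LinearEquiv.ofInjectiveEndo _ hinj).toContinuousLinearEquiv, ?_⟩
    exact hd.hasFDerivAt
  obtain ⟨e, he⟩ := hE p hp
  -- Restricting to `U` keeps the differential invertible on the whole source, so the inverse is
  -- smooth at every point of the target and not only at `F p`.
  let φ := ((hC p hp).toOpenPartialHomeomorph F he hn0).restrOpen U hU
  have hφF : (φ : _ → _) = F := rfl
  have hsrc : φ.source ⊆ U := inter_subset_right
  refine ⟨φ, ⟨(hC p hp).mem_toOpenPartialHomeomorph_source he hn0, hp⟩, hsrc, hφF,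
    hF.mono hsrc, fun r hr => ?_⟩
  have hr' := hsrc (φ.map_target hr)
  obtain ⟨e', he'⟩ := hE _ hr'
  exact (φ.contDiffAt_symm hr he' (hC _ hr')).contDiffWithinAt

/-- A function of class `Cᵏ` near a point agrees there with one that has compact support. -/
theorem exists_contDiff_hasCompactSupport {k : ℕ∞} {f : ℝ × ℝ → ℝ} {U : Set (ℝ × ℝ)} {p : ℝ × ℝ}
    (hU : IsOpen U) (hp : p ∈ U) (hf : ContDiffOn ℝ k f U) :
    ∃ v : ℝ × ℝ → ℝ, ContDiff ℝ k v ∧ HasCompactSupport v ∧ ∀ᶠ q in 𝓝 p, v q = f q := by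
  obtain ⟨r, hr, hrU⟩ := Metric.nhds_basis_closedBall.mem_iff.1 (hU.mem_nhds hp)
  let b : ContDiffBump p := ⟨r / 2, r, by positivity, by linarith⟩
  refine ⟨fun q => b q * f q, ?_, b.hasCompactSupport.mul_right, ?_⟩
  · rw [contDiff_iff_contDiffAt]
    intro q
    by_cases hq : q ∈ U
    · exact b.contDiffAt.mul (hf.contDiffAt (hU.mem_nhds hq))
    · have h0 : (fun q => b q * f q) =ᶠ[𝓝 q] fun _ => 0 := by
        have hq' : q ∈ (Metric.closedBall p r)ᶜ := fun h => hq (hrU h)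
        filter_upwards [Metric.isClosed_closedBall.isOpen_compl.mem_nhds hq'] with s hs
        have : dist s p ≥ r := by
          by_contra hlt
          exact hs (Metric.mem_closedBall.2 (not_le.1 hlt).le)
        rw [b.zero_of_le_dist this, zero_mul]
      exact contDiffAt_const.congr_of_eventuallyEq h0
  · filter_upwards [Metric.closedBall_mem_nhds p (half_pos hr)] with q hq
    rw [b.one_of_mem_closedBall hq, one_mul]

/-- The chain rule for the map `(b, t) ↦ (t, α(b, t))`. It gives the derivatives of functions of
`(x, y)` from those in the parameters `(b, t)` without differentiating the inverse map. -/
theorem pd_comp_graph {f h α : ℝ × ℝ → ℝ} {r : ℝ × ℝ} (hf : DifferentiableAt ℝ f (r.2, α r))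
    (hα : DifferentiableAt ℝ α r) (hfh : ∀ᶠ s in 𝓝 r, f (s.2, α s) = h s) :
    pd 1 f (r.2, α r) * pd 0 α r = pd 0 h r ∧
      pd 0 f (r.2, α r) + pd 1 f (r.2, α r) * pd 1 α r = pd 1 h r := by
  have hc : HasFDerivAt (fun s : ℝ × ℝ => f (s.2, α s)) _ r :=
    hf.hasFDerivAt.comp r (hasFDerivAt_snd.prodMk hα.hasFDerivAt)
  rw [← pd_congr_of_eventuallyEq hfh 0, ← pd_congr_of_eventuallyEq hfh 1,
    pd_eq_of_hasFDerivAt hc, pd_eq_of_hasFDerivAt hc]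
  simp [fderiv_eq_pd]

/-- The curves tangent to `ker K` solve `y' = -K₁/K₂`. Let `α(b, t)` be their flow and use `(b, t)`
as parameters, with `(x, y) = (t, α)`. Then `X = b` is constant along the curves and `K = K₂ (dy -
α_t dt) = K₂ α_b db`, which fixes `g`. Since `dx ∧ dy = -α_b db ∧ dt`, the condition on the Jacobian
becomes an equation for `∂Y/∂t`, solved by integration. -/
theorem exists_rectification_of_pos {n : ℕ∞} (hn : 1 ≤ n) {K : Fin 2 → ℝ × ℝ → ℝ}
    {U : Set (ℝ × ℝ)} {p : ℝ × ℝ} (hU : IsOpen U) (hp : p ∈ U)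
    (hK : ∀ a, ContDiffOn ℝ ((n + 1 : ℕ∞) : WithTop ℕ∞) (K a) U) (h1 : 0 < K 1 p) :
    ∃ (φ : OpenPartialHomeomorph (ℝ × ℝ) (ℝ × ℝ)) (g : ℝ × ℝ → ℝ), p ∈ φ.source ∧ φ.source ⊆ U ∧
      ContDiffOn ℝ n φ φ.source ∧ ContDiffOn ℝ n φ.symm φ.target ∧
      DifferentiableOn ℝ g φ.source ∧
      (∀ q ∈ φ.source, ∀ a, K a q = g q * pd a (fun q => (φ q).1) q) ∧
      ∀ q ∈ φ.source, g q ^ 3 * jac (fun q => (φ q).1) (fun q => (φ q).2) q ^ 2 = 1 := by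
  have hnn : ((n + 1 : ℕ∞) : WithTop ℕ∞) = (n : WithTop ℕ∞) + 1 := by push_cast; rfl
  have hn0 : (n : WithTop ℕ∞) ≠ 0 := by
    have : n ≠ 0 := fun h => by simp [h] at hn
    exact_mod_cast this
  have hW : IsOpen (U ∩ {q | 0 < K 1 q}) := by
    exact (hK 1).continuousOn.isOpen_inter_preimage hU isOpen_Ioi
  set W := U ∩ {q | 0 < K 1 q}
  obtain ⟨v, hv, hvc, hvK⟩ := exists_contDiff_hasCompactSupport hW ⟨hp, h1⟩
    (((hK 0).mono inter_subset_left).neg.div ((hK 1).mono inter_subset_left)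
      fun q hq => hq.2.ne')
  obtain ⟨t₀, y₀⟩ := p
  obtain ⟨α, hα, hα0, hαd⟩ := exists_contDiffOn_flow (le_add_self) hv hvc t₀ y₀
  obtain ⟨V, hVs, hV, hpV⟩ := eventually_nhds_iff.1 (hvK.and (hW.mem_nhds ⟨hp, h1⟩))
  set S₀ := Ioo (y₀ - 1) (y₀ + 1) ×ˢ Ioo (t₀ - 1) (t₀ + 1)
  have hS₀ : IsOpen S₀ := isOpen_Ioo.prod isOpen_Ioo
  have hα1 : ContDiffOn ℝ n α S₀ := hα.of_le (by exact_mod_cast le_self_add)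
  let Ψ : ℝ × ℝ → ℝ × ℝ := fun q => (q.2, α q)
  have hΨ : ContDiffOn ℝ n Ψ S₀ := contDiff_snd.contDiffOn.prodMk hα1
  have hq₀ : (y₀, t₀) ∈ S₀ := ⟨⟨by linarith, by linarith⟩, ⟨by linarith, by linarith⟩⟩
  have hΨ₀ : Ψ (y₀, t₀) = (t₀, y₀) := by simp [Ψ, hα0]
  have hpre : IsOpen (S₀ ∩ Ψ ⁻¹' V) := hΨ.continuousOn.isOpen_inter_preimage hS₀ hV
  -- A box in `(b, t)` is needed because `Y` is obtained by integrating over `t` from `t₀` at fixed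
  -- `b`.
  obtain ⟨ε, hε, hεS⟩ := Metric.isOpen_iff.1 hpre (y₀, t₀) ⟨hq₀, by simpa [hΨ₀] using hpV⟩
  rw [← ball_prod_same, Real.ball_eq_Ioo, Real.ball_eq_Ioo] at hεS
  set S := Ioo (y₀ - ε) (y₀ + ε) ×ˢ Ioo (t₀ - ε) (t₀ + ε)
  have hS : IsOpen S := isOpen_Ioo.prod isOpen_Ioo
  have hqS : (y₀, t₀) ∈ S := ⟨⟨by linarith, by linarith⟩, ⟨by linarith, by linarith⟩⟩
  have hSS : S ⊆ S₀ := fun q hq => (hεS hq).1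
  have hSW : ∀ q ∈ S, Ψ q ∈ W := fun q hq => (hVs _ (hεS hq).2).2
  have hSv : ∀ q ∈ S, v (Ψ q) = -K 0 (Ψ q) / K 1 (Ψ q) := fun q hq => (hVs _ (hεS hq).2).1
  -- The factor `α_b` enters `g` and `Y` and has one derivative less than the flow; for this `K` is
  -- assumed of class `Cⁿ⁺¹`.
  have hE : ContDiffOn ℝ n (pd 0 α) S := (hα.pd_of_le hS₀ hnn.ge 0).mono hSS
  have hE0 : ∀ q ∈ S, 0 < pd 0 α q := fun q hq => (hαd q (hSS hq)).1
  have hKΨ : ContDiffOn ℝ n (fun q => K 1 (Ψ q)) S :=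
    ((hK 1).of_le (by exact_mod_cast le_self_add)).comp (hΨ.mono hSS) fun q hq => (hSW q hq).1
  let g : ℝ × ℝ → ℝ := fun q => K 1 (Ψ q) * pd 0 α q
  have hg : ContDiffOn ℝ n g S := hKΨ.mul hE
  have hg0 : ∀ q ∈ S, 0 < g q := fun q hq => mul_pos (hSW q hq).2 (hE0 q hq)
  -- `j = g^(-3/2)` is the required absolute value of the Jacobian. Choosing `∂Y/∂t = j α_b` makes
  -- the Jacobian equal to `-j`.
  let j : ℝ × ℝ → ℝ := fun q => (g q * √(g q))⁻¹
  have hj : ContDiffOn ℝ n j S := (hg.mul (hg.sqrt fun q hq => (hg0 q hq).ne')).inv fun q hq =>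
    (mul_pos (hg0 q hq) (Real.sqrt_pos.2 (hg0 q hq))).ne'
  have hj2 : ∀ q ∈ S, g q ^ 3 * j q ^ 2 = 1 := by
    have h : ∀ x : ℝ, 0 < x → x ^ 3 * (x * √x)⁻¹ ^ 2 = 1 := fun x hx => by
      rw [inv_pow, mul_pow x, Real.sq_sqrt hx.le]
      field_simp
    exact fun q hq => h _ (hg0 q hq)
  let Y : ℝ × ℝ → ℝ := fun q => ∫ s in t₀..q.2, j (q.1, s) * pd 0 α (q.1, s)
  have hjE : ContDiffOn ℝ n (fun q => j q * pd 0 α q) S := hj.mul hE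
  have hY : ContDiffOn ℝ n Y S := contDiffOn_iff_forall_nat_le.2 fun m hm =>
    contDiffOn_primitive hqS.2 m (hjE.of_le (by exact_mod_cast hm))
  have hYt : ∀ q ∈ S, pd 1 Y q = j q * pd 0 α q := by
    intro q hq
    have e1 := hasDerivAt_comp_curve (f := Y) (u := fun _ => q.1) (v := fun s => s)
      ((hY.differentiableOn hn0).differentiableAt (hS.mem_nhds hq))
      (hasDerivAt_const q.2 q.1) (hasDerivAt_id' q.2)
    simp only [mul_one, mul_zero, zero_add] at e1
    exact e1.unique (hasDerivAt_primitive hqS.2 hjE.continuousOn hq.1 hq.2)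
  have hj0 : ∀ q ∈ S, j q ≠ 0 := fun q hq h => by simpa [h] using hj2 q hq
  obtain ⟨ψ, hψp, hψS, hψΨ, hψ1, hψ2⟩ := exists_openPartialHomeomorph hn hS hqS (hΨ.mono hSS)
    fun q hq => by
      have : (fun q : ℝ × ℝ => (Ψ q).1) = Prod.snd := rfl
      simp only [jac, this, pd_snd]
      simpa [Ψ] using (hE0 q hq).ne'
  obtain ⟨θ, hθp, hθS, hθY, hθ1, hθ2⟩ := exists_openPartialHomeomorph hn hS hqS
    (F := fun q => (q.1, Y q)) (contDiff_fst.contDiffOn.prodMk hY) fun q hq => by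
      have : (fun q : ℝ × ℝ => q.1) = Prod.fst := rfl
      simp only [jac, this, pd_fst]
      simpa [hYt q hq] using ⟨hj0 q hq, (hE0 q hq).ne'⟩
  have hψ₀ : ψ (y₀, t₀) = (t₀, y₀) := by rw [hψΨ, hΨ₀]
  have hsrc : ∀ q, q ∈ (ψ.symm.trans θ).source ↔ q ∈ ψ.target ∧ ψ.symm q ∈ θ.source := fun q => by
    simp
  have hmem : ∀ q ∈ (ψ.symm.trans θ).source, ψ.symm q ∈ S := fun q hq =>
    hθS ((hsrc q).1 hq).2
  have hinv : ∀ q ∈ (ψ.symm.trans θ).source, Ψ (ψ.symm q) = q := fun q hq => by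
    rw [← hψΨ]
    exact ψ.right_inv ((hsrc q).1 hq).1
  have hsub : (ψ.symm.trans θ).source ⊆ U := fun q hq => by
    rw [← hinv q hq]
    exact (hSW _ (hmem q hq)).1
  have hs : ContDiffOn ℝ n ψ.symm (ψ.symm.trans θ).source :=
    hψ2.mono fun q hq => ((hsrc q).1 hq).1
  have hφ : ContDiffOn ℝ n (ψ.symm.trans θ) (ψ.symm.trans θ).source :=
    hθ1.comp hs fun q hq => ((hsrc q).1 hq).2
  have hopen := (ψ.symm.trans θ).open_source
  have hvq : ∀ q ∈ (ψ.symm.trans θ).source, pd 1 α (ψ.symm q) = v q := fun q hq => by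
    rw [(hαd _ (hSS (hmem q hq))).2]
    exact congrArg v (hinv q hq)
  have hchain : ∀ {f h : ℝ × ℝ → ℝ}, (∀ r ∈ ψ.source, f (Ψ r) = h r) → ∀ q ∈
      (ψ.symm.trans θ).source, DifferentiableAt ℝ f q →
      pd 1 f q * pd 0 α (ψ.symm q) = pd 0 h (ψ.symm q) ∧
        pd 0 f q + pd 1 f q * v q = pd 1 h (ψ.symm q) := by
    intro f h hfh q hq hf
    have hr : ψ.symm q ∈ ψ.source := ψ.map_target ((hsrc q).1 hq).1
    have hq' : ((ψ.symm q).2, α (ψ.symm q)) = q := hinv q hq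
    have := pd_comp_graph (f := f) (h := h) (α := α) (r := ψ.symm q) (by rwa [hq'])
      ((hα1.differentiableOn hn0).differentiableAt (hS₀.mem_nhds (hSS (hmem q hq))))
      (Filter.eventually_of_mem (ψ.open_source.mem_nhds hr) hfh)
    rwa [hq', hvq q hq] at this
  have hφ1 : ∀ q, ((ψ.symm.trans θ) q).1 = (ψ.symm q).1 := fun q => by
    simp [hθY]
  have hφ2 : ∀ q, ((ψ.symm.trans θ) q).2 = Y (ψ.symm q) := fun q => by
    simp [hθY]
  have hleft : ∀ r ∈ ψ.source, ψ.symm (Ψ r) = r := fun r hr => by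
    rw [← hψΨ]
    exact ψ.left_inv hr
  have hd : ∀ q ∈ (ψ.symm.trans θ).source, DifferentiableAt ℝ (ψ.symm.trans θ) q :=
    fun q hq => (hφ.differentiableOn hn0).differentiableAt (hopen.mem_nhds hq)
  have hX : ∀ q ∈ (ψ.symm.trans θ).source,
      pd 1 (fun q => ((ψ.symm.trans θ) q).1) q * pd 0 α (ψ.symm q) = 1 ∧
      pd 0 (fun q => ((ψ.symm.trans θ) q).1) q +
        pd 1 (fun q => ((ψ.symm.trans θ) q).1) q * v q = 0 := by
    intro q hq
    have h := hchain (f := fun q => ((ψ.symm.trans θ) q).1) (h := Prod.fst)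
      (fun r hr => by rw [hφ1, hleft r hr]) q hq (hd q hq).fst
    simpa [pd_fst] using h
  have hYq : ∀ q ∈ (ψ.symm.trans θ).source,
      pd 0 (fun q => ((ψ.symm.trans θ) q).2) q +
        pd 1 (fun q => ((ψ.symm.trans θ) q).2) q * v q = j (ψ.symm q) * pd 0 α (ψ.symm q) := by
    intro q hq
    rw [← hYt _ (hmem q hq)]
    exact (hchain (f := fun q => ((ψ.symm.trans θ) q).2) (h := Y)
      (fun r hr => by rw [hφ2, hleft r hr]) q hq (hd q hq).snd).2
  refine ⟨ψ.symm.trans θ, fun q => g (ψ.symm q), ?_, hsub, hφ, ?_, ?_, ?_, ?_⟩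
  · rw [hsrc, ← hψ₀, ψ.left_inv hψp]
    exact ⟨ψ.map_source hψp, hθp⟩
  · have h1 : ContDiffOn ℝ n ψ ψ.source := hψ1
    refine (h1.comp (hθ2.mono ?_) ?_ : ContDiffOn ℝ n (ψ ∘ θ.symm) (ψ.symm.trans θ).target)
    · intro q hq
      exact hq.1
    · intro q hq
      exact hq.2
  · exact (hg.comp hs hmem).differentiableOn hn0
  · intro q hq a
    have e := hX q hq
    have hv' := hSv _ (hmem q hq)
    have hW' := (hSW _ (hmem q hq)).2
    rw [hinv q hq] at hv' hW'
    have hW'' : 0 < K 1 q := hW'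
    rw [eq_div_iff hW''.ne'] at hv'
    simp only [g, hinv q hq]
    fin_cases a
    · simp only [Fin.zero_eta]
      linear_combination hv' + v q * K 1 q * e.1 - K 1 q * pd 0 α (ψ.symm q) * e.2
    · simp only [Fin.mk_one]
      linear_combination -K 1 q * e.1
  · intro q hq
    have e := hX q hq
    have ey := hYq q hq
    have hE' := hE0 _ (hmem q hq)
    have hJ : jac (fun q => ((ψ.symm.trans θ) q).1) (fun q => ((ψ.symm.trans θ) q).2) q
        = -j (ψ.symm q) := by
      unfold jac
      linear_combination pd 1 (fun q => ((ψ.symm.trans θ) q).2) q * e.2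
        - pd 1 (fun q => ((ψ.symm.trans θ) q).1) q * ey - j (ψ.symm q) * e.1
    rw [hJ, neg_sq, hj2 _ (hmem q hq)]

theorem pd_comp_swap (a : Fin 2) (f : ℝ × ℝ → ℝ) (q : ℝ × ℝ) :
    pd a (fun q => f q.swap) q = pd (1 - a) f q.swap := by
  have h := (ContinuousLinearEquiv.prodComm ℝ ℝ ℝ).comp_right_fderiv (f := f) (x := q)
  have h' : fderiv ℝ (fun q => f q.swap) q = (fderiv ℝ f q.swap).comp
    (ContinuousLinearEquiv.prodComm ℝ ℝ ℝ : (ℝ × ℝ) →L[ℝ] (ℝ × ℝ)) := h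
  fin_cases a <;> simp [pd, h']

/-- A one-form `K` that does not vanish at a point is `g dX` in suitable coordinates `(X, Y)`, whose
Jacobian determinant is a constant multiple of `g ^ (-3 / 2)`. -/
theorem exists_rectification {n : ℕ∞} (hn : 1 ≤ n) {K : Fin 2 → ℝ × ℝ → ℝ}
    {U : Set (ℝ × ℝ)} {p : ℝ × ℝ} (hU : IsOpen U) (hp : p ∈ U)
    (hK : ∀ a, ContDiffOn ℝ ((n + 1 : ℕ∞) : WithTop ℕ∞) (K a) U) (h0 : ∃ a, K a p ≠ 0) :
    ∃ (φ : OpenPartialHomeomorph (ℝ × ℝ) (ℝ × ℝ)) (g : ℝ × ℝ → ℝ) (c : ℝ), p ∈ φ.source ∧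
      φ.source ⊆ U ∧ ContDiffOn ℝ n φ φ.source ∧ ContDiffOn ℝ n φ.symm φ.target ∧
      DifferentiableOn ℝ g φ.source ∧
      (∀ q ∈ φ.source, ∀ a, K a q = g q * pd a (fun q => (φ q).1) q) ∧ c ≠ 0 ∧
      ∀ q ∈ φ.source, g q ^ 3 * jac (fun q => (φ q).1) (fun q => (φ q).2) q ^ 2 = c := by
  have main : ∀ (K : Fin 2 → ℝ × ℝ → ℝ) (U : Set (ℝ × ℝ)) (p : ℝ × ℝ), IsOpen U → p ∈ U →
      (∀ a, ContDiffOn ℝ ((n + 1 : ℕ∞) : WithTop ℕ∞) (K a) U) → K 1 p ≠ 0 →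
      ∃ (φ : OpenPartialHomeomorph (ℝ × ℝ) (ℝ × ℝ)) (g : ℝ × ℝ → ℝ) (c : ℝ), p ∈ φ.source ∧
      φ.source ⊆ U ∧ ContDiffOn ℝ n φ φ.source ∧ ContDiffOn ℝ n φ.symm φ.target ∧
      DifferentiableOn ℝ g φ.source ∧
      (∀ q ∈ φ.source, ∀ a, K a q = g q * pd a (fun q => (φ q).1) q) ∧ c ≠ 0 ∧
      ∀ q ∈ φ.source, g q ^ 3 * jac (fun q => (φ q).1) (fun q => (φ q).2) q ^ 2 = c := by
    intro K U p hU hp hK h1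
    rcases h1.lt_or_gt with h1 | h1
    -- For a negative second component the construction is applied to `-K`; `g` changes sign and so
    -- does `g³J²`.
    · obtain ⟨φ, g, a1, a2, a3, a4, a5, a6, a7⟩ := exists_rectification_of_pos hn hU hp
        (K := fun a q => -K a q) (fun a => (hK a).neg) (neg_pos.2 h1)
      refine ⟨φ, fun q => -g q, -1, a1, a2, a3, a4, a5.neg, fun q hq a => ?_, by norm_num,
        fun q hq => ?_⟩
      · linear_combination -a6 q hq a
      · linear_combination -a7 q hq
    · obtain ⟨φ, g, a1, a2, a3, a4, a5, a6, a7⟩ := exists_rectification_of_pos hn hU hp hK h1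
      exact ⟨φ, g, 1, a1, a2, a3, a4, a5, a6, one_ne_zero, a7⟩
  by_cases h1 : K 1 p = 0
  · have h00 : K 0 p ≠ 0 := by
      obtain ⟨a, ha⟩ := h0
      fin_cases a
      · exact ha
      · exact absurd h1 ha
    have hsw : ContDiff ℝ (⊤ : WithTop ℕ∞) (Prod.swap : ℝ × ℝ → ℝ × ℝ) :=
      contDiff_snd.prodMk contDiff_fst
    obtain ⟨φ, g, c, a1, a2, a3, a4, a5, a6, a7, a8⟩ := main (fun a q => K (1 - a) q.swap)
      (Prod.swap ⁻¹' U) p.swap (hU.preimage continuous_swap) (by simpa using hp)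
      (fun a => (hK (1 - a)).comp (hsw.of_le le_top).contDiffOn fun q hq => hq) (by simpa using h00)
    let σ : OpenPartialHomeomorph (ℝ × ℝ) (ℝ × ℝ) :=
      (Homeomorph.prodComm ℝ ℝ).toOpenPartialHomeomorph
    have hsrc : ∀ q, q ∈ (σ.trans φ).source ↔ q.swap ∈ φ.source := fun q => by
      simp [σ]
    have hpd : ∀ a q, pd a (fun q => ((σ.trans φ) q).1) q
        = pd (1 - a) (fun q => (φ q).1) q.swap := fun a q =>
      pd_comp_swap a (fun q => (φ q).1) q
    have hpd' : ∀ a q, pd a (fun q => ((σ.trans φ) q).2) q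
        = pd (1 - a) (fun q => (φ q).2) q.swap := fun a q =>
      pd_comp_swap a (fun q => (φ q).2) q
    refine ⟨σ.trans φ, fun q => g q.swap, c, (hsrc p).2 a1, fun q hq => ?_, ?_, ?_, ?_,
      fun q hq a => ?_, a7, fun q hq => ?_⟩
    · simpa using a2 ((hsrc q).1 hq)
    · exact a3.comp (hsw.of_le le_top).contDiffOn fun q hq => (hsrc q).1 hq
    · exact (hsw.of_le le_top).comp_contDiffOn (a4.mono fun q hq => hq.1)
    · exact a5.comp (hsw.differentiable (by simp)).differentiableOn fun q hq => (hsrc q).1 hq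
    · rw [hpd, ← a6 _ ((hsrc q).1 hq)]
      simp
    · rw [← a8 _ ((hsrc q).1 hq)]
      -- Exchanging the two variables reverses the sign of the Jacobian, which enters only through
      -- its square.
      simp only [jac, hpd, hpd', sub_zero, sub_self]
      ring
  · exact main K U p hU hp hK h1

section

variable {A B : Fin 4 → ℝ × ℝ → ℝ} {U : Set (ℝ × ℝ)} {p : ℝ × ℝ} {n : ℕ∞}
  {φ : OpenPartialHomeomorph (ℝ × ℝ) (ℝ × ℝ)}

/-! ### Equations whose right-hand side does not involve the slope -/

/-- The components of `dX` are constant, so its covariant derivative is minus the symbols with upper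
index `X`, and these are `B 1 / 3`, `B 2 / 3` and `B 3`. -/
theorem isKillingOn_dX_iff :
    IsKillingOn (thomas B) dX U ↔ ∀ q ∈ U, B 1 q = 0 ∧ B 2 q = 0 ∧ B 3 q = 0 := by
  have hd : ∀ a, DifferentiableOn ℝ (dX a) U := fun a => by
    fin_cases a <;> exact differentiableOn_const _
  have h0 : ∀ a b q, pd a (dX b) q = 0 := fun a b q => by
    fin_cases b <;> exact pd_const _ _ _
  rw [IsKillingOn, and_iff_right hd]
  refine forall₂_congr fun q _ => ?_
  simp only [covForm, h0, Fin.forall_fin_two, Fin.sum_univ_two]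
  simp only [dX, thomas]
  simp
  tauto

theorem IsKillingOn.congr {Γ : Conn} {K K' : Fin 2 → ℝ × ℝ → ℝ} (hU : IsOpen U)
    (h : IsKillingOn Γ K U) (hK : ∀ q ∈ U, ∀ a, K' a q = K a q) : IsKillingOn Γ K' U := by
  refine ⟨fun a => (h.1 a).congr fun q hq => hK q hq a, fun q hq a b => ?_⟩
  rw [← h.2 q hq a b]
  simp only [covForm, hK q hq]
  rw [pd_congr hU (fun r hr => hK r hr b) hq a, pd_congr hU (fun r hr => hK r hr a) hq b]

theorem IsKillingOn.mono {Γ : Conn} {K : Fin 2 → ℝ × ℝ → ℝ} {V : Set (ℝ × ℝ)}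
    (h : IsKillingOn Γ K U) (hV : V ⊆ U) : IsKillingOn Γ K V :=
  ⟨fun a => (h.1 a).mono hV, fun q hq => h.2 q (hV hq)⟩

/-- An equation with a Killing form that does not vanish at `p` can be brought to the form
`Y'' = f(X, Y)` near `p`. -/
theorem IsKillingOn.exists_isPointTransformation {K : Fin 2 → ℝ × ℝ → ℝ}
    (h : IsKillingOn (thomas A) K U) (hn : 2 ≤ n) (hU : IsOpen U) (hp : p ∈ U)
    (hK : ∀ a, ContDiffOn ℝ ((n + 1 : ℕ∞) : WithTop ℕ∞) (K a) U) (h0 : ∃ a, K a p ≠ 0) :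
    ∃ (φ : OpenPartialHomeomorph (ℝ × ℝ) (ℝ × ℝ)) (f : ℝ × ℝ → ℝ), p ∈ φ.source ∧
      φ.source ⊆ U ∧ IsPointTransformation n φ A ![f, fun _ => 0, fun _ => 0, fun _ => 0] := by
  obtain ⟨φ, g, c, hpφ, hφU, h1, h2, hg, hKg, hc, hgc⟩ :=
    exists_rectification (le_trans (by norm_num) hn) hU hp hK h0
  have hn' : (2 : WithTop ℕ∞) ≤ n := WithTop.coe_le_coe.2 hn
  have hT := (isKillingOn_smul_iff (A := A) φ.open_source (contDiffOn_fst_comp (h1.of_le hn'))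
    (contDiffOn_snd_comp (h1.of_le hn')) hg hc hgc).1
    ((h.mono hφU).congr φ.open_source fun q hq a => (hKg q hq a).symm)
  -- The value `F` is found separately at each point. `IsPointTransformation` asks for no regularity
  -- of the right-hand side, so any such choice, carried over by `φ.symm`, serves as `f`.
  choose! F hF using hT
  refine ⟨φ, fun r => F (φ.symm r), hpφ, hφU,
    TransformsTo.isPointTransformation hn h1 h2 fun q hq => ?_⟩
  rw [φ.left_inv hq]
  exact hF q hq

/-- If local coordinates `(X, Y)` bring an equation to the form `Y'' = f(X, Y)`, then a multiple
of `dX` is a Killing form of the equation. -/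
theorem IsPointTransformation.exists_isKillingOn {Ω : Set (ℝ × ℝ)} {f : ℝ × ℝ → ℝ}
    (h : IsPointTransformation n φ A ![f, fun _ => 0, fun _ => 0, fun _ => 0]) (hn : 4 ≤ n)
    (hΩ : IsOpen Ω) (hA : ∀ i, ContDiffOn ℝ 1 (A i) Ω) (hφΩ : φ.source ⊆ Ω) :
    ∃ K : Fin 2 → ℝ × ℝ → ℝ, (∀ a, ContDiffOn ℝ 3 (K a) φ.source) ∧
      IsKillingOn (thomas A) K φ.source ∧ ∀ q ∈ φ.source, ∃ a, K a q ≠ 0 := by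
  have hn2 : 2 ≤ n := le_trans (by norm_num) hn
  have hn' : (4 : WithTop ℕ∞) ≤ n := WithTop.coe_le_coe.2 hn
  have h1 : ContDiffOn ℝ 4 φ φ.source := h.contDiffOn.of_le hn'
  have h2 : ContDiffOn ℝ 4 φ.symm φ.target := h.contDiffOn_symm.of_le hn'
  have hX := contDiffOn_fst_comp h1
  have hY := contDiffOn_snd_comp h1
  have hJ : ContDiffOn ℝ 3 (jac (fun q => (φ q).1) (fun q => (φ q).2)) φ.source :=
    contDiffOn_jac φ.open_source hX hY (by norm_num)
  have hJ0 : ∀ q ∈ φ.source, jac (fun q => (φ q).1) (fun q => (φ q).2) q ≠ 0 := fun q hq =>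
    jac_ne_zero φ (h1.differentiableOn (by norm_num)) (h2.differentiableOn (by norm_num)) hq
  -- The weight `J^(-2/3)`, written as a power of `J²` because `J` may be negative.
  let g : ℝ × ℝ → ℝ := fun q => (jac (fun q => (φ q).1) (fun q => (φ q).2) q ^ 2) ^ (-1 / 3 : ℝ)
  have hg : ContDiffOn ℝ 3 g φ.source :=
    (hJ.pow 2).rpow_const_of_ne fun q hq => pow_ne_zero 2 (hJ0 q hq)
  have hgJ : ∀ q ∈ φ.source, g q ^ 3 * jac (fun q => (φ q).1) (fun q => (φ q).2) q ^ 2 = 1 := by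
    intro q hq
    have hpos := pow_pos (abs_pos.2 (hJ0 q hq)) 2
    rw [sq_abs] at hpos
    simp only [g]
    rw [← Real.rpow_natCast, ← Real.rpow_mul hpos.le]
    norm_num
    rw [Real.rpow_neg_one, inv_mul_cancel₀ hpos.ne']
  refine ⟨fun a q => g q * pd a (fun q => (φ q).1) q, fun a =>
    hg.mul (hX.pd_of_le φ.open_source (by norm_num) a), ?_, fun q hq => ?_⟩
  · refine (isKillingOn_smul_iff φ.open_source (hX.of_le (by norm_num)) (hY.of_le (by norm_num))
      (hg.differentiableOn (by norm_num)) one_ne_zero hgJ).2 fun q hq => ⟨f (φ q), ?_⟩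
    exact h.transformsTo hn2 hΩ hA hφΩ hq
  · by_contra! h0
    have hgq : g q ≠ 0 := fun h => by simpa [h] using hgJ q hq
    have e0 := (mul_eq_zero.1 (h0 0)).resolve_left hgq
    have e1 := (mul_eq_zero.1 (h0 1)).resolve_left hgq
    exact hJ0 q hq (by simp [jac, e0, e1])

/-- A point transformation depends on the coefficients of the target equation only through their
values on the image of the coordinates. -/
theorem IsPointTransformation.congr {B' : Fin 4 → ℝ × ℝ → ℝ} (h : IsPointTransformation n φ A B)
    (hB : ∀ i, ∀ q ∈ φ.target, B' i q = B i q) : IsPointTransformation n φ A B' := by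
  refine ⟨h.contDiffOn, h.contDiffOn_symm, fun I J y η hI hI' hJ hJ' hy hη hgr himg => ?_⟩
  rw [h.solvesOn_iff I J y η hI hI' hJ hJ' hy hη hgr himg, SolvesOn, SolvesOn]
  refine and_congr_right fun _ => forall₂_congr fun x hx => ?_
  have hm : (x, η x) ∈ φ '' graphOver y I := himg ▸ ⟨x, hx, rfl⟩
  have hm' : (x, η x) ∈ φ.target := by
    obtain ⟨r, hr, he⟩ := hm
    exact he ▸ φ.map_source (hgr hr)
  simp only [hB _ _ hm']

end

end ProjectiveODE

end

/-! ### The theorem -/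

open ProjectiveODE in
theorem theorem5p6 (n : ℕ∞) (hn : 4 ≤ n)
    (Ω : Set (ℝ × ℝ)) (hΩ : IsOpen Ω)
    (A : Fin 4 → ℝ × ℝ → ℝ) (hA : ∀ i, ContDiffOn ℝ n (A i) Ω)
    (p : ℝ × ℝ) (hp : p ∈ Ω) (hL : ∃ a, liouvilleL A a p ≠ 0) :
    List.TFAE
      [ ∃ (φ : OpenPartialHomeomorph (ℝ × ℝ) (ℝ × ℝ)) (f : ℝ × ℝ → ℝ),
          p ∈ φ.source ∧ φ.source ⊆ Ω ∧
          IsPointTransformation n φ A ![f, fun _ => 0, fun _ => 0, fun _ => 0],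
        ∀ᶠ q in 𝓝 p, nu5 A q = 0 ∧ w1 A q = 0,
        ∃ (φ : OpenPartialHomeomorph (ℝ × ℝ) (ℝ × ℝ)) (B : Fin 4 → ℝ × ℝ → ℝ),
          p ∈ φ.source ∧ φ.source ⊆ Ω ∧
          IsPointTransformation n φ A B ∧ IsKillingOn (thomas B) dX φ.target ] ∧
    ∀ (φ : OpenPartialHomeomorph (ℝ × ℝ) (ℝ × ℝ)) (B : Fin 4 → ℝ × ℝ → ℝ),
      φ.source ⊆ Ω → IsPointTransformation n φ A B →
      ((∀ q ∈ φ.target, B 1 q = 0 ∧ B 2 q = 0 ∧ B 3 q = 0) ↔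
        IsKillingOn (thomas B) dX φ.target) := by
  refine ⟨?_, fun φ B _ _ => isKillingOn_dX_iff.symm⟩
  have hn' : (4 : WithTop ℕ∞) ≤ n := WithTop.coe_le_coe.2 hn
  have hA4 : ∀ i, ContDiffOn ℝ 4 (A i) Ω := fun i => (hA i).of_le hn'
  tfae_have 1 → 2 := by
    rintro ⟨φ, f, hpφ, hφΩ, h⟩
    obtain ⟨K, hK, hKill, hK0⟩ := h.exists_isKillingOn hn hΩ
      (fun i => (hA4 i).of_le (by norm_num)) hφΩ
    filter_upwards [φ.open_source.mem_nhds hpφ] with q hq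
    have hA4' := fun i => (hA4 i).mono hφΩ
    exact ⟨hKill.nu5_eq_zero φ.open_source hK hA4' hq (hK0 q hq),
      hKill.w1_eq_zero φ.open_source hK hA4' hq (hK0 q hq)⟩
  tfae_have 2 → 1 := by
    intro h
    obtain ⟨U, K, hU, hpU, hUΩ, hK, hKill, hK0⟩ := exists_isKillingOn hΩ hA4 hp hL h
    have hn2 : 2 ≤ n := le_trans (by norm_num) hn
    -- The Killing form was constructed only of class `C²`; rectification by coordinates of class
    -- `Cⁿ` needs `Cⁿ⁺¹`, which the closed system supplies.
    obtain ⟨φ, f, hpφ, hφU, hφ⟩ := hKill.exists_isPointTransformation hn2 hU hpU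
      (hKill.contDiffOn hU hn2 (fun i => (hA i).mono hUΩ) hK) hK0
    exact ⟨φ, f, hpφ, hφU.trans hUΩ, hφ⟩
  tfae_have 1 → 3 := by
    rintro ⟨φ, f, hpφ, hφΩ, h⟩
    exact ⟨φ, _, hpφ, hφΩ, h, isKillingOn_dX_iff.2 fun _ _ => ⟨rfl, rfl, rfl⟩⟩
  tfae_have 3 → 1 := by
    rintro ⟨φ, B, hpφ, hφΩ, h, hKill⟩
    -- The Killing condition controls the other coefficients only on `φ.target`; replacing them by
    -- zero elsewhere does not affect the transformation.
    refine ⟨φ, B 0, hpφ, hφΩ, h.congr fun i q hq => ?_⟩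
    obtain ⟨h1, h2, h3⟩ := isKillingOn_dX_iff.1 hKill q hq
    fin_cases i
    · rfl
    · exact h1.symm
    · exact h2.symm
    · exact h3.symm
  tfae_finish
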